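/- Let $\Gamma$ be a finite group, $\Gamma_*$ its set of conjugacy classes, $R(\Gamma)$ the space of complex class functions on $\Gamma$, $R_{\mathbb Z}(\Gamma)\subset R(\Gamma)$ the lattice of virtual characters, $\xi\in R_{\mathbb Z}(\Gamma)$ a self-dual virtual character, and $\langle f,g\rangle_\xi=|\Gamma|^{-1}\sum_{x\in\Gamma}\xi(x)f(x)g(x^{-1})$. *Groups.* Let $\Pi_n$ be generated by $a_1,\dots,a_n$ and a central element $z$ with $a_i^2=z$, $z^2=1$, $a_ia_j=za_ja_i$ ($i\ne j$), and let $\widetilde\Gamma_n=(\Gamma^n\times\Pi_n)\rtimes S_n$, graded by: $a_i$ odd, $\Gamma^n$ and $S_n$ even. $R^-(\widetilde\Gamma_n)$ is the space of class functions $f$ on $\widetilde\Gamma_n$ with $f(zx)=-f(x)$ that vanish on odd elements, and $\widetilde R_\Gamma=\bigoplus_{n\ge0}R^-(\widetilde\Gamma_n)$. Let $\widetilde\Gamma_n\hat\times\widetilde\Gamma_m\subset\widetilde\Gamma_{n+m}$ be the subgroup generated by the standard copies of $\widetilde\Gamma_n$ and $\widetilde\Gamma_m$. *Group-theoretic operators.*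 For $\gamma\in R(\Gamma)$ let $\eta_n(\gamma)$ be the class function on $\Gamma^n\rtimes S_n$ with value $\prod_{c}\gamma(c)^{l(\rho(c))}$ at elements of type $\rho$ (for the character of a $\Gamma$-module $V$ it is the character of $V^{\otimes n}$), and $\chi_n(\gamma)=\eta_n(\gamma)\cdot\chi_n$, where $\chi_n$ is the character of $\Pi_n\rtimes S_n$ on the Clifford algebra with generators $e_1,\dots,e_n$, $e_ie_j+e_je_i=-2\delta_{ij}$ ($a_i$ acts by left multiplication by $e_i$, $s\in S_n$ by $e_i\mapsto e_{s(i)}$). On $\widetilde R_\Gamma$, for $n\ge0$, $$H_{-n}(\gamma)f=\mathrm{Ind}\,(\chi_n(\gamma)\otimes f),\qquad H_n(\gamma)f=\langle\chi_n(\gamma),\mathrm{Res}\,f\rangle_\xi,$$ with $\mathrm{Ind}$ from and $\mathrm{Res}$ to the subgroups $\widetilde\Gamma_n\hat\times\widetilde\Gamma_m$, where the pairing is in the variable of $\widetilde\Gamma_n$ and $\langle f,g\rangle_\xi=|\widetilde\Gamma_n|^{-1}\sum_x\eta_n(\xi)(x)f(x)g(x^{-1})$. Put $$H_+(\gamma,z)=\sum_{n\ge0}H_{-n}(\gamma)z^n,\qquad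 H_-(\gamma,z)=\sum_{n\ge0}H_n(\gamma)z^{-n}.$$ *Fock space.* Let $S^-_\Gamma$ be the symmetric algebra generated by the elements $a_{-n}(\gamma)$, $n\ge1$ odd, linear in $\gamma\in R(\Gamma)$. Here $a_{-n}(\gamma)$ acts by multiplication and $a_n(\gamma)$ is the derivation with $a_n(\gamma)\,a_{-m}(\beta)=\frac n2\delta_{n,m}\langle\gamma,\beta\rangle_\xi$. Let $\zeta_c$ be the order of the centralizer of an element of $c\in\Gamma_*$ and let $a_{-n}(c)$ be $a_{-n}$ of the class function equal to $\zeta_c$ on $c$ and $0$ elsewhere. The characteristic map $\mathrm{ch}:\widetilde R_\Gamma\to S^-_\Gamma$ is $$\mathrm{ch}(f)=\sum_\rho Z_\rho^{-1}f_\rho\prod_{c\in\Gamma_*}\prod_{i\in\rho(c)}a_{-i}(c),\qquad f\in R^-(\widetilde\Gamma_n),$$ where $\rho$ runs over the partition-valued functions on $\Gamma_*$ of total size $n$ with odd parts, $f_\rho$ is the value of $f$ at the elements $(g,s)\in\Gamma^n\rtimes S_n$ of type $\rho$, and $Z_\rho=\prod_{c,i}i^{m_i(c)}m_i(c)!\,\zeta_c^{m_i(c)}$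 with $m_i(c)$ the multiplicity of $i$ in $\rho(c)$. *Vertex operators.* For $\alpha,\beta\in R_{\mathbb Z}(\Gamma)$ let $c_1(\alpha,\beta)=\langle\alpha,\beta\rangle_\xi+\langle\alpha,\alpha\rangle_\xi\langle\beta,\beta\rangle_\xi\bmod 2$, let $\Phi\supseteq2R_{\mathbb Z}(\Gamma)$ be a subgroup of $R_{\mathbb Z}(\Gamma)$ maximal with $c_1|_{\Phi\times\Phi}=0$, and fix a central extension of $R_{\mathbb Z}(\Gamma)/2R_{\mathbb Z}(\Gamma)$ by $\{\pm1\}$ with commutator map $(-1)^{c_1}$, lifts $e_{\bar\alpha}$ of the elements $\bar\alpha$, and an irreducible module structure over it on $\mathbb C[R_{\mathbb Z}(\Gamma)/\Phi]$ in which $-1$ acts by $-1$ and $e_{\bar\alpha}e^{[\beta]}=\epsilon(\alpha,\beta)e^{[\alpha+\beta]}$ with $\epsilon(\alpha,\beta)=\pm1$. For $\gamma\in R_{\mathbb Z}(\Gamma)$ put $X(\gamma,z)=H_+(\gamma,z)H_-(\gamma,-z)e_{\bar\gamma}=\sum_{n\in\mathbb Z}X_n(\gamma)z^{-n}$ on $\widetilde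 R_\Gamma\otimes\mathbb C[R_{\mathbb Z}(\Gamma)/\Phi]$. **Theorem.** The map $\mathrm{ch}$ is a linear isomorphism, and after extending it to operators by $\mathrm{ch}(A)\,\mathrm{ch}(v)=\mathrm{ch}(Av)$ one has, for every $\gamma\in R(\Gamma)$, $$\mathrm{ch}\bigl(H_+(\gamma,z)\bigr)=\exp\Bigl(\sum_{n\ge1,\ \mathrm{odd}}\tfrac2n\,a_{-n}(\gamma)z^n\Bigr),\qquad \mathrm{ch}\bigl(H_-(\gamma,z)\bigr)=\exp\Bigl(\sum_{n\ge1,\ \mathrm{odd}}\tfrac2n\,a_n(\gamma)z^{-n}\Bigr).$$ Consequently, for $\gamma\in R_{\mathbb Z}(\Gamma)$ and for every choice of $\Phi$ and of the module as above, the coefficients of $X(\gamma,z)$ are well defined (each vector is killed by all but finitely many coefficients of $H_-(\gamma,-z)$, and likewise of the second exponential below), and, extending $\mathrm{ch}$ by the identity on $\mathbb C[R_{\mathbb Z}(\Gamma)/\Phi]$, $$\mathrm{ch}\bigl(X(\gamma,z)\bigr)=\exp\Bigl(\sum_{n\ge1,\ \mathrm{odd}}\tfrac2n\,a_{-n}(\gamma)z^n\Bigr)\exp\Bigl(-\sum_{n\ge1,\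 \mathrm{odd}}\tfrac2n\,a_n(\gamma)z^{-n}\Bigr)e_{\bar\gamma},$$ the twisted vertex operator of Frenkel, Lepowsky and Meurman. -/

import Mathlib

namespace SpinWreath

open scoped Classical TensorProduct

/-! ### The group `Π_n` -/

/-- The group `Π_n` generated by `a_1, …, a_n` and a central element `z` subject to
`a_i² = z`, `z² = 1`, `a_i a_j = z a_j a_i` (`i ≠ j`), in normal form: the element
`⟨k, u⟩` is `z ^ k * a_1 ^ (u 1) * ⋯ * a_n ^ (u n)`, and its order is `2 ^ (n + 1)`. -/
@[ext]
structure PiGroup (n : ℕ) where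
  /-- the exponent of `z` -/
  zexp : ZMod 2
  /-- the exponents of `a_1, …, a_n` -/
  supp : Fin n → ZMod 2

namespace PiGroup

variable {n : ℕ}

/-- The power of `z` produced by bringing `(∏ a_i ^ (u i)) * (∏ a_j ^ (v j))` to normal form:
one factor `z` for every pair `j < i` (a transposition) and every `i = j` (a square). -/
def cocycle (u v : Fin n → ZMod 2) : ZMod 2 :=
  ∑ i, ∑ j, if j ≤ i then u i * v j else 0

theorem cocycle_add_left (u u' v : Fin n → ZMod 2) :
    cocycle (u + u') v = cocycle u v + cocycle u' v := by
  simp only [cocycle, ← Finset.sum_add_distrib]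
  refine Finset.sum_congr rfl fun i _ => Finset.sum_congr rfl fun j _ => ?_
  split_ifs <;> simp [add_mul]

theorem cocycle_add_right (u v v' : Fin n → ZMod 2) :
    cocycle u (v + v') = cocycle u v + cocycle u v' := by
  simp only [cocycle, ← Finset.sum_add_distrib]
  refine Finset.sum_congr rfl fun i _ => Finset.sum_congr rfl fun j _ => ?_
  split_ifs <;> simp [mul_add]

theorem cocycle_zero_left (v : Fin n → ZMod 2) : cocycle 0 v = 0 := by simp [cocycle]

theorem cocycle_zero_right (v : Fin n → ZMod 2) : cocycle v 0 = 0 := by simp [cocycle]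

theorem two_vec (u : Fin n → ZMod 2) : u + u = 0 := by
  funext i; exact CharTwo.add_self_eq_zero (u i)

instance : Mul (PiGroup n) :=
  ⟨fun a b => ⟨a.zexp + b.zexp + cocycle a.supp b.supp, a.supp + b.supp⟩⟩

instance : One (PiGroup n) := ⟨⟨0, 0⟩⟩

instance : Inv (PiGroup n) := ⟨fun a => ⟨a.zexp + cocycle a.supp a.supp, a.supp⟩⟩

@[simp] theorem mul_zexp (a b : PiGroup n) :
    (a * b).zexp = a.zexp + b.zexp + cocycle a.supp b.supp := rfl
@[simp] theorem mul_supp (a b : PiGroup n) : (a * b).supp = a.supp + b.supp := rfl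
@[simp] theorem one_zexp : (1 : PiGroup n).zexp = 0 := rfl
@[simp] theorem one_supp : (1 : PiGroup n).supp = 0 := rfl

instance : Group (PiGroup n) :=
  Group.ofLeftAxioms
    (fun a b c => by
      ext1
      · simp only [mul_zexp, mul_supp, cocycle_add_left, cocycle_add_right]; ring
      · simp only [mul_supp, add_assoc])
    (fun a => by ext1 <;> simp [cocycle_zero_left])
    (fun a => by
      ext1
      · show a.zexp + cocycle a.supp a.supp + a.zexp + cocycle a.supp a.supp = 0
        have h1 := CharTwo.add_self_eq_zero (a.zexp + cocycle a.supp a.supp)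
        rw [← h1]; ring
      · exact two_vec a.supp)

/-- The central element `z`. -/
def z : PiGroup n := ⟨1, 0⟩

/-- The generator `a_i`. -/
def gen (i : Fin n) : PiGroup n := ⟨0, Pi.single i 1⟩

theorem cocycle_single (i j : Fin n) :
    cocycle (Pi.single i 1) (Pi.single j 1) = if j ≤ i then 1 else 0 := by
  unfold cocycle
  rw [Finset.sum_eq_single i, Finset.sum_eq_single j]
  · simp
  · intro b _ hb; simp [Pi.single_eq_of_ne hb]
  · simp
  · intro b _ hb; simp [Pi.single_eq_of_ne hb]
  · simp

theorem gen_mul_self (i : Fin n) : gen i * gen i = (z : PiGroup n) := by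
  ext1
  · simp [gen, z, cocycle_single]
  · exact two_vec _

theorem z_mul_z : (z : PiGroup n) * z = 1 := by
  ext1
  · simp only [mul_zexp, z, cocycle_zero_left, one_zexp]; decide
  · simp [z]

theorem z_mul (a : PiGroup n) : z * a = a * z := by
  ext1
  · simp [z, cocycle_zero_left, cocycle_zero_right, add_comm]
  · simp [z]

theorem gen_mul_gen {i j : Fin n} (h : i ≠ j) :
    gen i * gen j = z * (gen j * gen i : PiGroup n) := by
  ext1
  · simp only [gen, z, mul_zexp, mul_supp, cocycle_single, cocycle_zero_left]
    rcases lt_or_gt_of_ne h with h | h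
    · simp [h.le, not_le.2 h]
      decide
    · simp [h.le, not_le.2 h]
  · simp [gen, z, add_comm]

theorem closure_eq_top : Subgroup.closure (insert z (Set.range gen)) = (⊤ : Subgroup (PiGroup n)) := by
  rw [eq_top_iff]
  set H := Subgroup.closure (insert z (Set.range (gen (n := n)))) with hH
  have hz : (z : PiGroup n) ∈ H := Subgroup.subset_closure (Set.mem_insert _ _)
  have hg : ∀ i, gen i ∈ H := fun i =>
    Subgroup.subset_closure (Set.mem_insert_of_mem _ ⟨i, rfl⟩)
  have hk : ∀ k : ZMod 2, (⟨k, 0⟩ : PiGroup n) ∈ H := by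
    intro k
    fin_cases k
    · exact H.one_mem
    · exact hz
  have key : ∀ (s : Finset (Fin n)) (k : ZMod 2) (u : Fin n → ZMod 2),
      (∀ i, i ∉ s → u i = 0) → (⟨k, u⟩ : PiGroup n) ∈ H := by
    intro s
    induction s using Finset.induction_on with
    | empty =>
      intro k u hu
      have : u = 0 := funext fun i => hu i (by simp)
      rw [this]; exact hk k
    | insert i s hi ih =>
      intro k u hu
      by_cases h0 : u i = 0
      · exact ih k u fun j hj => by
          by_cases hji : j = i
          · rw [hji]; exact h0
          · exact hu j (by simp [hji, hj])
      · have h1 : u i = 1 := by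
          generalize u i = t at h0
          fin_cases t
          · exact absurd rfl h0
          · rfl
        have hm := H.mul_mem (hg i)
          (ih (k + cocycle (Pi.single i 1) (u + Pi.single i 1)) (u + Pi.single i 1)
            (fun j hj => by
              by_cases hji : j = i
              · subst hji
                simp only [Pi.add_apply, h1, Pi.single_eq_same]; decide
              · simp [Pi.single_eq_of_ne hji, hu j (by simp [hji, hj])]))
        convert hm using 1
        ext1
        · simp only [gen, mul_zexp, zero_add]
          rw [add_assoc, CharTwo.add_self_eq_zero, add_zero]
        · show u = Pi.single i 1 + (u + Pi.single i 1)
          rw [add_comm u, ← add_assoc, two_vec, zero_add]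
  intro a _
  exact key Finset.univ a.zexp a.supp (fun i hi => absurd (Finset.mem_univ i) hi)

theorem hom_ext {G : Type*} [Group G] {f g : PiGroup n →* G} (hz : f z = g z)
    (hg : ∀ i, f (gen i) = g (gen i)) : f = g := by
  refine MonoidHom.eq_of_eqOn_dense closure_eq_top ?_
  intro x hx
  rcases hx with rfl | ⟨i, rfl⟩
  · exact hz
  · exact hg i

/-- The action of a permutation `s` on `Π_n`, i.e. the automorphism with `a_i ↦ a_{s(i)}` and
`z ↦ z`: in normal form one factor `z` appears for every inversion of `s` inside the support. -/
def permuteHom (s : Equiv.Perm (Fin n)) : PiGroup n →* PiGroup n where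
  toFun a := ⟨a.zexp + ∑ i, ∑ j, if i < j ∧ s j < s i then a.supp i * a.supp j else 0,
    fun i => a.supp (s.symm i)⟩
  map_one' := by ext1 <;> simp; rfl
  map_mul' a b := by
    ext1
    · obtain ⟨k, u⟩ := a
      obtain ⟨l, v⟩ := b
      simp only [mul_zexp, mul_supp]
      have e1 : cocycle (fun i => u (s.symm i)) (fun i => v (s.symm i)) =
          ∑ i, ∑ j, if s j ≤ s i then u i * v j else 0 := by
        unfold cocycle
        rw [← Equiv.sum_comp s]
        refine Finset.sum_congr rfl fun i _ => ?_
        rw [← Equiv.sum_comp s]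
        simp
      have e2 : (∑ i, ∑ j, if i < j ∧ s j < s i then v i * u j else 0) =
          ∑ i, ∑ j, if j < i ∧ s i < s j then u i * v j else 0 := by
        rw [Finset.sum_comm]
        refine Finset.sum_congr rfl fun i _ => Finset.sum_congr rfl fun j _ => ?_
        rw [mul_comm]
      have e3 : (∑ i, ∑ j, if i < j ∧ s j < s i then (u + v) i * (u + v) j else 0) =
          (∑ i, ∑ j, if i < j ∧ s j < s i then u i * u j else 0) +
          (∑ i, ∑ j, if i < j ∧ s j < s i then v i * v j else 0) +
          (∑ i, ∑ j, if i < j ∧ s j < s i then u i * v j else 0) +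
          (∑ i, ∑ j, if j < i ∧ s i < s j then u i * v j else 0) := by
        rw [← e2]
        simp only [← Finset.sum_add_distrib]
        refine Finset.sum_congr rfl fun i _ => Finset.sum_congr rfl fun j _ => ?_
        split_ifs
        · simp only [Pi.add_apply]; ring
        · simp
      have e4 : cocycle u v + (∑ i, ∑ j, if i < j ∧ s j < s i then u i * v j else 0) +
          (∑ i, ∑ j, if j < i ∧ s i < s j then u i * v j else 0) =
          ∑ i, ∑ j, if s j ≤ s i then u i * v j else 0 := by
        unfold cocycle
        simp only [← Finset.sum_add_distrib]
        refine Finset.sum_congr rfl fun i _ => Finset.sum_congr rfl fun j _ => ?_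
        have h2 : u i * v j + u i * v j = 0 := CharTwo.add_self_eq_zero _
        rcases lt_trichotomy i j with h | h | h
        · rcases lt_or_gt_of_ne (fun hh => h.ne (s.injective hh) : s i ≠ s j) with h' | h'
          · simp [h, h', h.not_ge, h.not_gt, h'.not_gt, h'.not_ge]
          · simp [h, h', h.not_ge, h.not_gt, h'.not_gt, h'.le]
        · subst h; simp
        · rcases lt_or_gt_of_ne (fun hh => h.ne' (s.injective hh) : s i ≠ s j) with h' | h'
          · simp [h, h', h.le, h.not_gt, h'.not_gt, h'.not_ge, h2]
          · simp [h, h', h.le, h.not_gt, h'.not_gt, h'.le]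
      rw [e1, e3, ← e4]
      ring
    · rfl

theorem permuteHom_z (s : Equiv.Perm (Fin n)) : permuteHom s z = z := by
  ext1 <;> simp [permuteHom, z]; rfl

theorem permuteHom_gen (s : Equiv.Perm (Fin n)) (i : Fin n) :
    permuteHom s (gen i) = gen (s i) := by
  ext1
  · simp only [permuteHom, gen, MonoidHom.coe_mk, OneHom.coe_mk, zero_add]
    refine Finset.sum_eq_zero fun a _ => Finset.sum_eq_zero fun b _ => ?_
    split_ifs with h
    · by_cases ha : a = i
      · have hb : b ≠ i := fun hb => h.1.ne (ha.trans hb.symm)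
        simp [Pi.single_eq_of_ne hb]
      · simp [Pi.single_eq_of_ne ha]
    · rfl
  · funext j
    simp only [permuteHom, gen, MonoidHom.coe_mk, OneHom.coe_mk, Pi.single_apply]
    simp [Equiv.symm_apply_eq]

theorem permuteHom_mul (s t : Equiv.Perm (Fin n)) :
    permuteHom (s * t) = (permuteHom s).comp (permuteHom t) :=
  hom_ext (by simp [permuteHom_z]) (fun i => by simp [permuteHom_gen])

theorem permuteHom_one : permuteHom (1 : Equiv.Perm (Fin n)) = MonoidHom.id _ :=
  hom_ext (by simp [permuteHom_z]) (fun i => by simp [permuteHom_gen])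

end PiGroup

/-! ### The group `Γ̃_n` -/

section Groups

variable (Γ : Type*) [Group Γ]

/-- The action of `S_n` on `Γ^n × Π_n` by simultaneous permutations:
`s (g_1, …, g_n) = (g_{s⁻¹(1)}, …, g_{s⁻¹(n)})` and `s (a_i) = a_{s(i)}`. -/
def permAct (n : ℕ) : Equiv.Perm (Fin n) →* MulAut ((Fin n → Γ) × PiGroup n) where
  toFun s :=
    { toFun := fun x => (fun i => x.1 (s.symm i), PiGroup.permuteHom s x.2)
      invFun := fun x => (fun i => x.1 (s i), PiGroup.permuteHom s⁻¹ x.2)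
      left_inv := fun x => by
        refine Prod.ext (funext fun i => by simp) ?_
        show (PiGroup.permuteHom s⁻¹).comp (PiGroup.permuteHom s) x.2 = x.2
        rw [← PiGroup.permuteHom_mul, inv_mul_cancel, PiGroup.permuteHom_one]; rfl
      right_inv := fun x => by
        refine Prod.ext (funext fun i => by simp) ?_
        show (PiGroup.permuteHom s).comp (PiGroup.permuteHom s⁻¹) x.2 = x.2
        rw [← PiGroup.permuteHom_mul, mul_inv_cancel, PiGroup.permuteHom_one]; rfl
      map_mul' := fun x y => Prod.ext rfl (map_mul (PiGroup.permuteHom s) x.2 y.2) }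
  map_one' := by
    refine MulEquiv.ext fun x => Prod.ext rfl ?_
    show PiGroup.permuteHom 1 x.2 = x.2
    rw [PiGroup.permuteHom_one]; rfl
  map_mul' s t := by
    refine MulEquiv.ext fun x => Prod.ext rfl ?_
    show PiGroup.permuteHom (s * t) x.2 = _
    rw [PiGroup.permuteHom_mul]; rfl

/-- The finite group `Γ̃_n = (Γ^n × Π_n) ⋊ S_n`. -/
abbrev BG (n : ℕ) : Type _ := SemidirectProduct ((Fin n → Γ) × PiGroup n) (Equiv.Perm (Fin n)) (permAct Γ n)

instance (n : ℕ) : Finite (PiGroup n) :=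
  Finite.of_injective (fun a : PiGroup n => (a.zexp, a.supp)) fun a b h => by
    simp only [Prod.mk.injEq] at h
    exact PiGroup.ext h.1 h.2

instance [Finite Γ] (n : ℕ) : Finite (BG Γ n) :=
  Finite.of_equiv _ (SemidirectProduct.equivProd (φ := permAct Γ n)).symm

noncomputable instance [Finite Γ] (n : ℕ) : Fintype (BG Γ n) := Fintype.ofFinite _

variable {Γ}

/-- The central element `z` of `Γ̃_n`. -/
def zBG (n : ℕ) : BG Γ n := ⟨(1, PiGroup.z), 1⟩

/-- The element `(g, s)` of `Γ_n = Γ^n ⋊ S_n ⊆ Γ̃_n`. -/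
def ofWreath {n : ℕ} (g : Fin n → Γ) (s : Equiv.Perm (Fin n)) : BG Γ n := ⟨(g, 1), s⟩

/-- The parity `p`: `a_i` is odd, `z` and the elements of `Γ^n` and `S_n` are even. -/
def parity {n : ℕ} (x : BG Γ n) : ZMod 2 := ∑ i, x.left.2.supp i

theorem zBG_mul {n : ℕ} (x : BG Γ n) : zBG n * x = x * zBG n := by
  ext1
  · refine Prod.ext ?_ ?_
    · show 1 * x.left.1 = x.left.1 * fun i => 1
      simp; rfl
    · show PiGroup.z * (PiGroup.permuteHom 1) x.left.2 = x.left.2 * PiGroup.permuteHom _ PiGroup.z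
      rw [PiGroup.permuteHom_one, PiGroup.permuteHom_z]
      exact PiGroup.z_mul _
  · show 1 * x.right = x.right * 1
    simp

theorem zBG_mul_zBG {n : ℕ} : (zBG n : BG Γ n) * zBG n = 1 := by
  ext1
  · refine Prod.ext ?_ ?_
    · show (1 : Fin n → Γ) * (fun i => 1) = 1
      simp; rfl
    · show PiGroup.z * PiGroup.permuteHom _ PiGroup.z = 1
      rw [PiGroup.permuteHom_z, PiGroup.z_mul_z]
  · rfl

theorem parity_mul {n : ℕ} (x y : BG Γ n) : parity (x * y) = parity x + parity y := by
  show ∑ i, (x.left.2.supp i + y.left.2.supp (x.right.symm i)) = _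
  rw [Finset.sum_add_distrib, Equiv.sum_comp x.right.symm]
  rfl

theorem parity_zBG {n : ℕ} : parity (zBG n : BG Γ n) = 0 := by
  simp [parity, zBG, PiGroup.z]

theorem parity_conj {n : ℕ} (x y : BG Γ n) : parity (y * x * y⁻¹) = parity x := by
  have h : parity y + parity y⁻¹ = 0 := by
    rw [← parity_mul, mul_inv_cancel]; simp [parity]
  rw [parity_mul, parity_mul, add_right_comm, h, zero_add]

/-- The inclusion `Γ̃_n → Γ̃_m` induced by an increasing map `{1, …, n} → {1, …, m}`. -/
noncomputable def PiGroup.incl {n m : ℕ} (e : Fin n ↪o Fin m) : PiGroup n →* PiGroup m where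
  toFun a := ⟨a.zexp, Function.extend e a.supp 0⟩
  map_one' := by
    ext1
    · rfl
    · funext j
      by_cases hj : ∃ i, e i = j
      · obtain ⟨i, rfl⟩ := hj
        simp [e.injective.extend_apply]
      · simp [Function.extend_apply' _ _ _ hj]
  map_mul' a b := by
    have hs : ∀ (f : Fin m → ZMod 2), (∀ j, (¬ ∃ i, e i = j) → f j = 0) →
        ∑ j, f j = ∑ i, f (e i) := by
      intro f hf
      refine Eq.trans ?_ (Finset.sum_map Finset.univ e.toEmbedding f)
      refine (Finset.sum_subset (Finset.subset_univ _) fun j _ hj => hf j ?_).symm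
      rintro ⟨i, rfl⟩
      exact hj (Finset.mem_map_of_mem _ (Finset.mem_univ i))
    ext1
    · show a.zexp + b.zexp + PiGroup.cocycle a.supp b.supp = a.zexp + b.zexp +
        PiGroup.cocycle (Function.extend e a.supp 0) (Function.extend e b.supp 0)
      congr 1
      unfold PiGroup.cocycle
      rw [hs]
      · refine Finset.sum_congr rfl fun i _ => ?_
        rw [hs]
        · refine Finset.sum_congr rfl fun j _ => ?_
          simp [e.injective.extend_apply]
        · intro j hj
          simp [Function.extend_apply' _ _ _ hj]
      · intro j hj
        simp [Function.extend_apply' _ _ _ hj]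
    · funext j
      by_cases hj : ∃ i, e i = j
      · obtain ⟨i, rfl⟩ := hj
        simp [e.injective.extend_apply]
      · simp [Function.extend_apply' _ _ _ hj]

theorem PiGroup.incl_z {n m : ℕ} (e : Fin n ↪o Fin m) : PiGroup.incl e PiGroup.z = PiGroup.z := by
  ext1
  · rfl
  · funext j
    by_cases hj : ∃ i, e i = j
    · obtain ⟨i, rfl⟩ := hj
      simp [incl, z, e.injective.extend_apply]
    · simp [incl, z, Function.extend_apply' _ _ _ hj]

theorem PiGroup.incl_gen {n m : ℕ} (e : Fin n ↪o Fin m) (i : Fin n) :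
    PiGroup.incl e (PiGroup.gen i) = PiGroup.gen (e i) := by
  ext1
  · rfl
  · funext j
    by_cases hj : ∃ i, e i = j
    · obtain ⟨k, rfl⟩ := hj
      simp [incl, gen, e.injective.extend_apply, Pi.single_apply]
    · have hj' : j ≠ e i := fun h => hj ⟨i, h.symm⟩
      simp [incl, gen, Function.extend_apply' _ _ _ hj, Pi.single_eq_of_ne hj']

/-- The inclusion `Γ^n → Γ^m` induced by an injection `{1, …, n} → {1, …, m}`. -/
noncomputable def vecIncl {n m : ℕ} (e : Fin n ↪o Fin m) : (Fin n → Γ) →* (Fin m → Γ) where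
  toFun g := Function.extend e g 1
  map_one' := by
    funext j
    by_cases hj : ∃ i, e i = j
    · obtain ⟨i, rfl⟩ := hj
      simp [e.injective.extend_apply]
    · simp [Function.extend_apply' _ _ _ hj]
  map_mul' g h := by
    funext j
    by_cases hj : ∃ i, e i = j
    · obtain ⟨i, rfl⟩ := hj
      simp [e.injective.extend_apply]
    · simp [Function.extend_apply' _ _ _ hj]

theorem permuteHom_incl {n m : ℕ} (e : Fin n ↪o Fin m) (s : Equiv.Perm (Fin n)) :
    (PiGroup.permuteHom (Equiv.Perm.viaEmbedding s e.toEmbedding)).comp (PiGroup.incl e) =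
      (PiGroup.incl e).comp (PiGroup.permuteHom s) := by
  refine PiGroup.hom_ext (by simp [PiGroup.incl_z, PiGroup.permuteHom_z]) fun i => ?_
  have := Equiv.Perm.viaEmbedding_apply s e.toEmbedding i
  simp only [RelEmbedding.coe_toEmbedding] at this
  simp [PiGroup.incl_gen, PiGroup.permuteHom_gen, this]

theorem vecIncl_perm {n m : ℕ} (e : Fin n ↪o Fin m) (s : Equiv.Perm (Fin n)) (g : Fin n → Γ)
    (j : Fin m) : vecIncl e g ((Equiv.Perm.viaEmbedding s e.toEmbedding).symm j) =
      vecIncl e (fun i => g (s.symm i)) j := by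
  have hinv : (Equiv.Perm.viaEmbedding s e.toEmbedding).symm =
      Equiv.Perm.viaEmbedding s⁻¹ e.toEmbedding :=
    (map_inv (Equiv.Perm.viaEmbeddingHom e.toEmbedding) s).symm
  rw [hinv]
  by_cases hj : ∃ i, e i = j
  · obtain ⟨i, rfl⟩ := hj
    have := Equiv.Perm.viaEmbedding_apply s⁻¹ e.toEmbedding i
    simp only [RelEmbedding.coe_toEmbedding] at this
    rw [this]
    simp [vecIncl, e.injective.extend_apply]
  · have := Equiv.Perm.viaEmbedding_apply_of_notMem s⁻¹ e.toEmbedding j (by simpa using hj)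
    rw [this]
    simp [vecIncl, Function.extend_apply' _ _ _ hj]

/-- The inclusion `Γ̃_n → Γ̃_m` induced by an increasing map `e : {1, …, n} → {1, …, m}`; it sends
`a_i` to `a_{e(i)}`. -/
noncomputable def incl {n m : ℕ} (e : Fin n ↪o Fin m) : BG Γ n →* BG Γ m :=
  SemidirectProduct.map ((vecIncl e).prodMap (PiGroup.incl e))
    (Equiv.Perm.viaEmbeddingHom e.toEmbedding) (fun s => by
      refine MonoidHom.ext fun x => Prod.ext (funext fun j => ?_) ?_
      · exact (vecIncl_perm e s x.1 j).symm
      · exact (DFunLike.congr_fun (permuteHom_incl e s) x.2).symm)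

/-- `{1, …, n} → {1, …, m}` onto the first `n` elements. -/
def firstEmb {n k m : ℕ} (h : n + k = m) : Fin n ↪o Fin m := Fin.castLEOrderEmb (by omega)

/-- `{1, …, k} → {1, …, m}`, `i ↦ n + i`, onto the last `k` elements. -/
def lastEmb {n k m : ℕ} (h : n + k = m) : Fin k ↪o Fin m :=
  (Fin.natAddOrderEmb n).trans (Fin.castOrderIso h).toOrderEmbedding

theorem firstEmb_lt_lastEmb {n k m : ℕ} (h : n + k = m) (i : Fin n) (j : Fin k) :
    firstEmb h i < lastEmb h j := by
  simp [firstEmb, lastEmb, Fin.lt_def]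
  omega

/-- The canonical map `Γ̃_n → Γ̃_{n+k}`. -/
noncomputable def inclL {n k m : ℕ} (h : n + k = m) : BG Γ n →* BG Γ m := incl (firstEmb h)

/-- The canonical map `Γ̃_k → Γ̃_{n+k}`, `a_j ↦ a_{n+j}`. -/
noncomputable def inclR {n k m : ℕ} (h : n + k = m) : BG Γ k →* BG Γ m := incl (lastEmb h)

theorem incl_zBG {n m : ℕ} (e : Fin n ↪o Fin m) : incl e (zBG n : BG Γ n) = zBG m := by
  ext1
  · refine Prod.ext ?_ ?_
    · exact map_one (vecIncl e)
    · exact PiGroup.incl_z e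
  · exact map_one _

theorem parity_incl {n m : ℕ} (e : Fin n ↪o Fin m) (x : BG Γ n) : parity (incl e x) = parity x := by
  show ∑ j, Function.extend e x.left.2.supp 0 j = ∑ i, x.left.2.supp i
  have : ∑ i, x.left.2.supp i = ∑ i, Function.extend e x.left.2.supp 0 (e i) := by
    simp [e.injective.extend_apply]
  rw [this]
  refine Eq.trans ?_ (Finset.sum_map Finset.univ e.toEmbedding (Function.extend e x.left.2.supp 0))
  refine (Finset.sum_subset (Finset.subset_univ _) fun j _ hj => ?_).symm
  rw [Function.extend_apply']
  · rfl
  · rintro ⟨i, rfl⟩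
    exact hj (Finset.mem_map_of_mem _ (Finset.mem_univ i))

/-- The central element `z ^ k`. -/
def zPow (n : ℕ) (k : ZMod 2) : BG Γ n := ⟨(1, ⟨k, 0⟩), 1⟩

theorem zPow_mul {n : ℕ} (k : ZMod 2) (x : BG Γ n) :
    zPow n k * x = ⟨(x.left.1, ⟨k + x.left.2.zexp, x.left.2.supp⟩), x.right⟩ := by
  ext1
  · refine Prod.ext ?_ ?_
    · show 1 * x.left.1 = x.left.1
      simp
    · show (⟨k, 0⟩ : PiGroup n) * (PiGroup.permuteHom 1) x.left.2 = _
      rw [PiGroup.permuteHom_one]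
      ext1
      · simp [PiGroup.cocycle_zero_left]
      · simp
  · show 1 * x.right = x.right
    simp

theorem firstEmb_ne_lastEmb {n k m : ℕ} (h : n + k = m) (i : Fin n) (j : Fin k) :
    firstEmb h i ≠ lastEmb h j := (firstEmb_lt_lastEmb h i j).ne

theorem inclL_right_last {n k m : ℕ} (h : n + k = m) (s : Equiv.Perm (Fin n)) (j : Fin k) :
    Equiv.Perm.viaEmbedding s (firstEmb h).toEmbedding (lastEmb h j) = lastEmb h j :=
  Equiv.Perm.viaEmbedding_apply_of_notMem _ _ _ (by
    rintro ⟨i, hi⟩; exact firstEmb_ne_lastEmb h i j hi)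

theorem inclR_right_first {n k m : ℕ} (h : n + k = m) (s : Equiv.Perm (Fin k)) (j : Fin n) :
    Equiv.Perm.viaEmbedding s (lastEmb h).toEmbedding (firstEmb h j) = firstEmb h j :=
  Equiv.Perm.viaEmbedding_apply_of_notMem _ _ _ (by
    rintro ⟨i, hi⟩; exact firstEmb_ne_lastEmb h j i hi.symm)

theorem vecIncl_fixed {n m : ℕ} (e : Fin n ↪o Fin m) (s : Equiv.Perm (Fin m))
    (hs : ∀ i, s (e i) = e i) (g : Fin n → Γ) (j : Fin m) :
    vecIncl e g (s.symm j) = vecIncl e g j := by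
  by_cases hj : ∃ i, e i = j
  · obtain ⟨i, rfl⟩ := hj
    rw [s.symm_apply_eq.2 (hs i).symm]
  · have hj' : ¬ ∃ i, e i = s.symm j := by
      rintro ⟨i, hi⟩
      exact hj ⟨i, by rw [← hs i, hi, s.apply_symm_apply]⟩
    simp [vecIncl, Function.extend_apply' _ _ _ hj, Function.extend_apply' _ _ _ hj']

theorem permAct_fixed {n m : ℕ} (e : Fin n ↪o Fin m) (s : Equiv.Perm (Fin m))
    (hs : ∀ i, s (e i) = e i) (x : BG Γ n) :
    permAct Γ m s (incl e x).left = (incl e x).left := by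
  refine Prod.ext (funext fun j => vecIncl_fixed e s hs x.left.1 j) ?_
  show ((PiGroup.permuteHom s).comp (PiGroup.incl e)) x.left.2 = PiGroup.incl e x.left.2
  congr 1
  refine PiGroup.hom_ext (by simp [PiGroup.incl_z, PiGroup.permuteHom_z]) fun i => ?_
  simp [PiGroup.incl_gen, PiGroup.permuteHom_gen, hs]

theorem inclL_mul_inclR_left {n k m : ℕ} (h : n + k = m) (x : BG Γ n) (y : BG Γ k) :
    (inclL h x * inclR h y).left = (inclL h x).left * (inclR h y).left := by
  show (inclL h x).left * permAct Γ m _ (incl (lastEmb h) y).left = _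
  rw [permAct_fixed (lastEmb h) (inclL h x).right (inclL_right_last h x.right)]
  rfl

theorem inclR_mul_inclL_left {n k m : ℕ} (h : n + k = m) (x : BG Γ n) (y : BG Γ k) :
    (inclR h y * inclL h x).left = (inclR h y).left * (inclL h x).left := by
  show (inclR h y).left * permAct Γ m _ (incl (firstEmb h) x).left = _
  rw [permAct_fixed (firstEmb h) (inclR h y).right (inclR_right_first h y.right)]
  rfl

theorem cocycle_first_last {n k m : ℕ} (h : n + k = m) (u : Fin n → ZMod 2) (v : Fin k → ZMod 2) :
    PiGroup.cocycle (Function.extend (firstEmb h) u 0) (Function.extend (lastEmb h) v 0) = 0 := by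
  refine Finset.sum_eq_zero fun i _ => Finset.sum_eq_zero fun j _ => ?_
  split_ifs with hij
  · by_cases hi : ∃ a, firstEmb h a = i
    · by_cases hj : ∃ b, lastEmb h b = j
      · obtain ⟨a, rfl⟩ := hi
        obtain ⟨b, rfl⟩ := hj
        exact absurd hij (not_le.2 (firstEmb_lt_lastEmb h a b))
      · simp [Function.extend_apply' _ _ _ hj]
    · simp [Function.extend_apply' _ _ _ hi]
  · rfl

theorem cocycle_last_first {n k m : ℕ} (h : n + k = m) (x : BG Γ n) (y : BG Γ k) :
    PiGroup.cocycle (inclR h y).left.2.supp (inclL h x).left.2.supp = parity x * parity y := by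
  have hx : parity x = parity (inclL h x) := (parity_incl _ x).symm
  have hy : parity y = parity (inclR h y) := (parity_incl _ y).symm
  rw [hx, hy, mul_comm]
  unfold parity PiGroup.cocycle
  rw [Finset.sum_mul_sum]
  refine Finset.sum_congr rfl fun i _ => Finset.sum_congr rfl fun j _ => ?_
  split_ifs with hij
  · rfl
  · show (0 : ZMod 2) = Function.extend (lastEmb h) y.left.2.supp 0 i *
      Function.extend (firstEmb h) x.left.2.supp 0 j
    by_cases hj : ∃ a, firstEmb h a = j
    · by_cases hi : ∃ b, lastEmb h b = i
      · obtain ⟨a, rfl⟩ := hi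
        obtain ⟨b, rfl⟩ := hj
        exact absurd (firstEmb_lt_lastEmb h b a).le hij
      · simp [Function.extend_apply' _ _ _ hi]
    · simp [Function.extend_apply' _ _ _ hj]

theorem vecIncl_comm {n k m : ℕ} (h : n + k = m) (g : Fin n → Γ) (g' : Fin k → Γ) :
    vecIncl (firstEmb h) g * vecIncl (lastEmb h) g' =
      vecIncl (lastEmb h) g' * vecIncl (firstEmb h) g := by
  funext i
  by_cases hi : ∃ a, firstEmb h a = i
  · have hj : ¬ ∃ b, lastEmb h b = i := by
      obtain ⟨a, rfl⟩ := hi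
      rintro ⟨b, hb⟩
      exact firstEmb_ne_lastEmb h a b hb.symm
    simp [vecIncl, Function.extend_apply' _ _ _ hj]
  · simp [vecIncl, Function.extend_apply' _ _ _ hi]

/-- The images of `Γ̃_n` and `Γ̃_k` in `Γ̃_{n+k}` commute up to the sign rule of the twisted
multiplication `(t, t') (s, s') = (t s, z ^ {p(t') p(s)} t' s')`. -/
theorem inclL_mul_inclR {n k m : ℕ} (h : n + k = m) (x : BG Γ n) (y : BG Γ k) :
    inclL h x * inclR h y = zPow m (parity x * parity y) * (inclR h y * inclL h x) := by
  rw [zPow_mul]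
  ext1
  · rw [inclL_mul_inclR_left, inclR_mul_inclL_left]
    refine Prod.ext (vecIncl_comm h x.left.1 y.left.1) ?_
    ext1
    · show x.left.2.zexp + y.left.2.zexp + PiGroup.cocycle (Function.extend (firstEmb h) x.left.2.supp 0)
        (Function.extend (lastEmb h) y.left.2.supp 0) = parity x * parity y +
        (y.left.2.zexp + x.left.2.zexp +
          PiGroup.cocycle (inclR h y).left.2.supp (inclL h x).left.2.supp)
      rw [cocycle_first_last, cocycle_last_first]
      have := CharTwo.add_self_eq_zero (parity x * parity y)
      linear_combination -this
    · exact add_comm _ _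
  · show Equiv.Perm.viaEmbedding x.right _ * Equiv.Perm.viaEmbedding y.right _ =
      Equiv.Perm.viaEmbedding y.right _ * Equiv.Perm.viaEmbedding x.right _
    refine (Equiv.Perm.Disjoint.commute fun j => ?_).eq
    by_cases hj : ∃ a, firstEmb h a = j
    · obtain ⟨a, rfl⟩ := hj
      exact Or.inr (inclR_right_first h _ a)
    · exact Or.inl (Equiv.Perm.viaEmbedding_apply_of_notMem _ _ _ (by
        rintro ⟨i, hi⟩; exact hj ⟨i, hi⟩))

/-- The spin product `Γ̃_n ×̂ Γ̃_k`, identified with its image in `Γ̃_{n+k}`. -/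
noncomputable def spinProd (Γ : Type*) [Group Γ] {n k m : ℕ} (h : n + k = m) :
    Subgroup (BG Γ m) :=
  (inclL h).range ⊔ (inclR h).range

theorem inclL_mul_inclR_mem {n k m : ℕ} (h : n + k = m) (x : BG Γ n) (y : BG Γ k) :
    inclL h x * inclR h y ∈ spinProd Γ h :=
  mul_mem (Subgroup.mem_sup_left ⟨x, rfl⟩) (Subgroup.mem_sup_right ⟨y, rfl⟩)

theorem zPow_eq_inclL {n k m : ℕ} (h : n + k = m) (c : ZMod 2) :
    (zPow m c : BG Γ m) = inclL h (zPow n c) := by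
  ext1
  · refine Prod.ext (map_one (vecIncl (firstEmb h))).symm ?_
    ext1
    · rfl
    · funext j
      by_cases hj : ∃ i, firstEmb h i = j
      · obtain ⟨i, rfl⟩ := hj
        exact ((firstEmb h).injective.extend_apply (0 : Fin n → ZMod 2) 0 i).symm
      · exact (Function.extend_apply' (f := firstEmb h) (0 : Fin n → ZMod 2) 0 j hj).symm
  · exact (map_one _).symm

theorem exists_of_mem_spinProd {n k m : ℕ} (h : n + k = m) {w : BG Γ m} (hw : w ∈ spinProd Γ h) :
    ∃ (x : BG Γ n) (y : BG Γ k), w = inclL h x * inclR h y := by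
  have swap : ∀ (x : BG Γ n) (y : BG Γ k),
      ∃ x' : BG Γ n, inclR h y * inclL h x = inclL h x' * inclR h y := by
    intro x y
    refine ⟨zPow n (parity x * parity y) * x, ?_⟩
    rw [map_mul, ← zPow_eq_inclL, mul_assoc, inclL_mul_inclR, ← mul_assoc, zPow_eq_inclL h,
      ← map_mul]
    have : (zPow n (parity x * parity y) * zPow n (parity x * parity y) : BG Γ n) = 1 := by
      rw [zPow_mul]
      ext1
      · refine Prod.ext rfl ?_
        ext1
        · exact CharTwo.add_self_eq_zero _
        · rfl
      · rfl
    rw [this, map_one, one_mul]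
  rw [spinProd, Subgroup.sup_eq_closure] at hw
  induction hw using Subgroup.closure_induction with
  | mem w hw =>
    rcases hw with ⟨x, rfl⟩ | ⟨y, rfl⟩
    · exact ⟨x, 1, by simp⟩
    · exact ⟨1, y, by simp⟩
  | one => exact ⟨1, 1, by simp⟩
  | mul a b _ _ ha hb =>
    obtain ⟨x, y, rfl⟩ := ha
    obtain ⟨x', y', rfl⟩ := hb
    obtain ⟨t, ht⟩ := swap x' y
    refine ⟨x * t, y * y', ?_⟩
    rw [map_mul, map_mul, mul_assoc, ← mul_assoc (inclR h y), ht]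
    simp only [mul_assoc]
  | inv a _ ha =>
    obtain ⟨x, y, rfl⟩ := ha
    obtain ⟨t, ht⟩ := swap x⁻¹ y⁻¹
    refine ⟨t, y⁻¹, ?_⟩
    rw [mul_inv_rev, ← map_inv, ← map_inv, ht]

theorem extend_sum_inj {n k m : ℕ} (h : n + k = m) {M : Type*} [MulOneClass M]
    {f f' : Fin n → M} {g g' : Fin k → M}
    (hh : ∀ j, Function.extend (firstEmb h) f 1 j * Function.extend (lastEmb h) g 1 j =
      Function.extend (firstEmb h) f' 1 j * Function.extend (lastEmb h) g' 1 j) :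
    f = f' ∧ g = g' := by
  constructor
  · funext i
    have h1 := hh (firstEmb h i)
    have hj : ¬ ∃ b, lastEmb h b = firstEmb h i := by
      rintro ⟨b, hb⟩
      exact firstEmb_ne_lastEmb h i b hb.symm
    simpa [Function.extend_apply' _ _ _ hj, (firstEmb h).injective.extend_apply] using h1
  · funext i
    have h1 := hh (lastEmb h i)
    have hj : ¬ ∃ b, firstEmb h b = lastEmb h i := by
      rintro ⟨b, hb⟩
      exact firstEmb_ne_lastEmb h b i hb
    simpa [Function.extend_apply' _ _ _ hj, (lastEmb h).injective.extend_apply] using h1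

/-- The kernel of `Γ̃_n × Γ̃_k → Γ̃_{n+k}` is `{(1, 1), (z, z)}`. -/
theorem inclL_mul_inclR_eq {n k m : ℕ} (h : n + k = m) {x x' : BG Γ n} {y y' : BG Γ k}
    (hh : inclL h x * inclR h y = inclL h x' * inclR h y') :
    ∃ c : ZMod 2, x' = zPow n c * x ∧ y' = zPow k c * y := by
  have hl := congrArg SemidirectProduct.left hh
  have hr := congrArg SemidirectProduct.right hh
  rw [inclL_mul_inclR_left, inclL_mul_inclR_left] at hl
  have h1 : x.left.1 = x'.left.1 ∧ y.left.1 = y'.left.1 :=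
    extend_sum_inj h fun j => congrFun (congrArg Prod.fst hl) j
  have h2 : x.left.2.supp = x'.left.2.supp ∧ y.left.2.supp = y'.left.2.supp :=
    extend_sum_inj (M := Multiplicative (ZMod 2)) h
      fun j => congrFun (congrArg (fun t => PiGroup.supp (Prod.snd t)) hl) j
  have h3 : x.left.2.zexp + y.left.2.zexp = x'.left.2.zexp + y'.left.2.zexp := by
    have h4 : x.left.2.zexp + y.left.2.zexp +
        PiGroup.cocycle (Function.extend (firstEmb h) x.left.2.supp 0)
          (Function.extend (lastEmb h) y.left.2.supp 0) =
        x'.left.2.zexp + y'.left.2.zexp +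
        PiGroup.cocycle (Function.extend (firstEmb h) x'.left.2.supp 0)
          (Function.extend (lastEmb h) y'.left.2.supp 0) :=
      congrArg (fun t => PiGroup.zexp (Prod.snd t)) hl
    simpa only [cocycle_first_last, add_zero] using h4
  have h5 : Equiv.Perm.viaEmbedding x.right (firstEmb h).toEmbedding *
      Equiv.Perm.viaEmbedding y.right (lastEmb h).toEmbedding =
      Equiv.Perm.viaEmbedding x'.right (firstEmb h).toEmbedding *
      Equiv.Perm.viaEmbedding y'.right (lastEmb h).toEmbedding := hr
  have h6 : x.right = x'.right := by
    refine Equiv.ext fun i => ?_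
    have := congrArg (fun s => s (firstEmb h i)) h5
    simp only [Equiv.Perm.mul_apply, inclR_right_first] at this
    have e1 := Equiv.Perm.viaEmbedding_apply x.right (firstEmb h).toEmbedding i
    have e2 := Equiv.Perm.viaEmbedding_apply x'.right (firstEmb h).toEmbedding i
    exact (firstEmb h).injective (e1.symm.trans (this.trans e2))
  have h7 : y.right = y'.right := by
    refine Equiv.ext fun i => ?_
    have := congrArg (fun s => s (lastEmb h i)) h5
    simp only [Equiv.Perm.mul_apply] at this
    have e1 := Equiv.Perm.viaEmbedding_apply y.right (lastEmb h).toEmbedding i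
    have e2 := Equiv.Perm.viaEmbedding_apply y'.right (lastEmb h).toEmbedding i
    simp only [RelEmbedding.coe_toEmbedding] at e1 e2
    rw [e1, e2, inclL_right_last, inclL_right_last] at this
    exact (lastEmb h).injective this
  have h8 := CharTwo.add_self_eq_zero x.left.2.zexp
  have h9 := CharTwo.add_self_eq_zero y'.left.2.zexp
  have h10 := CharTwo.add_self_eq_zero y.left.2.zexp
  refine ⟨x'.left.2.zexp + x.left.2.zexp, ?_, ?_⟩
  · rw [zPow_mul]
    ext1
    · refine Prod.ext h1.1.symm ?_
      ext1
      · show x'.left.2.zexp = x'.left.2.zexp + x.left.2.zexp + x.left.2.zexp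
        linear_combination -h8
      · exact h2.1.symm
    · exact h6.symm
  · rw [zPow_mul]
    ext1
    · refine Prod.ext h1.2.symm ?_
      ext1
      · show y'.left.2.zexp = x'.left.2.zexp + x.left.2.zexp + y.left.2.zexp
        linear_combination h3 + h9 - h8 - h10
      · exact h2.2.symm
    · exact h7.symm

end Groups

/-! ### The Clifford module `L_n` and the class functions `χ_n(γ)` -/

section CliffordModule

variable {n : ℕ}

/-- The quadratic form `-(x_1² + ⋯ + x_n²)`. -/
noncomputable def cliffordForm (n : ℕ) : QuadraticForm ℂ (Fin n → ℂ) :=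
  QuadraticMap.weightedSumSquares ℂ (fun _ : Fin n => (-1 : ℂ))

/-- The Clifford algebra `L_n` with generators `e_1, …, e_n` and relations
`e_i e_j + e_j e_i = -2 δ_{ij}`. -/
abbrev cliffordL (n : ℕ) : Type := CliffordAlgebra (cliffordForm n)

/-- The generator `e_i` of `L_n`. -/
noncomputable def cliffordE (i : Fin n) : cliffordL n :=
  CliffordAlgebra.ι (cliffordForm n) (Pi.single i 1)

theorem cliffordE_mul_add (i j : Fin n) :
    cliffordE i * cliffordE j + cliffordE j * cliffordE i =
      algebraMap ℂ (cliffordL n) (if i = j then -2 else 0) := by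
  rw [cliffordE, cliffordE, CliffordAlgebra.ι_mul_ι_add_swap]
  congr 1
  simp only [QuadraticMap.polar, cliffordForm, QuadraticMap.weightedSumSquares_apply]
  simp only [← Finset.sum_sub_distrib]
  by_cases hij : i = j
  · subst hij
    rw [Finset.sum_eq_single i]
    · simp; norm_num
    · intro b _ hb; simp [Pi.single_eq_of_ne hb]
    · simp
  · rw [if_neg hij]
    refine Finset.sum_eq_zero fun k _ => ?_
    by_cases hk : k = i
    · subst hk; simp [Pi.single_eq_of_ne hij]
    · simp [Pi.single_eq_of_ne hk]

/-- The isometry `e_i ↦ e_{s(i)}`. -/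
noncomputable def permIsometry (s : Equiv.Perm (Fin n)) :
    (cliffordForm n) →qᵢ (cliffordForm n) where
  toLinearMap := (LinearMap.funLeft ℂ ℂ s.symm)
  map_app' v := by
    simp only [cliffordForm, QuadraticMap.weightedSumSquares_apply]
    exact Equiv.sum_comp s.symm (fun i => (-1 : ℂ) • (v i * v i))

/-- The automorphism of `L_n` with `e_i ↦ e_{s(i)}`. -/
noncomputable def permL (s : Equiv.Perm (Fin n)) : cliffordL n →ₐ[ℂ] cliffordL n :=
  CliffordAlgebra.map (permIsometry s)

theorem permL_e (s : Equiv.Perm (Fin n)) (i : Fin n) :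
    permL s (cliffordE i) = cliffordE (s i) := by
  simp only [permL, cliffordE, CliffordAlgebra.map_apply_ι]
  congr 1
  funext j
  show (Pi.single i 1 : Fin n → ℂ) (s.symm j) = (Pi.single (s i) 1 : Fin n → ℂ) j
  simp only [Pi.single_apply, Equiv.symm_apply_eq]

/-- The element `(-1) ^ k * e_1 ^ (u 1) * ⋯ * e_n ^ (u n)` of `L_n` by which the element
`z ^ k * a_1 ^ (u 1) * ⋯ * a_n ^ (u n)` of `Π_n` acts. -/
noncomputable def cliffordMonomial (a : PiGroup n) : cliffordL n :=
  (-1 : ℂ) ^ a.zexp.val • (List.ofFn fun i => cliffordE i ^ (a.supp i).val).prod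

/-- The action of the element `(a, s)` of `Π_n ⋊ S_n` on `L_n`: `e_J ↦ a · s(e_J)`. -/
noncomputable def cliffordAction (a : PiGroup n) (s : Equiv.Perm (Fin n)) :
    Module.End ℂ (cliffordL n) :=
  LinearMap.mulLeft ℂ (cliffordMonomial a) ∘ₗ (permL s).toLinearMap

/-- The character `χ_n` of the basic spin supermodule `L_n`. -/
noncomputable def basicChar (a : PiGroup n) (s : Equiv.Perm (Fin n)) : ℂ :=
  LinearMap.trace ℂ (cliffordL n) (cliffordAction a s)

theorem negOnePow_add (k l : ZMod 2) :
    (-1 : ℂ) ^ (k + l).val = (-1) ^ k.val * (-1) ^ l.val := by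
  rw [ZMod.val_add, ← pow_add, ← neg_one_pow_eq_pow_mod_two]

theorem basicChar_zmul (c : ZMod 2) (a : PiGroup n) (s : Equiv.Perm (Fin n)) :
    basicChar ⟨c + a.zexp, a.supp⟩ s = (-1 : ℂ) ^ c.val * basicChar a s := by
  unfold basicChar
  rw [← smul_eq_mul, ← map_smul]
  congr 1
  refine LinearMap.ext fun v => ?_
  simp [cliffordAction, cliffordMonomial, negOnePow_add, mul_smul]

theorem involute_permL (s : Equiv.Perm (Fin n)) (v : cliffordL n) :
    CliffordAlgebra.involute (permL s v) = permL s (CliffordAlgebra.involute v) := by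
  have : (CliffordAlgebra.involute).comp (permL s) = (permL s).comp CliffordAlgebra.involute := by
    refine CliffordAlgebra.hom_ext (LinearMap.ext fun w => ?_)
    simp [permL]
  exact DFunLike.congr_fun this v

theorem involute_monomial (a : PiGroup n) :
    CliffordAlgebra.involute (cliffordMonomial a) =
      (-1 : ℂ) ^ (∑ i, a.supp i).val • cliffordMonomial a := by
  have h1 : ∀ (m : ℕ) (f : Fin m → cliffordL n) (c : Fin m → ZMod 2),
      (∀ i, CliffordAlgebra.involute (f i) = (-1 : ℂ) ^ (c i).val • f i) →
      CliffordAlgebra.involute (List.ofFn f).prod =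
        (-1 : ℂ) ^ (∑ i, c i).val • (List.ofFn f).prod := by
    intro m
    induction m with
    | zero => intro f c _; simp
    | succ m ih =>
      intro f c hf
      rw [List.ofFn_succ, List.prod_cons, map_mul, hf 0,
        ih (fun i => f i.succ) (fun i => c i.succ) (fun i => hf i.succ), Fin.sum_univ_succ,
        negOnePow_add, smul_mul_smul_comm]
  unfold cliffordMonomial
  rw [map_smul, h1 n _ a.supp, smul_comm]
  intro i
  generalize a.supp i = t
  fin_cases t
  · show CliffordAlgebra.involute (cliffordE i ^ 0) = (-1 : ℂ) ^ 0 • cliffordE i ^ 0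
    simp
  · show CliffordAlgebra.involute (cliffordE i ^ 1) = (-1 : ℂ) ^ 1 • cliffordE i ^ 1
    simp [cliffordE]

/-- Odd elements have trace zero on `L_n`. -/
theorem basicChar_odd (a : PiGroup n) (s : Equiv.Perm (Fin n)) (h : ∑ i, a.supp i = 1) :
    basicChar a s = 0 := by
  have h1 : (CliffordAlgebra.involuteEquiv (Q := cliffordForm n)).toLinearEquiv.conj
      (cliffordAction a s) = -cliffordAction a s := by
    refine LinearMap.ext fun v => ?_
    have hv : CliffordAlgebra.involuteEquiv.symm v = CliffordAlgebra.involute (Q := cliffordForm n) v := by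
      rw [AlgEquiv.symm_apply_eq]; simp
    rw [LinearEquiv.conj_apply_apply]
    show CliffordAlgebra.involute (cliffordMonomial a * permL s
      (CliffordAlgebra.involuteEquiv.symm v)) = -(cliffordMonomial a * permL s v)
    rw [hv, map_mul, involute_monomial, h, involute_permL, CliffordAlgebra.involute_involute]
    simp [ZMod.val_one]
  have h2 := LinearMap.trace_conj' (cliffordAction a s)
    (CliffordAlgebra.involuteEquiv (Q := cliffordForm n)).toLinearEquiv
  rw [h1, map_neg] at h2
  have h3 : basicChar a s = -basicChar a s := h2.symm
  linear_combination (1 / 2 : ℂ) * h3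

end CliffordModule

section ClassFunctions

variable {Γ : Type*} [Group Γ]

/-- The space `R(Γ)` of complex class functions on `Γ`, as functions on the set `Γ_*` of conjugacy
classes. -/
abbrev ClassFn (Γ : Type*) [Group Γ] : Type _ := ConjClasses Γ → ℂ

/-- The cycles of a permutation `s` of `{1, …, n}`, fixed points included. -/
abbrev Cycles {n : ℕ} (s : Equiv.Perm (Fin n)) : Type :=
  Quotient (Equiv.Perm.SameCycle.setoid s)

/-- The length of the cycle `q`. -/
noncomputable def cycleLen {n : ℕ} {s : Equiv.Perm (Fin n)} (q : Cycles s) : ℕ :=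
  Function.minimalPeriod s q.out

/-- The conjugacy class of the cycle product `g_{j_m} g_{j_{m-1}} ⋯ g_{j_1}` of the cycle
`q = (j_1 j_2 … j_m)` of `(g, s)`, read off from `j_m = q.out` backwards. -/
noncomputable def cycleClass {n : ℕ} (g : Fin n → Γ) {s : Equiv.Perm (Fin n)} (q : Cycles s) :
    ConjClasses Γ :=
  ConjClasses.mk (((List.range (cycleLen q)).map fun k => g ((s ^ k)⁻¹ q.out)).prod)

/-- The class function `η_n(γ)` on `Γ_n = Γ^n ⋊ S_n`: its value at an element of type `ρ` is
`∏_c γ(c) ^ {l(ρ(c))}`, one factor for each cycle. If `γ` is the character of a `Γ`-module `V`,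
this is the character of `V^{⊗ n}` (see `eta_character`). -/
noncomputable def eta {n : ℕ} (γ : ClassFn Γ) (g : Fin n → Γ) (s : Equiv.Perm (Fin n)) : ℂ :=
  ∏ q : Cycles s, γ (cycleClass g q)

theorem list_prod_apply {ι : Type*} [Fintype ι] [DecidableEq ι] (m : ℕ) (N : Fin (m + 1) → ι → ι → ℂ) (a b : ι) :
    (List.ofFn fun j => Matrix.of (N j)).prod a b =
      ∑ k : Fin m → ι, ∏ j, N j ((Fin.cons a k : Fin (m + 1) → ι) j)
        ((Fin.snoc k b : Fin (m + 1) → ι) j) := by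
  induction m generalizing a with
  | zero =>
    rw [Fintype.sum_unique, List.ofFn_succ, List.ofFn_zero, List.prod_singleton]
    simp [Fin.snoc]
  | succ m ih =>
    rw [List.ofFn_succ, List.prod_cons, Matrix.mul_apply]
    rw [← (Fin.consEquiv fun _ : Fin (m + 1) => ι).sum_comp, Fintype.sum_prod_type]
    refine Finset.sum_congr rfl fun c _ => ?_
    rw [ih, Finset.mul_sum]
    refine Finset.sum_congr rfl fun k _ => ?_
    show N 0 a c * _ = ∏ j, N j ((Fin.cons a (Fin.cons c k : Fin (m + 1) → ι) : Fin (m + 2) → ι) j)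
      ((Fin.snoc (Fin.cons c k : Fin (m + 1) → ι) b : Fin (m + 2) → ι) j)
    have h : ∀ j : Fin (m + 2), (Fin.snoc (Fin.cons c k : Fin (m + 1) → ι) b : Fin (m + 2) → ι) j =
        (Fin.cons c (Fin.snoc k b : Fin (m + 1) → ι) : Fin (m + 2) → ι) j :=
      fun j => (congrFun (Fin.cons_snoc_eq_snoc_cons c k b) j).symm
    refine Eq.trans ?_ (Fin.prod_univ_succ _).symm
    refine congrArg₂ (fun x y : ℂ => x * y) ?_ (Finset.prod_congr rfl fun j _ => ?_)
    · rw [h]; rfl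
    · rw [h]; rfl

theorem trace_list_prod {ι : Type*} [Fintype ι] [DecidableEq ι] (m : ℕ) (N : Fin (m + 1) → ι → ι → ℂ) :
    (List.ofFn fun j => Matrix.of (N j)).prod.trace =
      ∑ k : Fin (m + 1) → ι, ∏ j, N j (k j) (k (finRotate (m + 1) j)) := by
  rw [← (Fin.consEquiv fun _ : Fin (m + 1) => ι).sum_comp, Fintype.sum_prod_type]
  refine Finset.sum_congr rfl fun a _ => ?_
  rw [Matrix.diag_apply, list_prod_apply]
  refine Finset.sum_congr rfl fun k _ => Finset.prod_congr rfl fun j _ => ?_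
  rw [Fin.snoc_eq_cons_rotate]
  rfl

theorem cycleLen_pos {n : ℕ} {s : Equiv.Perm (Fin n)} (q : Cycles s) : 0 < cycleLen q :=
  Function.minimalPeriod_pos_of_mem_periodicPts
    (s.injective.mem_periodicPts q.out)

theorem iterate_eq {n : ℕ} (s : Equiv.Perm (Fin n)) (k : ℕ) (i : Fin n) : s^[k] i = (s ^ k) i := by
  rw [Equiv.Perm.iterate_eq_pow]

theorem pow_cycleLen {n : ℕ} {s : Equiv.Perm (Fin n)} (q : Cycles s) :
    (s ^ cycleLen q) q.out = q.out := by
  rw [← iterate_eq]; exact Function.iterate_minimalPeriod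

theorem mk_backwards {n : ℕ} {s : Equiv.Perm (Fin n)} (q : Cycles s) (k : ℕ) :
    (Quotient.mk _ ((s ^ k)⁻¹ q.out) : Cycles s) = q := by
  refine Eq.trans (Quotient.sound ?_) (Quotient.out_eq q)
  show s.SameCycle _ _
  exact ⟨k, by rw [zpow_natCast]; exact (s ^ k).apply_symm_apply _⟩

/-- The points of a cycle, listed backwards from the representative. -/
theorem cycle_bijective {n : ℕ} {s : Equiv.Perm (Fin n)} (q : Cycles s) :
    Function.Bijective (fun j : Fin (cycleLen q) =>
      (⟨(s ^ (j : ℕ))⁻¹ q.out, mk_backwards q j⟩ :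
        {i : Fin n // (Quotient.mk _ i : Cycles s) = q})) := by
  have hinv : ∀ (k : ℕ) (x : Fin n), (s ^ k) ((s ^ k)⁻¹ x) = x := fun k x =>
    (s ^ k).apply_symm_apply x
  constructor
  · intro j k hjk
    have h1 : (s ^ (j : ℕ))⁻¹ q.out = (s ^ (k : ℕ))⁻¹ q.out := congrArg Subtype.val hjk
    have h2 : (s ^ (k : ℕ)) q.out = (s ^ (j : ℕ)) q.out := by
      have h3 : (s ^ (j : ℕ)) ((s ^ (k : ℕ))⁻¹ q.out) = q.out := by rw [← h1, hinv]
      have h4 := congrArg (s ^ (k : ℕ)) h3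
      rw [← h4, ← Equiv.Perm.mul_apply, (Commute.pow_pow_self s _ _).eq, Equiv.Perm.mul_apply, hinv]
    rw [← iterate_eq, ← iterate_eq] at h2
    exact Fin.ext ((Function.iterate_injOn_Iio_minimalPeriod (f := s) (x := q.out)) k.2 j.2 h2).symm
  · rintro ⟨i, hi⟩
    have h1 : s.SameCycle i q.out := by
      have : (Quotient.mk _ i : Cycles s) = Quotient.mk _ q.out := by rw [hi, Quotient.out_eq]
      exact Quotient.exact this
    obtain ⟨k, -, hk⟩ := h1.exists_pow_eq'
    refine ⟨⟨k % cycleLen q, Nat.mod_lt _ (cycleLen_pos q)⟩, Subtype.ext ?_⟩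
    show (s ^ (k % cycleLen q))⁻¹ q.out = i
    rw [Equiv.Perm.inv_eq_iff_eq, ← hk]
    have hl : (s ^ cycleLen q) i = i := by
      have h5 := pow_cycleLen q
      rw [← hk, ← Equiv.Perm.mul_apply, (Commute.pow_pow_self s _ _).eq,
        Equiv.Perm.mul_apply] at h5
      exact (s ^ k).injective h5
    have hm : ∀ m : ℕ, ((s ^ cycleLen q) ^ m) i = i := by
      intro m
      induction m with
      | zero => rfl
      | succ m ih => rw [pow_succ, Equiv.Perm.mul_apply, hl, ih]
    conv_lhs => rw [← Nat.mod_add_div k (cycleLen q), pow_add, Equiv.Perm.mul_apply, pow_mul, hm]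

/-- The sum over all colourings of the points of one cycle. -/
theorem cycle_sum {ι : Type*} [Fintype ι] [DecidableEq ι] {n : ℕ} {s : Equiv.Perm (Fin n)} (q : Cycles s)
    (N : Fin n → ι → ι → ℂ)
    (hs : ∀ i : {i : Fin n // (Quotient.mk _ i : Cycles s) = q},
      (Quotient.mk _ (s.symm i.1) : Cycles s) = q) :
    ∑ k : {i : Fin n // (Quotient.mk _ i : Cycles s) = q} → ι,
      ∏ i, N i.1 (k i) (k ⟨s.symm i.1, hs i⟩) =
    (((List.range (cycleLen q)).map fun j => Matrix.of (N ((s ^ j)⁻¹ q.out))).prod).trace := by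
  obtain ⟨m, hm⟩ : ∃ m, cycleLen q = m + 1 := ⟨cycleLen q - 1, by have := cycleLen_pos q; omega⟩
  let e : Fin (m + 1) ≃ {i : Fin n // (Quotient.mk _ i : Cycles s) = q} :=
    (finCongr hm.symm).trans (Equiv.ofBijective _ (cycle_bijective q))
  have he : ∀ j : Fin (m + 1), (e j).1 = (s ^ (j : ℕ))⁻¹ q.out := fun j => rfl
  have hr : ∀ j : Fin (m + 1), (⟨s.symm (e j).1, hs (e j)⟩ :
      {i : Fin n // (Quotient.mk _ i : Cycles s) = q}) = e (finRotate (m + 1) j) := by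
    intro j
    refine Subtype.ext ?_
    show s⁻¹ (e j).1 = _
    rw [he, he, ← Equiv.Perm.mul_apply, ← mul_inv_rev, ← pow_succ]
    by_cases hj : j = Fin.last m
    · subst hj
      rw [finRotate_last]
      have h5 := pow_cycleLen q
      rw [hm] at h5
      show (s ^ (m + 1))⁻¹ q.out = (s ^ 0)⁻¹ q.out
      rw [Equiv.Perm.inv_eq_iff_eq]
      exact h5.symm
    · rw [coe_finRotate_of_ne_last hj]
  have hmap : (List.range (cycleLen q)).map (fun j => Matrix.of (N ((s ^ j)⁻¹ q.out))) =
      List.ofFn fun j : Fin (m + 1) => Matrix.of (N ((s ^ (j : ℕ))⁻¹ q.out)) := by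
    rw [hm, List.ofFn_eq_map, ← List.map_coe_finRange_eq_range, List.map_map]
    rfl
  rw [hmap, trace_list_prod, ← Equiv.sum_comp (e.arrowCongr (Equiv.refl ι))]
  refine Finset.sum_congr rfl fun k _ => ?_
  rw [← Equiv.prod_comp e]
  refine Finset.prod_congr rfl fun j _ => ?_
  rw [hr]
  simp [he]

theorem perm_sum {ι : Type*} [Fintype ι] [DecidableEq ι] {n : ℕ} (s : Equiv.Perm (Fin n))
    (N : Fin n → ι → ι → ℂ) :
    ∑ k : Fin n → ι, ∏ i, N i (k i) (k (s.symm i)) =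
    ∏ q : Cycles s,
      (((List.range (cycleLen q)).map fun j => Matrix.of (N ((s ^ j)⁻¹ q.out))).prod).trace := by
  have hs : ∀ (q : Cycles s) (i : {i : Fin n // (Quotient.mk _ i : Cycles s) = q}),
      (Quotient.mk _ (s.symm i.1) : Cycles s) = q := by
    rintro q ⟨i, hi⟩
    refine Eq.trans (Quotient.sound ?_) hi
    show s.SameCycle _ _
    exact ⟨1, by rw [zpow_one]; exact s.apply_symm_apply i⟩
  simp_rw [← fun q => cycle_sum q N (hs q)]
  rw [Fintype.prod_sum]
  let E : (Fin n → ι) ≃ (∀ q : Cycles s, {i : Fin n // (Quotient.mk _ i : Cycles s) = q} → ι) :=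
    { toFun := fun k q i => k i.1
      invFun := fun k i => k (Quotient.mk _ i) ⟨i, rfl⟩
      left_inv := fun k => rfl
      right_inv := fun k => by
        funext q i
        obtain ⟨i, rfl⟩ := i
        rfl }
  rw [← Equiv.sum_comp E]
  refine Finset.sum_congr rfl fun k _ => ?_
  rw [← (Equiv.sigmaFiberEquiv (fun i : Fin n => (Quotient.mk _ i : Cycles s))).prod_comp,
    Fintype.prod_sigma]
  rfl

/-- The operator of `(g, s) ∈ Γ^n ⋊ S_n` on `V^{⊗ n}`:
`v_1 ⊗ ⋯ ⊗ v_n ↦ g_1 v_{s⁻¹(1)} ⊗ ⋯ ⊗ g_n v_{s⁻¹(n)}`. -/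
noncomputable def tensorPowerAction {Γ V : Type*} [Group Γ] [AddCommGroup V] [Module ℂ V]
    (ρ : Representation ℂ Γ V) {n : ℕ} (g : Fin n → Γ) (s : Equiv.Perm (Fin n)) :
    Module.End ℂ (⨂[ℂ] _ : Fin n, V) :=
  PiTensorProduct.map (fun i => ρ (g i)) ∘ₗ
    (PiTensorProduct.reindex ℂ (fun _ : Fin n => V) s).toLinearMap

theorem trace_tensorPower {Γ V : Type*} [Group Γ] [AddCommGroup V] [Module ℂ V]
    [FiniteDimensional ℂ V] (ρ : Representation ℂ Γ V) {n : ℕ} (g : Fin n → Γ)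
    (s : Equiv.Perm (Fin n)) :
    LinearMap.trace ℂ _ (tensorPowerAction ρ g s) =
      ∏ q : Cycles s, ρ.character
        (((List.range (cycleLen q)).map fun k => g ((s ^ k)⁻¹ q.out)).prod) := by
  let b := Module.finBasis ℂ V
  let N : Fin n → Fin (Module.finrank ℂ V) → Fin (Module.finrank ℂ V) → ℂ :=
    fun i a c => LinearMap.toMatrix b b (ρ (g i)) a c
  rw [LinearMap.trace_eq_matrix_trace ℂ (Basis.piTensorProduct fun _ : Fin n => b)]
  have h1 : (LinearMap.toMatrix (Basis.piTensorProduct fun _ : Fin n => b)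
      (Basis.piTensorProduct fun _ : Fin n => b) (tensorPowerAction ρ g s)).trace =
      ∑ k : Fin n → Fin (Module.finrank ℂ V), ∏ i, N i (k i) (k (s.symm i)) := by
    refine Finset.sum_congr rfl fun k _ => ?_
    rw [Matrix.diag_apply, LinearMap.toMatrix_apply, Basis.piTensorProduct_apply]
    have : tensorPowerAction ρ g s (⨂ₜ[ℂ] i, b (k i)) = ⨂ₜ[ℂ] i, ρ (g i) (b (k (s.symm i))) := by
      simp [tensorPowerAction, PiTensorProduct.map_tprod]
    rw [this, Basis.piTensorProduct_repr_tprod_apply]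
    refine Finset.prod_congr rfl fun i _ => ?_
    exact (LinearMap.toMatrix_apply b b _ _ _).symm
  rw [h1, perm_sum]
  refine Finset.prod_congr rfl fun q _ => ?_
  rw [Representation.character, LinearMap.trace_eq_matrix_trace ℂ b, map_list_prod, List.map_map]
  congr 1
  have h2 : ∀ l : List (Module.End ℂ V), LinearMap.toMatrix b b l.prod =
      (l.map (LinearMap.toMatrix b b)).prod := fun l => map_list_prod (LinearMap.toMatrixAlgEquiv b) l
  rw [h2, List.map_map]
  rfl

/-- For the character `γ` of a `Γ`-module `V`, `η_n(γ)` is the character of `V^{⊗ n}`. -/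
theorem eta_character {Γ V : Type*} [Group Γ] [AddCommGroup V] [Module ℂ V]
    [FiniteDimensional ℂ V] (ρ : Representation ℂ Γ V) {γ : ClassFn Γ}
    (hγ : ∀ x : Γ, γ (ConjClasses.mk x) = ρ.character x) {n : ℕ} (g : Fin n → Γ)
    (s : Equiv.Perm (Fin n)) : eta γ g s = LinearMap.trace ℂ _ (tensorPowerAction ρ g s) := by
  rw [trace_tensorPower]
  exact Finset.prod_congr rfl fun q _ => hγ _

/-- `χ_n(γ) = η_n(γ) ⊛ χ_n` on `Γ̃_n`. -/
noncomputable def chi (γ : ClassFn Γ) (n : ℕ) (x : BG Γ n) : ℂ :=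
  eta γ x.left.1 x.right * basicChar x.left.2 x.right

/-- The type of `(g, s) ∈ Γ_n`: the partition-valued function on `Γ_*` whose value at `c` has as
parts the lengths of the cycles with cycle product in `c`. -/
noncomputable def wreathType {n : ℕ} (g : Fin n → Γ) (s : Equiv.Perm (Fin n)) :
    ConjClasses Γ → Multiset ℕ :=
  fun c => ((Finset.univ.filter fun q : Cycles s => cycleClass g q = c).val.map cycleLen)

theorem chi_zmul (γ : ClassFn Γ) {n : ℕ} (c : ZMod 2) (x : BG Γ n) :
    chi γ n (zPow n c * x) = (-1 : ℂ) ^ c.val * chi γ n x := by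
  rw [zPow_mul]
  simp only [chi, basicChar_zmul]
  ring

theorem chi_odd (γ : ClassFn Γ) {n : ℕ} (x : BG Γ n) (h : parity x = 1) : chi γ n x = 0 := by
  simp only [chi, basicChar_odd _ _ h, mul_zero]

end ClassFunctions

/-! ### The space `R̃_Γ = ⨁_n R⁻(Γ̃_n)` and the operators on it -/

section Operators

variable {Γ : Type*} [Group Γ]

/-- The space `R⁻(Γ̃_n)` of spin super class functions: class functions `f` with
`f(zx) = -f(x)` that vanish on odd elements. -/
def spinSuper (Γ : Type*) [Group Γ] (n : ℕ) : Submodule ℂ (BG Γ n → ℂ) where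
  carrier := {f | (∀ x y, f (y * x * y⁻¹) = f x) ∧ (∀ x, f (zBG n * x) = -f x) ∧
    ∀ x, parity x = 1 → f x = 0}
  add_mem' {f g} hf hg :=
    ⟨fun x y => by simp [hf.1 x y, hg.1 x y],
      fun x => by simp [hf.2.1 x, hg.2.1 x, add_comm],
      fun x hx => by simp [hf.2.2 x hx, hg.2.2 x hx]⟩
  zero_mem' := ⟨fun x y => rfl, fun x => by simp, fun x _ => rfl⟩
  smul_mem' c f hf :=
    ⟨fun x y => by simp [hf.1 x y], fun x => by simp [hf.2.1 x],
      fun x hx => by simp [hf.2.2 x hx]⟩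

/-- `R̃_Γ = ⨁_n R⁻(Γ̃_n)`. -/
abbrev RTotal (Γ : Type*) [Group Γ] : Type _ := DirectSum ℕ fun n => spinSuper Γ n

/-- The outer tensor product of functions on `Γ̃_n` and `Γ̃_k`, as a function on
`Γ̃_n ×̂ Γ̃_k`: the value at `t t'` (`t ∈ Γ̃_n`, `t' ∈ Γ̃_k`) is `f(t) g(t')`. -/
noncomputable def outerTensor {n k m : ℕ} (h : n + k = m) (f : BG Γ n → ℂ) (g : BG Γ k → ℂ)
    (w : spinProd Γ h) : ℂ :=
  f (exists_of_mem_spinProd h w.2).choose * g (exists_of_mem_spinProd h w.2).choose_spec.choose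

theorem spin_zPow {n : ℕ} {f : BG Γ n → ℂ} (hf : ∀ x, f (zBG n * x) = -f x) (c : ZMod 2)
    (x : BG Γ n) : f (zPow n c * x) = (-1 : ℂ) ^ c.val * f x := by
  fin_cases c
  · have : (zPow n 0 : BG Γ n) = 1 := rfl
    show f (zPow n 0 * x) = (-1 : ℂ) ^ 0 * f x
    rw [this]; simp
  · show f (zBG n * x) = (-1 : ℂ) ^ 1 * f x
    rw [hf]; simp

/-- The outer tensor product of spin functions does not depend on the factorization. -/
theorem outerTensor_apply {n k m : ℕ} (h : n + k = m) {f : BG Γ n → ℂ} {g : BG Γ k → ℂ}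
    (hf : ∀ x, f (zBG n * x) = -f x) (hg : ∀ x, g (zBG k * x) = -g x) (w : spinProd Γ h)
    (x : BG Γ n) (y : BG Γ k) (hw : (w : BG Γ m) = inclL h x * inclR h y) :
    outerTensor h f g w = f x * g y := by
  obtain ⟨c, h1, h2⟩ := inclL_mul_inclR_eq h
    (hw.symm.trans (exists_of_mem_spinProd h w.2).choose_spec.choose_spec)
  have e1 := (congrArg f h1).trans (spin_zPow hf c x)
  have e2 := (congrArg g h2).trans (spin_zPow hg c y)
  unfold outerTensor
  refine (congrArg₂ (· * ·) e1 e2).trans ?_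
  have : ((-1 : ℂ) ^ c.val) * (-1) ^ c.val = 1 := by
    rw [← mul_pow]; simp
  linear_combination (f x * g y) * this

theorem chi_spin (γ : ClassFn Γ) {n : ℕ} (x : BG Γ n) : chi γ n (zBG n * x) = -chi γ n x := by
  have h : chi γ n (zBG n * x) = (-1 : ℂ) ^ 1 * chi γ n x := chi_zmul γ 1 x
  rw [h]; simp

/-- The function on a finite group `G` induced from a class function `φ` on a subgroup `H`:
`x ↦ |H|⁻¹ ∑_{y ∈ G, y⁻¹ x y ∈ H} φ(y⁻¹ x y)`. -/
noncomputable def induce {G : Type*} [Group G] [Fintype G] (H : Subgroup G) (φ : H → ℂ) (x : G) :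
    ℂ :=
  (Nat.card H : ℂ)⁻¹ * ∑ y : G, if hy : y⁻¹ * x * y ∈ H then φ ⟨y⁻¹ * x * y, hy⟩ else 0

theorem induce_conj {G : Type*} [Group G] [Fintype G] (H : Subgroup G) (φ : H → ℂ) (x t : G) :
    induce H φ (t * x * t⁻¹) = induce H φ x := by
  unfold induce
  congr 1
  rw [← Equiv.sum_comp (Equiv.mulLeft t)]
  refine Finset.sum_congr rfl fun y _ => ?_
  have : (Equiv.mulLeft t y)⁻¹ * (t * x * t⁻¹) * Equiv.mulLeft t y = y⁻¹ * x * y := by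
    simp only [Equiv.coe_mulLeft]; group
  simp only [this]

theorem outerTensor_add {n k m : ℕ} (h : n + k = m) (f : BG Γ n → ℂ) (g g' : BG Γ k → ℂ) :
    outerTensor h f (g + g') = fun w => outerTensor h f g w + outerTensor h f g' w :=
  funext fun _ => mul_add _ _ _

theorem outerTensor_smul {n k m : ℕ} (h : n + k = m) (f : BG Γ n → ℂ) (c : ℂ)
    (g : BG Γ k → ℂ) : outerTensor h f (c • g) = fun w => c * outerTensor h f g w :=
  funext fun _ => mul_left_comm _ _ _

theorem induce_add {G : Type*} [Group G] [Fintype G] (H : Subgroup G) (φ ψ : H → ℂ) (x : G) :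
    induce H (fun w => φ w + ψ w) x = induce H φ x + induce H ψ x := by
  unfold induce
  rw [← mul_add, ← Finset.sum_add_distrib]
  congr 1
  refine Finset.sum_congr rfl fun t _ => ?_
  split_ifs <;> simp

theorem induce_smul {G : Type*} [Group G] [Fintype G] (H : Subgroup G) (c : ℂ) (φ : H → ℂ)
    (x : G) : induce H (fun w => c * φ w) x = c * induce H φ x := by
  unfold induce
  rw [mul_left_comm]
  congr 1
  rw [Finset.mul_sum]
  refine Finset.sum_congr rfl fun t _ => ?_
  split_ifs <;> simp

theorem parity_inv {n : ℕ} {x : BG Γ n} (hx : parity x ≠ 1) : parity x⁻¹ = 0 := by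
  have hx0 : parity x = 0 := by
    generalize parity x = c at hx
    fin_cases c
    · rfl
    · exact absurd rfl hx
  have : parity x + parity x⁻¹ = 0 := by
    rw [← parity_mul, mul_inv_cancel]; simp [parity]
  rwa [hx0, zero_add] at this

variable [Finite Γ]

/-- `f ↦ Ind (χ_n(γ) ⊗ f)`, from `R⁻(Γ̃_k)` to `R⁻(Γ̃_{n+k})`. -/
noncomputable def indChi (γ : ClassFn Γ) {n k m : ℕ} (h : n + k = m) :
    spinSuper Γ k →ₗ[ℂ] spinSuper Γ m where
  toFun f := ⟨induce (spinProd Γ h) (outerTensor h (chi γ n) f), by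
    refine ⟨fun x t => induce_conj _ _ x t, fun x => ?_, fun x hx => ?_⟩
    · unfold induce
      rw [← mul_neg, ← Finset.sum_neg_distrib]
      congr 1
      refine Finset.sum_congr rfl fun t _ => ?_
      have hz : t⁻¹ * (zBG m * x) * t = inclL h (zBG n) * (t⁻¹ * x * t) := by
        rw [inclL, incl_zBG, ← mul_assoc, ← zBG_mul, mul_assoc, mul_assoc, mul_assoc]
      by_cases ht : t⁻¹ * x * t ∈ spinProd Γ h
      · have ht' : t⁻¹ * (zBG m * x) * t ∈ spinProd Γ h := by
          rw [hz]; exact mul_mem (Subgroup.mem_sup_left ⟨_, rfl⟩) ht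
        rw [dif_pos ht, dif_pos ht']
        obtain ⟨a, b, hab⟩ := exists_of_mem_spinProd h ht
        rw [outerTensor_apply h (chi_spin γ) f.2.2.1 ⟨_, ht⟩ a b hab,
          outerTensor_apply h (chi_spin γ) f.2.2.1 ⟨_, ht'⟩ (zBG n * a) b
            (hz.trans ((congrArg _ hab).trans (by rw [map_mul, mul_assoc]))), chi_spin]
        ring
      · have ht' : t⁻¹ * (zBG m * x) * t ∉ spinProd Γ h := by
          rw [hz]
          intro hh
          have h1 : inclL h (zBG n) ∈ spinProd Γ h := Subgroup.mem_sup_left ⟨_, rfl⟩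
          exact ht ((Subgroup.mul_mem_cancel_left _ h1).1 hh)
        rw [dif_neg ht, dif_neg ht', neg_zero]
    · unfold induce
      rw [Finset.sum_eq_zero, mul_zero]
      intro t _
      by_cases ht : t⁻¹ * x * t ∈ spinProd Γ h
      · rw [dif_pos ht]
        obtain ⟨a, b, hab⟩ := exists_of_mem_spinProd h ht
        rw [outerTensor_apply h (chi_spin γ) f.2.2.1 ⟨_, ht⟩ a b hab]
        have hp : parity a + parity b = 1 := by
          have h1 := parity_conj x t⁻¹
          rw [inv_inv, hab, parity_mul, inclL, inclR, parity_incl, parity_incl] at h1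
          rw [h1, hx]
        by_cases ha : parity a = 1
        · rw [chi_odd γ a ha, zero_mul]
        · have ha0 : parity a = 0 := by
            generalize parity a = c at ha
            fin_cases c
            · rfl
            · exact absurd rfl ha
          rw [ha0, zero_add] at hp
          rw [f.2.2.2 b hp, mul_zero]
      · rw [dif_neg ht]⟩
  map_add' f g := by
    refine Subtype.ext (funext fun x => ?_)
    show induce (spinProd Γ h) (outerTensor h (chi γ n) (f.1 + g.1)) x =
      induce (spinProd Γ h) (outerTensor h (chi γ n) f.1) x +
      induce (spinProd Γ h) (outerTensor h (chi γ n) g.1) x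
    rw [outerTensor_add, induce_add]
  map_smul' c f := by
    refine Subtype.ext (funext fun x => ?_)
    show induce (spinProd Γ h) (outerTensor h (chi γ n) (c • f.1)) x =
      c * induce (spinProd Γ h) (outerTensor h (chi γ n) f.1) x
    rw [outerTensor_smul, induce_smul]

/-- The weighted bilinear form
`⟨f, g⟩_ξ = ⟨η_n(ξ) ⊛ f, g⟩ = |Γ̃_n|⁻¹ ∑_x (η_n(ξ) ⊛ f)(x) g(x⁻¹)` on functions on `Γ̃_n`. -/
noncomputable def weightedForm (ξ : ClassFn Γ) {n : ℕ} (f g : BG Γ n → ℂ) : ℂ :=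
  (Nat.card (BG Γ n) : ℂ)⁻¹ * ∑ x : BG Γ n, eta ξ x.left.1 x.right * f x * g x⁻¹

theorem weightedForm_congr (ξ : ClassFn Γ) {n : ℕ} {f g g' : BG Γ n → ℂ}
    (h : ∀ x, f x * g x⁻¹ = f x * g' x⁻¹) : weightedForm ξ f g = weightedForm ξ f g' := by
  unfold weightedForm
  congr 1
  refine Finset.sum_congr rfl fun x _ => ?_
  rw [mul_assoc, h, mul_assoc]

theorem weightedForm_add (ξ : ClassFn Γ) {n : ℕ} (f g g' : BG Γ n → ℂ) :
    weightedForm ξ f (fun x => g x + g' x) = weightedForm ξ f g + weightedForm ξ f g' := by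
  unfold weightedForm
  rw [← mul_add, ← Finset.sum_add_distrib]
  congr 1
  exact Finset.sum_congr rfl fun x _ => mul_add _ _ _

theorem weightedForm_smul (ξ : ClassFn Γ) {n : ℕ} (c : ℂ) (f g : BG Γ n → ℂ) :
    weightedForm ξ f (fun x => c * g x) = c * weightedForm ξ f g := by
  unfold weightedForm
  rw [mul_left_comm]
  congr 1
  rw [Finset.mul_sum]
  exact Finset.sum_congr rfl fun x _ => mul_left_comm _ _ _

/-- `f ↦ ⟨χ_n(γ), Res f⟩_ξ`, from `R⁻(Γ̃_m)` to `R⁻(Γ̃_k)`, `m = n + k`: `f` is restricted to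
`Γ̃_n ×̂ Γ̃_k`, and the form is taken in the variable in `Γ̃_n`. -/
noncomputable def resChi (ξ γ : ClassFn Γ) {n k m : ℕ} (h : n + k = m) :
    spinSuper Γ m →ₗ[ℂ] spinSuper Γ k where
  toFun f := ⟨fun y => weightedForm ξ (chi γ n) (fun x => f.1 (inclL h x * inclR h y)), by
    refine ⟨fun y t => ?_, fun y => ?_, fun y hy => ?_⟩
    · refine weightedForm_congr ξ fun x => ?_
      by_cases hx : parity x = 1
      · rw [chi_odd γ x hx, zero_mul, zero_mul]
      · have hc : inclL h x⁻¹ * inclR h t = inclR h t * inclL h x⁻¹ := by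
          rw [inclL_mul_inclR, parity_inv hx, zero_mul]
          exact one_mul _
        have : inclL h x⁻¹ * inclR h (t * y * t⁻¹) =
            inclR h t * (inclL h x⁻¹ * inclR h y) * (inclR h t)⁻¹ := by
          rw [map_mul, map_mul, ← mul_assoc, ← mul_assoc, hc, map_inv (inclR h) t]
          simp only [mul_assoc]
        show _ * f.1 (inclL h x⁻¹ * inclR h (t * y * t⁻¹)) = _ * f.1 (inclL h x⁻¹ * inclR h y)
        rw [this, f.2.1]
    · show weightedForm ξ (chi γ n) (fun x => f.1 (inclL h x * inclR h (zBG k * y))) =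
        -weightedForm ξ (chi γ n) (fun x => f.1 (inclL h x * inclR h y))
      rw [← neg_one_mul, ← weightedForm_smul]
      refine weightedForm_congr ξ fun x => ?_
      have : inclL h x⁻¹ * inclR h (zBG k * y) = zBG m * (inclL h x⁻¹ * inclR h y) := by
        rw [map_mul, inclR, incl_zBG, ← mul_assoc, ← zBG_mul, mul_assoc]
      rw [this, f.2.2.1, neg_one_mul]
    · show weightedForm ξ (chi γ n) (fun x => f.1 (inclL h x * inclR h y)) = 0
      rw [← zero_mul (weightedForm ξ (chi γ n) (fun x => f.1 (inclL h x * inclR h y))),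
        ← weightedForm_smul]
      refine weightedForm_congr ξ fun x => ?_
      by_cases hx : parity x = 1
      · rw [chi_odd γ x hx, zero_mul, zero_mul]
      · rw [f.2.2.2, zero_mul]
        rw [parity_mul, inclL, inclR, parity_incl, parity_incl, parity_inv hx, hy, zero_add]⟩
  map_add' f g := by
    refine Subtype.ext (funext fun y => ?_)
    show weightedForm ξ (chi γ n) (fun x => f.1 (inclL h x * inclR h y) +
      g.1 (inclL h x * inclR h y)) = _
    rw [weightedForm_add]
    rfl
  map_smul' c f := by
    refine Subtype.ext (funext fun y => ?_)
    show weightedForm ξ (chi γ n) (fun x => c * f.1 (inclL h x * inclR h y)) = _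
    rw [weightedForm_smul]
    rfl

/-- The operator `H_{-n}(γ)` on `R̃_Γ`: on `R⁻(Γ̃_m)` it is `f ↦ Ind (χ_n(γ) ⊗ f)`. -/
noncomputable def HNeg (γ : ClassFn Γ) (n : ℕ) : Module.End ℂ (RTotal Γ) :=
  DirectSum.toModule ℂ ℕ (RTotal Γ) fun m =>
    DirectSum.lof ℂ ℕ (fun i => spinSuper Γ i) (n + m) ∘ₗ indChi γ (rfl : n + m = n + m)

/-- The operator `H_n(γ)` on `R̃_Γ`: on `R⁻(Γ̃_m)` it is `f ↦ ⟨χ_n(γ), Res f⟩_ξ` if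
`n ≤ m`, and zero otherwise. -/
noncomputable def HPos (ξ γ : ClassFn Γ) (n : ℕ) : Module.End ℂ (RTotal Γ) :=
  DirectSum.toModule ℂ ℕ (RTotal Γ) fun m =>
    if h : n ≤ m then
      DirectSum.lof ℂ ℕ (fun i => spinSuper Γ i) (m - n) ∘ₗ resChi ξ γ (Nat.add_sub_of_le h)
    else 0

/-- `H_+(γ, z) = ∑_{n ≥ 0} H_{-n}(γ) z^n`, a power series in `z`. -/
noncomputable def HPlus (γ : ClassFn Γ) : PowerSeries (Module.End ℂ (RTotal Γ)) :=
  PowerSeries.mk fun n => HNeg γ n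

/-- `H_-(γ, z) = ∑_{n ≥ 0} H_n(γ) z^{-n}`, a power series in `z⁻¹`. -/
noncomputable def HMinus (ξ γ : ClassFn Γ) : PowerSeries (Module.End ℂ (RTotal Γ)) :=
  PowerSeries.mk fun n => HPos ξ γ n

end Operators

/-! ### The Fock space and the characteristic map -/

section Fock

variable {Γ : Type*} [Group Γ]

/-- The Fock space `S⁻_Γ`: the symmetric algebra generated by the `a_{-n}(γ)`, `n` odd and
positive, linear in `γ ∈ R(Γ)`; that is, the symmetric algebra of `⨁_{n odd} R(Γ)`. -/
abbrev Fock (Γ : Type*) [Group Γ] : Type _ :=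
  SymmetricAlgebra ℂ ({n : ℕ // Odd n} →₀ ClassFn Γ)

/-- The element `a_{-n}(γ)` of the Fock space for odd `n`, and `0` for even `n`. -/
noncomputable def aNeg (n : ℕ) (γ : ClassFn Γ) : Fock Γ :=
  if h : Odd n then SymmetricAlgebra.ι ℂ _ (Finsupp.single ⟨n, h⟩ γ) else 0

variable [Fintype Γ]

/-- The weighted bilinear form `⟨f, g⟩_ξ = ⟨ξ * f, g⟩_Γ = |Γ|⁻¹ ∑_x ξ(x) f(x) g(x⁻¹)` on
`R(Γ)`, as a linear functional of `g`. -/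
noncomputable def classForm (ξ f : ClassFn Γ) : ClassFn Γ →ₗ[ℂ] ℂ where
  toFun g := (Fintype.card Γ : ℂ)⁻¹ *
    ∑ x : Γ, ξ (ConjClasses.mk x) * f (ConjClasses.mk x) * g (ConjClasses.mk x⁻¹)
  map_add' g g' := by
    rw [← mul_add, ← Finset.sum_add_distrib]
    congr 1
    exact Finset.sum_congr rfl fun x _ => mul_add _ _ _
  map_smul' c g := by
    rw [RingHom.id_apply, smul_eq_mul, mul_left_comm]
    congr 1
    rw [Finset.mul_sum]
    exact Finset.sum_congr rfl fun x _ => mul_left_comm _ _ _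

/-- The linear functional `⨁_{m odd} R(Γ) → ℂ` with `a_{-m}(β) ↦ (n/2) δ_{n,m} ⟨γ, β⟩_ξ`. -/
noncomputable def contraction (ξ γ : ClassFn Γ) (n : ℕ) :
    ({n : ℕ // Odd n} →₀ ClassFn Γ) →ₗ[ℂ] ℂ :=
  if h : Odd n then ((n : ℂ) / 2) • (classForm ξ γ ∘ₗ Finsupp.lapply ⟨n, h⟩) else 0

/-- The algebra homomorphism `v ↦ v + c(v) ε` to the dual numbers over the Fock space, `c` the
functional `contraction ξ γ n`; its `ε`-part is a derivation. -/
noncomputable def aPosLift (ξ γ : ClassFn Γ) (n : ℕ) :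
    Fock Γ →ₐ[ℂ] TrivSqZeroExt (Fock Γ) (Fock Γ) :=
  SymmetricAlgebra.lift
    ((TrivSqZeroExt.inlAlgHom ℂ (Fock Γ) (Fock Γ)).toLinearMap ∘ₗ SymmetricAlgebra.ι ℂ _ +
      (TrivSqZeroExt.inrHom (Fock Γ) (Fock Γ)).restrictScalars ℂ ∘ₗ
        Algebra.linearMap ℂ (Fock Γ) ∘ₗ contraction ξ γ n)

/-- The operator `a_n(γ)`, `n > 0`, on the Fock space (`0` for even `n`): the derivation with
`a_n(γ) · a_{-m}(β) = (n/2) δ_{n,m} ⟨γ, β⟩_ξ`. Together with the multiplications by `a_{-n}(γ)`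
it satisfies `[a_m(γ), a_n(γ')] = (m/2) δ_{m,-n} ⟨γ, γ'⟩_ξ`. -/
noncomputable def aPos (ξ γ : ClassFn Γ) (n : ℕ) : Module.End ℂ (Fock Γ) :=
  (TrivSqZeroExt.sndHom (Fock Γ) (Fock Γ)).restrictScalars ℂ ∘ₗ (aPosLift ξ γ n).toLinearMap

theorem aPosLift_fst (ξ γ : ClassFn Γ) (n : ℕ) (v : Fock Γ) : (aPosLift ξ γ n v).fst = v := by
  have : (TrivSqZeroExt.fstHom ℂ (Fock Γ) (Fock Γ)).comp (aPosLift ξ γ n) = AlgHom.id ℂ _ := by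
    refine SymmetricAlgebra.algHom_ext (LinearMap.ext fun w => ?_)
    simp [aPosLift]
  exact DFunLike.congr_fun this v

theorem aPos_mul (ξ γ : ClassFn Γ) (n : ℕ) (v w : Fock Γ) :
    aPos ξ γ n (v * w) = v * aPos ξ γ n w + w * aPos ξ γ n v := by
  show (aPosLift ξ γ n (v * w)).snd = v * (aPosLift ξ γ n w).snd + w * (aPosLift ξ γ n v).snd
  rw [map_mul, TrivSqZeroExt.snd_mul, aPosLift_fst, aPosLift_fst]
  simp [mul_comm]

theorem aPos_aNeg (ξ γ β : ClassFn Γ) {n m : ℕ} (hn : Odd n) (hm : Odd m) :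
    aPos ξ γ n (aNeg m β) =
      algebraMap ℂ (Fock Γ) (if n = m then (n : ℂ) / 2 * classForm ξ γ β else 0) := by
  show (aPosLift ξ γ n (aNeg m β)).snd = _
  rw [aNeg, dif_pos hm, aPosLift, SymmetricAlgebra.lift_ι_apply]
  simp only [LinearMap.add_apply, LinearMap.comp_apply, TrivSqZeroExt.snd_add, contraction,
    dif_pos hn]
  by_cases h : n = m
  · subst h
    simp
  · simp [h]

/-- `ζ_c = |Γ| / |c|`, the order of the centralizer of an element of `c`. -/
noncomputable def zeta (c : ConjClasses Γ) : ℂ := Fintype.card Γ / Nat.card c.carrier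

/-- The element `a_{-n}(c) = ∑_{γ ∈ Γ*} γ(c⁻¹) a_{-n}(γ)`. By the orthogonality of characters
`∑_{γ ∈ Γ*} γ(c⁻¹) γ` is the class function with value `ζ_c` on `c` and `0` elsewhere, so that
`a_{-n}(γ) = ∑_c ζ_c⁻¹ γ(c) a_{-n}(c)` for all `γ ∈ R(Γ)`. -/
noncomputable def aNegClass (n : ℕ) (c : ConjClasses Γ) : Fock Γ :=
  aNeg n (Pi.single c (zeta c))

/-- The set `OP_n(Γ_*)` of partition-valued functions on `Γ_*` of total size `n` with odd parts. -/
def OP (Γ : Type*) [Group Γ] [Fintype Γ] (n : ℕ) : Set (ConjClasses Γ → Multiset ℕ) :=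
  {ρ | (∀ c, ∀ i ∈ ρ c, Odd i) ∧ ∑ c, (ρ c).sum = n}

theorem OP_finite (Γ : Type*) [Group Γ] [Fintype Γ] (n : ℕ) : (OP Γ n).Finite := by
  have h1 : {μ : Multiset ℕ | (∀ i ∈ μ, Odd i) ∧ μ.sum ≤ n}.Finite := by
    refine ((Set.finite_Iic n).biUnion fun k _ =>
      Set.finite_range (fun p : Nat.Partition k => p.parts)).subset ?_
    rintro μ ⟨h, hn⟩
    simp only [Set.mem_iUnion, Set.mem_range]
    exact ⟨μ.sum, hn, ⟨μ, fun hi => (h _ hi).pos, rfl⟩, rfl⟩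
  refine (Set.Finite.pi (fun _ : ConjClasses Γ => h1)).subset ?_
  rintro ρ ⟨h, hn⟩ c _
  exact ⟨h c, hn ▸ Finset.single_le_sum (f := fun c => (ρ c).sum) (fun _ _ => Nat.zero_le _)
    (Finset.mem_univ c)⟩

/-- `Z_ρ = ∏_{c, i} i ^ {m_i(c)} m_i(c)! ζ_c ^ {l(ρ(c))}`. -/
noncomputable def zRho (ρ : ConjClasses Γ → Multiset ℕ) : ℂ :=
  ∏ c, (((ρ c).prod : ℂ) * (∏ i ∈ (ρ c).toFinset, ((ρ c).count i).factorial : ℕ) *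
    zeta c ^ Multiset.card (ρ c))

/-- `a'_{-ρ} = ∏_c ∏_{i ∈ ρ(c)} a_{-i}(c)`. -/
noncomputable def aRho (ρ : ConjClasses Γ → Multiset ℕ) : Fock Γ :=
  ∏ c, ((ρ c).map fun i => aNegClass i c).prod

/-- An element `(g, s)` of `Γ_n` of type `ρ`, i.e. a representative of the class `D_ρ⁺`. -/
noncomputable def wreathRepr (n : ℕ) (ρ : ConjClasses Γ → Multiset ℕ) :
    (Fin n → Γ) × Equiv.Perm (Fin n) :=
  Classical.epsilon fun x => wreathType x.1 x.2 = ρ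

/-- The value `f_ρ = f(D_ρ⁺)`. -/
noncomputable def valueAt {n : ℕ} (ρ : ConjClasses Γ → Multiset ℕ) : spinSuper Γ n →ₗ[ℂ] ℂ :=
  LinearMap.proj (ofWreath (wreathRepr n ρ).1 (wreathRepr n ρ).2) ∘ₗ (spinSuper Γ n).subtype

/-- The characteristic map `ch : R̃_Γ → S⁻_Γ`,
`ch(f) = ∑_{ρ ∈ OP_n(Γ_*)} Z_ρ⁻¹ f_ρ a'_{-ρ}` for `f ∈ R⁻(Γ̃_n)`. -/
noncomputable def ch : RTotal Γ →ₗ[ℂ] Fock Γ :=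
  DirectSum.toModule ℂ ℕ (Fock Γ) fun n =>
    ∑ ρ ∈ (OP_finite Γ n).toFinset, (valueAt ρ).smulRight ((zRho ρ)⁻¹ • aRho ρ)

end Fock

/-! ### Formal series of operators -/

section Series

variable {V W : Type*} [AddCommMonoid V] [Module ℂ V] [AddCommMonoid W] [Module ℂ W]

/-- The exponential `∑_m A^m / m!` of a formal power series `A` without constant term and with
coefficients in `End(V)`. -/
noncomputable def seriesExp (A : PowerSeries (Module.End ℂ V)) : PowerSeries (Module.End ℂ V) :=
  PowerSeries.mk fun n =>
    ∑ m ∈ Finset.range (n + 1), ((m.factorial : ℂ)⁻¹) • PowerSeries.coeff n (A ^ m)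

/-- Coefficientwise `f ↦ φ f φ⁻¹`. For `φ = ch` this is the extension of `ch` to operators:
`ch(f) (ch(v)) = ch(f v)`. -/
noncomputable def transport (φ : V ≃ₗ[ℂ] W) (A : PowerSeries (Module.End ℂ V)) :
    PowerSeries (Module.End ℂ W) :=
  PowerSeries.mk fun n => φ.conj (PowerSeries.coeff n A)

/-- Every vector is killed by all but finitely many coefficients of `B`. -/
def IsLocallyFinite (B : PowerSeries (Module.End ℂ V)) : Prop :=
  ∀ v, {j | PowerSeries.coeff j B v ≠ 0}.Finite

/-- The coefficient of `z ^ k` (`k ∈ ℤ`) in the product `A(z) B(z⁻¹)` of a power series `A` in `z`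
and a locally finite power series `B` in `z⁻¹`, namely `v ↦ ∑_{i - j = k} A_i (B_j v)`; it is set
to `0` if `B` is not locally finite. -/
noncomputable def mulCoeff (A B : PowerSeries (Module.End ℂ V)) (k : ℤ) : Module.End ℂ V :=
  if hB : IsLocallyFinite B then
    { toFun := fun v => ∑ᶠ j : ℕ,
        if 0 ≤ k + j then PowerSeries.coeff (k + j).toNat A (PowerSeries.coeff j B v) else 0
      map_add' := fun v w => by
        rw [← finsum_add_distrib]
        · refine finsum_congr fun j => ?_
          split_ifs <;> simp
        · exact (hB v).subset fun j hj h0 => hj (by simp [h0])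
        · exact (hB w).subset fun j hj h0 => hj (by simp [h0])
      map_smul' := fun c v => by
        rw [RingHom.id_apply, smul_finsum' c
          ((hB v).subset fun j hj h0 => hj (by simp [h0]))]
        refine finsum_congr fun j => ?_
        split_ifs <;> simp }
  else 0

/-- `A(-z)`. -/
noncomputable def negArg (A : PowerSeries (Module.End ℂ V)) : PowerSeries (Module.End ℂ V) :=
  PowerSeries.mk fun n => ((-1 : ℂ) ^ n) • PowerSeries.coeff n A

/-- The operators `A_n ⊗ 1` on `V ⊗ L`. -/
noncomputable def tensorId (L : Type*) [AddCommMonoid L] [Module ℂ L]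
    (A : PowerSeries (Module.End ℂ V)) : PowerSeries (Module.End ℂ (TensorProduct ℂ V L)) :=
  PowerSeries.mk fun n => LinearMap.rTensor L (PowerSeries.coeff n A)

variable {Γ : Type*} [Group Γ] [Fintype Γ]

/-- `∑_{n odd} (2/n) a_{-n}(γ) z^n`, with `a_{-n}(γ)` acting on the Fock space by
multiplication. -/
noncomputable def creationSeries (γ : ClassFn Γ) : PowerSeries (Module.End ℂ (Fock Γ)) :=
  PowerSeries.mk fun n => if Odd n then ((2 : ℂ) / n) • LinearMap.mulLeft ℂ (aNeg n γ) else 0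

/-- `∑_{n odd} (2/n) a_n(γ) z^{-n}`, as a power series in `z⁻¹`. -/
noncomputable def annihilationSeries (ξ γ : ClassFn Γ) : PowerSeries (Module.End ℂ (Fock Γ)) :=
  PowerSeries.mk fun n => if Odd n then ((2 : ℂ) / n) • aPos ξ γ n else 0

end Series

/-! ### Twisted vertex operators -/

section Vertex

variable (Γ : Type*) [Group Γ]

/-- The lattice `R_ℤ(Γ)` of virtual characters: the `ℤ`-span of the irreducible characters. -/
def virtualChars : AddSubgroup (ClassFn Γ) :=
  AddSubgroup.closure {χ | ∃ (d : ℕ) (ρ : Representation ℂ Γ (Fin d → ℂ)),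
    ρ.IsIrreducible ∧ ∀ x : Γ, χ (ConjClasses.mk x) = ρ.character x}

/-- `R_ℤ(Γ) / 2 R_ℤ(Γ)`. -/
abbrev latticeMod2 : Type _ := virtualChars Γ ⧸ (zsmulAddGroupHom (α := virtualChars Γ) 2).range

variable {Γ} [Fintype Γ]

/-- The integer `⟨α, β⟩_ξ` for virtual characters `α`, `β`, `ξ`. -/
noncomputable def latticeForm (ξ : ClassFn Γ) (α β : virtualChars Γ) : ℤ :=
  round (classForm ξ α.1 β.1).re

/-- `c_1(α, β) = ⟨α, β⟩_ξ + ⟨α, α⟩_ξ ⟨β, β⟩_ξ mod 2`. -/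
noncomputable def c1 (ξ : ClassFn Γ) (α β : virtualChars Γ) : ZMod 2 :=
  ((latticeForm ξ α β + latticeForm ξ α α * latticeForm ξ β β : ℤ) : ZMod 2)

/-- A subgroup `Φ ⊇ 2 R_ℤ(Γ)` such that `c_1` vanishes on `Φ / 2 R_ℤ(Γ)`. -/
def IsIsotropic (ξ : ClassFn Γ) (Φ : AddSubgroup (virtualChars Γ)) : Prop :=
  (∀ α, (2 : ℤ) • α ∈ Φ) ∧ ∀ α ∈ Φ, ∀ β ∈ Φ, c1 ξ α β = 0

/-- The choices entering the twisted vertex operators: a maximal isotropic subgroup `Φ`, a central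
extension of `R_ℤ(Γ) / 2 R_ℤ(Γ)` by `⟨±1⟩` with commutator map `(-1) ^ c_1`, lifts `e_ᾱ` of the
elements `ᾱ`, and an irreducible module structure over it on the group algebra `ℂ[R_ℤ(Γ) / Φ]` on
which `-1` acts as `-1` and `e_ᾱ e^{[β]} = ε(α, β) e^{[α + β]}` with signs `ε(α, β)`. -/
structure TwistedModule (ξ : ClassFn Γ) where
  /-- the maximal isotropic subgroup -/
  Φ : AddSubgroup (virtualChars Γ)
  maximal : Maximal (IsIsotropic ξ) Φ
  /-- the central extension -/
  E : Type
  [group : Group E]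
  ext : GroupExtension ℤˣ E (Multiplicative (latticeMod2 Γ))
  central : ∀ (u : ℤˣ) (a : E), ext.inl u * a = a * ext.inl u
  commutator : ∀ (a b : E) (α β : virtualChars Γ),
    ext.rightHom a = Multiplicative.ofAdd (QuotientAddGroup.mk α) →
    ext.rightHom b = Multiplicative.ofAdd (QuotientAddGroup.mk β) →
    a * b * a⁻¹ * b⁻¹ = ext.inl ((-1) ^ (c1 ξ α β).val)
  /-- the lifts `e_ᾱ` -/
  e : latticeMod2 Γ → E
  rightHom_e : ∀ α, ext.rightHom (e α) = Multiplicative.ofAdd α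
  /-- the module structure -/
  rep : Representation ℂ E (AddMonoidAlgebra ℂ (virtualChars Γ ⧸ Φ))
  irreducible : rep.IsIrreducible
  rep_neg_one : rep (ext.inl (-1)) = -1
  /-- the signs `ε(α, β)` -/
  ε : virtualChars Γ → virtualChars Γ → ℤˣ
  rep_e : ∀ α β : virtualChars Γ,
    rep (e (QuotientAddGroup.mk α)) (AddMonoidAlgebra.single (QuotientAddGroup.mk β) 1) =
      AddMonoidAlgebra.single (QuotientAddGroup.mk (α + β)) ((ε α β : ℤ) : ℂ)

attribute [instance] TwistedModule.group

namespace TwistedModule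

variable {ξ : ClassFn Γ} (M : TwistedModule ξ)

/-- The group algebra `ℂ[R_ℤ(Γ) / Φ]`. -/
abbrev L : Type _ := AddMonoidAlgebra ℂ (virtualChars Γ ⧸ M.Φ)

/-- The operator `1 ⊗ e_γ̄` on `V ⊗ ℂ[R_ℤ(Γ) / Φ]`. -/
noncomputable def eOp (V : Type*) [AddCommMonoid V] [Module ℂ V] (γ : virtualChars Γ) :
    Module.End ℂ (TensorProduct ℂ V M.L) :=
  LinearMap.lTensor V (M.rep (M.e (QuotientAddGroup.mk γ)))

/-- The component `X_n(γ)` of the group-theoretic twisted vertex operator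
`X(γ, z) = H_+(γ, z) H_-(γ, -z) e_γ̄ = ∑_n X_n(γ) z^{-n}` on `R̃_Γ ⊗ ℂ[R_ℤ(Γ) / Φ]`. -/
noncomputable def X (γ : virtualChars Γ) (n : ℤ) : Module.End ℂ (TensorProduct ℂ (RTotal Γ) M.L) :=
  mulCoeff (tensorId M.L (HPlus γ.1)) (tensorId M.L (negArg (HMinus ξ γ.1))) (-n) *
    M.eOp (RTotal Γ) γ

/-- The coefficient of `z^{-n}` in the Frenkel–Lepowsky–Meurman twisted vertex operator
`exp(∑_{n odd} (2/n) a_{-n}(γ) z^n) exp(-∑_{n odd} (2/n) a_n(γ) z^{-n}) e_γ̄`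
on `S⁻_Γ ⊗ ℂ[R_ℤ(Γ) / Φ]`. -/
noncomputable def flmX (γ : virtualChars Γ) (n : ℤ) : Module.End ℂ (TensorProduct ℂ (Fock Γ) M.L) :=
  mulCoeff (tensorId M.L (seriesExp (creationSeries γ.1)))
      (tensorId M.L (seriesExp (-annihilationSeries ξ γ.1))) (-n) *
    M.eOp (Fock Γ) γ

end TwistedModule

end Vertex

end SpinWreath

/-! Both exponentials come from one recursion. For a function F of types (partition-valued functions
on Γ_*), `avgType n F` is its average over Γ^n ⋊ S_n. Counting pairs of a permutation and a marked
point, and splitting off the cycle through that point, gives `avgType_succ`: (n+1) avg_{n+1}(F) =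
∑_{i+j=n} ∑_c ζ_c⁻¹ avg_j(F((c, i+1) + ·)), where (c, i+1) stands for a single cycle. For
multiplicative F this is Newton's identity n h_n = ∑ p_i h_{n-i}. The exponential of a series A with
zero constant term and commuting coefficients satisfies the same recursion with i A_i in the place
of p_i, and is determined by it (`eq_coeff_seriesExp`). The recursion also shows that the elements
of type ρ have proportion Z_ρ⁻¹ (`avgType_indicator`), so that ch(f) is the average of f(x)
a'_{-type(x)} (`ch_lof`).

The spin structure enters through three facts. In the basis of ordered monomials an element (a, s)
acts on the Clifford algebra by a signed permutation matrix; hence summing χ_n over Π_n against a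
spin function returns 2^{n+1} times its value at 1 (`sum_basicChar_mul`), and χ_n(s) = 2^{number of
cycles} when all cycles of s are odd (`basicChar_one_eq`). Finally, an element of R⁻ vanishes on
permutations with an even cycle, and is determined by its values on odd types
(`apply_ofWreath_of_even`, `spinSuper_eq_zero`).

Creation: Π_m lies in the spin product, so induction reduces to Γ_n × Γ_k inside Γ_{n+k}.
Reciprocity and additivity of types give ch(H_{-n}(γ) v) = h_n ch(v), where h_n = `chImage γ n` is
the average of ∏ 2γ(c) a_{-i}(c) over the cycles. Since ∑_c ζ_c⁻¹ γ(c) a_{-i}(c) = a_{-i}(γ),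
Newton's identity makes ∑ h_n z^n the asserted exponential.

Annihilation: by the first fact, pairing with χ_n(γ) is the average over types ρ of f(ρ + σ),
weighted by ξγ at the inverse class of each cycle. On the Fock space the derivation 2a_i(γ) removes
one cycle of length i with the same weight (`twicePos_fockOf`), and the recursion for the
exponential assembles these removals into the weighted average (`coeff_seriesExp_annihilation`).

Bijectivity: products of annihilators followed by the augmentation read off every coefficient of
ch(f), which gives injectivity. The range contains 1 and is stable under all h_n, hence by Newton's
identity under all a_{-n}(γ), which gives surjectivity. The statement on vertex operators follows by
conjugating coefficientwise; replacing z by -z negates the exponent because only odd powers occur in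
it. -/

namespace SpinWreath

open scoped Classical TensorProduct

/-! ### Trace of the basic spin module -/

/-! ### Ordered monomials in anticommuting square roots of -1. -/

section OrderedMonomials

/-- The sign `(-1) ^ k`. -/
noncomputable def sgn (k : ZMod 2) : ℂ := (-1 : ℂ) ^ k.val

theorem sgn_add (k l : ZMod 2) : sgn (k + l) = sgn k * sgn l := negOnePow_add k l

@[simp] theorem sgn_zero : sgn 0 = 1 := by simp [sgn]

@[simp] theorem sgn_one : sgn 1 = -1 := by simp [sgn, ZMod.val_one]

theorem zmod_two_cases (k : ZMod 2) : k = 0 ∨ k = 1 := by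
  fin_cases k
  · exact Or.inl rfl
  · exact Or.inr rfl

variable {A : Type*} [Ring A] [Algebra ℂ A]

/-- Moving x to the left past the product costs one sign for each factor that is present. -/
theorem prod_ofFn_mul_pow {n : ℕ} {E : Fin n → A} {x : A} (hx : ∀ i, E i * x = -(x * E i))
    (u : Fin n → ZMod 2) (k : ZMod 2) :
    (List.ofFn fun i => E i ^ (u i).val).prod * x ^ k.val =
      sgn ((∑ i, u i) * k) • (x ^ k.val * (List.ofFn fun i => E i ^ (u i).val).prod) := by
  rcases zmod_two_cases k with rfl | rfl
  · simp
  · simp only [ZMod.val_one, pow_one, mul_one]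
    induction n with
    | zero => simp
    | succ n ih =>
      rw [List.ofFn_succ, List.prod_cons, mul_assoc, ih (fun i => hx i.succ) (fun i => u i.succ),
        Fin.sum_univ_succ, sgn_add, mul_smul_comm, ← mul_assoc]
      have h0 : E 0 ^ (u 0).val * x = sgn (u 0) • (x * E 0 ^ (u 0).val) := by
        rcases zmod_two_cases (u 0) with h | h <;> rw [h]
        · simp
        · simp [ZMod.val_one, hx]
      rw [h0, smul_mul_assoc, smul_smul, mul_comm, mul_assoc]

theorem pow_val_mul_pow_val {x : A} (hx : x * x = -1) (k l : ZMod 2) :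
    x ^ k.val * x ^ l.val = sgn (k * l) • x ^ (k + l).val := by
  rcases zmod_two_cases k with rfl | rfl
  · simp
  · rcases zmod_two_cases l with rfl | rfl
    · simp
    · rw [CharTwo.add_self_eq_zero]
      simp [ZMod.val_one, hx]

theorem cocycle_succ {n : ℕ} (u v : Fin (n + 1) → ZMod 2) :
    PiGroup.cocycle u v = u 0 * v 0 + (∑ i : Fin n, u i.succ) * v 0 +
      PiGroup.cocycle (fun i => u i.succ) (fun i => v i.succ) := by
  unfold PiGroup.cocycle
  simp [Fin.sum_univ_succ, Finset.sum_add_distrib, Finset.sum_mul, add_assoc]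

/-- The relations used to bring a product to normal form are those that define `PiGroup.cocycle`, so
the same sign appears. The induction peels off the first factor of each monomial. -/
theorem prod_ofFn_mul_prod_ofFn {n : ℕ} {E : Fin n → A} (hsq : ∀ i, E i * E i = -1)
    (hanti : ∀ i j, i ≠ j → E i * E j = -(E j * E i)) (u v : Fin n → ZMod 2) :
    (List.ofFn fun i => E i ^ (u i).val).prod * (List.ofFn fun i => E i ^ (v i).val).prod =
      sgn (PiGroup.cocycle u v) • (List.ofFn fun i => E i ^ ((u + v) i).val).prod := by
  induction n with
  | zero => simp [PiGroup.cocycle]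
  | succ n ih =>
    have ih' := ih (E := fun i => E i.succ) (fun i => hsq _)
      (fun i j hij => hanti _ _ (by simpa using hij)) (fun i => u i.succ) (fun i => v i.succ)
    have hc := prod_ofFn_mul_pow (E := fun i : Fin n => E i.succ) (x := E 0)
      (fun i => hanti _ _ (Fin.succ_ne_zero i)) (fun i => u i.succ) (v 0)
    simp only [List.ofFn_succ, List.prod_cons]
    rw [mul_assoc, ← mul_assoc _ (E 0 ^ _), hc, smul_mul_assoc, mul_smul_comm, ← mul_assoc,
      ← mul_assoc, pow_val_mul_pow_val (hsq 0), mul_assoc, ih', cocycle_succ, sgn_add, sgn_add]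
    simp only [smul_mul_assoc, mul_smul_comm, smul_smul]
    congr 1
    ring

end OrderedMonomials

/-! ### The monomial basis of the Clifford algebra and the trace on it. -/

section BasicCharacter

variable {n : ℕ}

theorem cliffordE_mul_self (i : Fin n) : cliffordE i * cliffordE i = -1 := by
  have h := cliffordE_mul_add i i
  rw [if_pos rfl, ← two_mul, map_neg, map_ofNat] at h
  have h2 : (2 : ℂ) • (cliffordE i * cliffordE i) = (2 : ℂ) • (-1 : cliffordL n) := by
    rw [ofNat_smul_eq_nsmul ℂ, ofNat_smul_eq_nsmul ℂ, two_nsmul, two_nsmul, ← two_mul, h]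
    norm_num
  exact smul_right_injective _ (two_ne_zero) h2

theorem cliffordE_anticomm (i j : Fin n) (h : i ≠ j) :
    cliffordE i * cliffordE j = -(cliffordE j * cliffordE i) := by
  have := cliffordE_mul_add i j
  rw [if_neg h, map_zero] at this
  exact eq_neg_of_add_eq_zero_left this

theorem cliffordMonomial_mul (a b : PiGroup n) :
    cliffordMonomial (a * b) = cliffordMonomial a * cliffordMonomial b := by
  unfold cliffordMonomial
  rw [smul_mul_smul_comm,
    prod_ofFn_mul_prod_ofFn cliffordE_mul_self cliffordE_anticomm a.supp b.supp, smul_smul]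
  simp only [PiGroup.mul_zexp, PiGroup.mul_supp, negOnePow_add]
  rfl

theorem cliffordMonomial_one : cliffordMonomial (1 : PiGroup n) = 1 := by
  have h : ∀ i : Fin n, cliffordE i ^ (0 : ZMod 2).val = 1 := fun i => by simp
  simp [cliffordMonomial]

/-- The monomials of the Clifford algebra as a homomorphism. -/
noncomputable def monomialHom (n : ℕ) : PiGroup n →* cliffordL n where
  toFun := cliffordMonomial
  map_one' := cliffordMonomial_one
  map_mul' := cliffordMonomial_mul

theorem cliffordMonomial_gen (i : Fin n) : cliffordMonomial (PiGroup.gen i) = cliffordE i := by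
  have h : ∀ (m : ℕ) (E : Fin m → cliffordL n) (i : Fin m),
      (List.ofFn fun j => E j ^ ((Pi.single i 1 : Fin m → ZMod 2) j).val).prod = E i := by
    intro m
    induction m with
    | zero => intro E i; exact i.elim0
    | succ m ih =>
      intro E i
      rw [List.ofFn_succ, List.prod_cons]
      refine Fin.cases ?_ (fun i => ?_) i
      · simp [ZMod.val_one, Fin.succ_ne_zero]
      · have := ih (fun j => E j.succ) i
        rw [← this]
        simp [Pi.single_apply, Fin.ext_iff]
  simp [cliffordMonomial, PiGroup.gen, h]

theorem cliffordMonomial_zmul (k : ZMod 2) (u : Fin n → ZMod 2) :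
    cliffordMonomial ⟨k, u⟩ = sgn k • cliffordMonomial ⟨0, u⟩ := by
  simp [cliffordMonomial, sgn]

theorem permL_monomial (s : Equiv.Perm (Fin n)) (a : PiGroup n) :
    permL s (cliffordMonomial a) = cliffordMonomial (PiGroup.permuteHom s a) := by
  -- It suffices to compare on generators; `PiGroup.hom_ext` concerns homomorphisms into a group,
  -- hence the passage to units.
  have h : ((permL s : cliffordL n →* cliffordL n).comp (monomialHom n)).toHomUnits =
      ((monomialHom n).comp (PiGroup.permuteHom s)).toHomUnits := by
    refine PiGroup.hom_ext (Units.ext ?_) (fun i => Units.ext ?_)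
    · show permL s (cliffordMonomial _) = cliffordMonomial (PiGroup.permuteHom s _)
      rw [PiGroup.permuteHom_z, PiGroup.z, cliffordMonomial_zmul]
      change permL s (_ • cliffordMonomial (1 : PiGroup n)) = _ • cliffordMonomial (1 : PiGroup n)
      rw [cliffordMonomial_one, map_smul, map_one]
    · show permL s (cliffordMonomial _) = cliffordMonomial (PiGroup.permuteHom s _)
      rw [PiGroup.permuteHom_gen, cliffordMonomial_gen, cliffordMonomial_gen, permL_e]
  exact congrArg Units.val (DFunLike.congr_fun h a)

/-- The twisted regular representation of `Π_n` on functions on `(ℤ/2)^n`. -/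
noncomputable def regularRep (n : ℕ) :
    PiGroup n →* Module.End ℂ ((Fin n → ZMod 2) →₀ ℂ) where
  toFun a := Finsupp.lsum ℂ fun v => LinearMap.toSpanSingleton ℂ _
    (Finsupp.single (a.supp + v) (sgn (a.zexp + PiGroup.cocycle a.supp v)))
  map_one' := by
    refine Finsupp.lhom_ext fun v c => ?_
    simp [PiGroup.cocycle_zero_left]
  map_mul' a b := by
    refine Finsupp.lhom_ext fun v c => ?_
    simp only [Finsupp.lsum_single, LinearMap.toSpanSingleton_apply, Module.End.mul_apply,
      Finsupp.smul_single, smul_eq_mul, PiGroup.mul_supp, PiGroup.mul_zexp, add_assoc]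
    congr 1
    simp only [PiGroup.cocycle_add_left, PiGroup.cocycle_add_right, sgn_add]
    ring

theorem regularRep_single (a : PiGroup n) (v : Fin n → ZMod 2) (c : ℂ) :
    regularRep n a (Finsupp.single v c) =
      Finsupp.single (a.supp + v) (c * sgn (a.zexp + PiGroup.cocycle a.supp v)) := by
  simp [regularRep]

theorem regularRep_gen_mul (i j : Fin n) :
    regularRep n (PiGroup.gen i) * regularRep n (PiGroup.gen j) +
      regularRep n (PiGroup.gen j) * regularRep n (PiGroup.gen i) =
      algebraMap ℂ (Module.End ℂ ((Fin n → ZMod 2) →₀ ℂ)) (if i = j then -2 else 0) := by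
  have hz : regularRep n PiGroup.z = -1 := by
    refine Finsupp.lhom_ext fun v c => ?_
    rw [regularRep_single]
    simp [PiGroup.z, PiGroup.cocycle_zero_left]
  by_cases h : i = j
  · subst h
    rw [← map_mul, PiGroup.gen_mul_self, hz, if_pos rfl, map_neg, map_ofNat]
    norm_num
  · rw [← map_mul, PiGroup.gen_mul_gen h, map_mul, hz, if_neg h, map_zero, map_mul]
    exact LinearMap.ext fun w => neg_add_cancel _

/-- The Clifford algebra acts on functions on `(ℤ/2)^n`. -/
noncomputable def regularLift (n : ℕ) :
    cliffordL n →ₐ[ℂ] Module.End ℂ ((Fin n → ZMod 2) →₀ ℂ) :=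
  CliffordAlgebra.lift (cliffordForm n)
    ⟨Fintype.linearCombination ℂ fun i => regularRep n (PiGroup.gen i), fun v => by
    rw [Fintype.linearCombination_apply, Finset.sum_mul_sum]
    -- Doubling the sum and exchanging i and j in one copy leaves only the anticommutators, which
    -- `regularRep_gen_mul` evaluates.
    have h2 : (2 : ℂ) • ∑ i, ∑ j, (v i • regularRep n (PiGroup.gen i)) *
          (v j • regularRep n (PiGroup.gen j)) =
        (2 : ℂ) • algebraMap ℂ (Module.End ℂ ((Fin n → ZMod 2) →₀ ℂ)) (cliffordForm n v) := by
      rw [two_smul]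
      conv_lhs => enter [2]; rw [Finset.sum_comm]
      simp only [← Finset.sum_add_distrib, smul_mul_smul_comm]
      have : ∀ i j, (v i * v j) • (regularRep n (PiGroup.gen i) * regularRep n (PiGroup.gen j)) +
          (v j * v i) • (regularRep n (PiGroup.gen j) * regularRep n (PiGroup.gen i)) =
          algebraMap ℂ (Module.End ℂ ((Fin n → ZMod 2) →₀ ℂ))
            (if i = j then (2 : ℂ) * (-1 * (v i * v j)) else 0) := by
        intro i j
        rw [mul_comm (v j), ← smul_add, regularRep_gen_mul, Algebra.smul_def, ← map_mul]
        congr 1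
        split_ifs <;> ring
      simp only [this, ← map_sum]
      rw [Algebra.smul_def, ← map_mul]
      congr 1
      simp [cliffordForm, QuadraticMap.weightedSumSquares_apply, Finset.mul_sum]
    exact smul_right_injective _ (two_ne_zero) h2⟩

theorem regularLift_e (i : Fin n) :
    regularLift n (cliffordE i) = regularRep n (PiGroup.gen i) := by
  rw [regularLift, cliffordE, CliffordAlgebra.lift_ι_apply]
  simp [Fintype.linearCombination_apply_single]

theorem regularLift_monomial (a : PiGroup n) :
    regularLift n (cliffordMonomial a) = regularRep n a := by
  have h : ((regularLift n : cliffordL n →* _).comp (monomialHom n)).toHomUnits =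
      (regularRep n).toHomUnits := by
    refine PiGroup.hom_ext (Units.ext ?_) (fun i => Units.ext ?_)
    · show regularLift n (cliffordMonomial _) = regularRep n _
      rw [PiGroup.z, cliffordMonomial_zmul]
      change regularLift n (_ • cliffordMonomial (1 : PiGroup n)) = _
      rw [cliffordMonomial_one, map_smul, map_one]
      refine Finsupp.lhom_ext fun v c => ?_
      rw [regularRep_single]
      simp [PiGroup.cocycle_zero_left]
    · show regularLift n (cliffordMonomial _) = regularRep n _
      rw [cliffordMonomial_gen, regularLift_e]
  exact congrArg Units.val (DFunLike.congr_fun h a)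

/-- In the twisted regular representation the monomial with exponents u sends the basis vector at 0
to the basis vector at u, so a relation among monomials would be one among distinct basis vectors.
-/
theorem linearIndependent_monomial :
    LinearIndependent ℂ fun u : Fin n → ZMod 2 => cliffordMonomial ⟨0, u⟩ := by
  refine LinearIndependent.of_comp ((LinearMap.applyₗ (Finsupp.single 0 1)) ∘ₗ
    (regularLift n).toLinearMap) ?_
  have : ((LinearMap.applyₗ (Finsupp.single 0 1)) ∘ₗ (regularLift n).toLinearMap) ∘
      (fun u : Fin n → ZMod 2 => cliffordMonomial ⟨0, u⟩) = fun u => Finsupp.single u (1 : ℂ) := by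
    funext u
    show regularLift n (cliffordMonomial ⟨0, u⟩) (Finsupp.single 0 1) = _
    rw [regularLift_monomial, regularRep_single]
    simp [PiGroup.cocycle_zero_right]
  rw [this]
  exact Finsupp.linearIndependent_single_one ℂ _

/-- The span is stable under left multiplication by vectors, because a generator times a monomial is
again a monomial up to sign. It is therefore a left ideal, and it contains 1. -/
theorem span_monomial :
    ⊤ ≤ Submodule.span ℂ (Set.range fun u : Fin n → ZMod 2 =>
      (cliffordMonomial ⟨0, u⟩ : cliffordL n)) := by
  set S := Submodule.span ℂ (Set.range fun u : Fin n → ZMod 2 =>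
      (cliffordMonomial ⟨0, u⟩ : cliffordL n)) with hS
  have hm : ∀ a : PiGroup n, cliffordMonomial a ∈ S := fun a => by
    have := cliffordMonomial_zmul a.zexp a.supp
    change cliffordMonomial a = _ at this
    rw [this]
    exact S.smul_mem _ (Submodule.subset_span ⟨_, rfl⟩)
  have hι : ∀ (v : Fin n → ℂ) (y : cliffordL n), y ∈ S →
      CliffordAlgebra.ι (cliffordForm n) v * y ∈ S := by
    intro v y hy
    have hv : CliffordAlgebra.ι (cliffordForm n) v = ∑ i, v i • cliffordE i := by
      conv_lhs => rw [pi_eq_sum_univ' v]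
      simp only [cliffordE, map_sum, map_smul]
    induction hy using Submodule.span_induction with
    | mem y hy =>
      obtain ⟨u, rfl⟩ := hy
      rw [hv, Finset.sum_mul]
      refine S.sum_mem fun i _ => ?_
      rw [smul_mul_assoc, ← cliffordMonomial_gen, ← cliffordMonomial_mul]
      exact S.smul_mem _ (hm _)
    | zero => rw [mul_zero]; exact S.zero_mem
    | add y y' _ _ h h' => rw [mul_add]; exact S.add_mem h h'
    | smul c y _ h => rw [mul_smul_comm]; exact S.smul_mem _ h
  intro x _
  have key : ∀ y ∈ S, x * y ∈ S := by
    induction x using CliffordAlgebra.induction with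
    | algebraMap r => intro y hy; rw [← Algebra.smul_def]; exact S.smul_mem _ hy
    | ι v => exact hι v
    | mul a b ha hb => intro y hy; rw [mul_assoc]; exact ha trivial _ (hb trivial y hy)
    | add a b ha hb =>
      intro y hy; rw [add_mul]; exact S.add_mem (ha trivial y hy) (hb trivial y hy)
  have := key 1 (by rw [← cliffordMonomial_one]; exact hm 1)
  rwa [mul_one] at this

/-- The basis of the Clifford algebra consisting of the ordered monomials. -/
noncomputable def monomialBasis (n : ℕ) : Module.Basis (Fin n → ZMod 2) ℂ (cliffordL n) :=
  Module.Basis.mk linearIndependent_monomial span_monomial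

theorem cliffordAction_monomial (a b : PiGroup n) (s : Equiv.Perm (Fin n)) :
    cliffordAction a s (cliffordMonomial b) = cliffordMonomial (a * PiGroup.permuteHom s b) := by
  rw [cliffordMonomial_mul, ← permL_monomial]
  rfl

/-- The pair (a, s) permutes the monomial basis up to sign; the trace collects the signs of the
fixed basis lines. -/
theorem basicChar_eq_sum (a : PiGroup n) (s : Equiv.Perm (Fin n)) :
    basicChar a s = ∑ u : Fin n → ZMod 2,
      if (a * PiGroup.permuteHom s ⟨0, u⟩).supp = u then
        sgn (a * PiGroup.permuteHom s ⟨0, u⟩).zexp else 0 := by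
  rw [basicChar, LinearMap.trace_eq_matrix_trace ℂ (monomialBasis n), Matrix.trace]
  refine Finset.sum_congr rfl fun u _ => ?_
  rw [Matrix.diag_apply, LinearMap.toMatrix_apply]
  have h1 : monomialBasis n u = cliffordMonomial ⟨0, u⟩ := by simp [monomialBasis]
  rw [h1, cliffordAction_monomial]
  set b := a * PiGroup.permuteHom s ⟨0, u⟩
  have h2 : cliffordMonomial b = sgn b.zexp • monomialBasis n b.supp := by
    have := cliffordMonomial_zmul b.zexp b.supp
    simpa [monomialBasis] using this
  rw [h2, map_smul, Module.Basis.repr_self, Finsupp.smul_apply, Finsupp.single_apply]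
  simp

instance : Fintype (PiGroup n) := Fintype.ofEquiv (ZMod 2 × (Fin n → ZMod 2))
  { toFun := fun x => ⟨x.1, x.2⟩
    invFun := fun a => (a.zexp, a.supp)
    left_inv := fun _ => rfl
    right_inv := fun _ => rfl }

theorem sum_piGroup {M : Type*} [AddCommMonoid M] (f : PiGroup n → M) :
    ∑ a, f a = ∑ u : Fin n → ZMod 2, (f ⟨0, u⟩ + f ⟨1, u⟩) := by
  let e : (ZMod 2 × (Fin n → ZMod 2)) ≃ PiGroup n :=
    { toFun := fun x => ⟨x.1, x.2⟩
      invFun := fun a => (a.zexp, a.supp)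
      left_inv := fun _ => rfl
      right_inv := fun _ => rfl }
  rw [← Equiv.sum_comp e, Fintype.sum_prod_type, Finset.sum_add_distrib]
  exact Fin.sum_univ_two fun k : Fin 2 => ∑ u : Fin n → ZMod 2, f ⟨k, u⟩

/-- The basic spin character integrates a twisted class function to its value at the identity. -/
theorem sum_basicChar_mul (s : Equiv.Perm (Fin n)) (F : PiGroup n → ℂ)
    (hz : ∀ k u, F ⟨k, u⟩ = sgn k * F ⟨0, u⟩)
    (hF : ∀ a b, F (b * a * (PiGroup.permuteHom s b)⁻¹) = F a) :
    ∑ a, basicChar a s * F a = 2 ^ (n + 1) * F 1 := by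
  simp only [basicChar_eq_sum, Finset.sum_mul]
  rw [Finset.sum_comm]
  -- For fixed u, the elements a that preserve the line of e^u are z^k e^u s(e^u)⁻¹. On them the
  -- sign (-1)^k occurs once in the trace and once in F, so k = 0 and k = 1 each contribute F(1).
  have h : ∀ u : Fin n → ZMod 2, ∑ a : PiGroup n,
      (if (a * PiGroup.permuteHom s ⟨0, u⟩).supp = u then
        sgn (a * PiGroup.permuteHom s ⟨0, u⟩).zexp else 0) * F a = 2 * F 1 := by
    intro u
    have h1 := Equiv.sum_comp (Equiv.mulRight (PiGroup.permuteHom s ⟨0, u⟩)⁻¹) fun a : PiGroup n =>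
      (if (a * PiGroup.permuteHom s ⟨0, u⟩).supp = u then
        sgn (a * PiGroup.permuteHom s ⟨0, u⟩).zexp else 0) * F a
    rw [← h1]
    simp only [Equiv.coe_mulRight, inv_mul_cancel_right]
    rw [sum_piGroup, Finset.sum_eq_single u]
    -- Invariance under twisted conjugation, applied to the identity and e^u, gives F(e^u s(e^u)⁻¹)
    -- = F(1).
    · have e : ∀ k : ZMod 2, F (⟨k, u⟩ * (PiGroup.permuteHom s ⟨0, u⟩)⁻¹) = sgn k * F 1 := by
        intro k
        have h2 := hF 1 ⟨0, u⟩
        rw [mul_one] at h2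
        rw [← h2]
        set c := (PiGroup.permuteHom s ⟨0, u⟩)⁻¹
        have h3 := hz (⟨k, u⟩ * c).zexp (⟨k, u⟩ * c).supp
        have h4 := hz (⟨0, u⟩ * c).zexp (⟨0, u⟩ * c).supp
        refine h3.trans ?_
        refine Eq.trans ?_ (congrArg (sgn k * ·) h4.symm)
        simp only [PiGroup.mul_zexp, PiGroup.mul_supp, sgn_add, sgn_zero]
        ring
      simp [e]
      ring
    · intro v _ hv
      simp [hv]
    · simp
  rw [Finset.sum_congr rfl fun u _ => h u]
  simp [pow_succ]
  ring

/-- Cyclicity of the trace: left multiplication by the monomial of b, carried to the right of the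
operator of (a, s), becomes multiplication of a by s(b). -/
theorem basicChar_conj (a b : PiGroup n) (s : Equiv.Perm (Fin n)) :
    basicChar (b * a * (PiGroup.permuteHom s b)⁻¹) s = basicChar a s := by
  have h : ∀ a b : PiGroup n, LinearMap.mulLeft ℂ (cliffordMonomial b) * cliffordAction a s =
      cliffordAction (b * a) s := fun a b => by
    refine LinearMap.ext fun v => ?_
    simp [cliffordAction, cliffordMonomial_mul]
  have h' : ∀ a b : PiGroup n, cliffordAction a s * LinearMap.mulLeft ℂ (cliffordMonomial b) =
      cliffordAction (a * PiGroup.permuteHom s b) s := fun a b => by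
    refine LinearMap.ext fun v => ?_
    simp [cliffordAction, cliffordMonomial_mul, permL_monomial]
  rw [basicChar, mul_assoc, ← h, LinearMap.trace_mul_comm, h', inv_mul_cancel_right]
  rfl

end BasicCharacter

/-! ### Types of elements of the wreath product -/

section Types

variable {Γ : Type*} [Group Γ]

/-- The conjugacy class of the cycle product of `(g, s)` read off backwards from the point `p`. -/
noncomputable def pointClass {α : Type*} (g : α → Γ) (s : Equiv.Perm α) (p : α) : ConjClasses Γ :=
  ConjClasses.mk (((List.range (Function.minimalPeriod s p)).map fun k => g ((s ^ k)⁻¹ p)).prod)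

theorem minimalPeriod_perm_apply {α : Type*} [Finite α] (s : Equiv.Perm α) (p : α) :
    Function.minimalPeriod s (s p) = Function.minimalPeriod s p :=
  Function.minimalPeriod_apply (s.injective.mem_periodicPts p)

theorem minimalPeriod_perm_pos {α : Type*} [Finite α] (s : Equiv.Perm α) (p : α) :
    0 < Function.minimalPeriod s p :=
  Function.minimalPeriod_pos_of_mem_periodicPts (s.injective.mem_periodicPts p)

theorem pow_minimalPeriod_apply {α : Type*} (s : Equiv.Perm α) (p : α) :
    (s ^ Function.minimalPeriod s p) p = p := by
  rw [← Equiv.Perm.iterate_eq_pow]; exact Function.iterate_minimalPeriod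

/-- Moving the base point one step along the cycle rotates the word cyclically, which conjugates the
product by one letter. -/
theorem pointClass_apply {α : Type*} [Finite α] (g : α → Γ) (s : Equiv.Perm α) (p : α) :
    pointClass g s (s p) = pointClass g s p := by
  unfold pointClass
  rw [minimalPeriod_perm_apply]
  obtain ⟨m, hm⟩ : ∃ m, Function.minimalPeriod s p = m + 1 :=
    ⟨_, (Nat.succ_pred_eq_of_pos (minimalPeriod_perm_pos s p)).symm⟩
  have h1 := pow_minimalPeriod_apply s p
  rw [hm]
  conv_lhs => rw [List.range_succ_eq_map, List.map_cons, List.prod_cons, List.map_map]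
  conv_rhs => rw [List.range_succ, List.map_append, List.prod_append]
  have h2 : ((fun k => g ((s ^ k)⁻¹ (s p))) ∘ Nat.succ) = fun k => g ((s ^ k)⁻¹ p) := by
    funext k
    simp only [Function.comp_apply, Nat.succ_eq_add_one]
    congr 1
    rw [Equiv.Perm.inv_eq_iff_eq, pow_succ', Equiv.Perm.mul_apply]
    congr 1
    exact ((s ^ k).apply_symm_apply p).symm
  have h3 : (s ^ m)⁻¹ p = s p := by
    rw [Equiv.Perm.inv_eq_iff_eq, ← Equiv.Perm.mul_apply, ← pow_succ, ← hm, h1]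
  rw [h2]
  simp only [List.map_cons, List.map_nil, List.prod_singleton, h3, pow_zero, inv_one,
    Equiv.Perm.one_apply]
  rw [ConjClasses.mk_eq_mk_iff_isConj, isConj_iff]
  exact ⟨(g (s p))⁻¹, by group⟩

theorem pointClass_pow_apply {α : Type*} [Finite α] (g : α → Γ) (s : Equiv.Perm α) (k : ℕ) (p : α) :
    pointClass g s ((s ^ k) p) = pointClass g s p := by
  induction k with
  | zero => rfl
  | succ k ih => rw [pow_succ', Equiv.Perm.mul_apply, pointClass_apply, ih]

theorem minimalPeriod_pow_apply {α : Type*} [Finite α] (s : Equiv.Perm α) (k : ℕ) (p : α) :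
    Function.minimalPeriod s ((s ^ k) p) = Function.minimalPeriod s p := by
  induction k with
  | zero => rfl
  | succ k ih => rw [pow_succ', Equiv.Perm.mul_apply, minimalPeriod_perm_apply, ih]

theorem sameCycle_out {n : ℕ} {s : Equiv.Perm (Fin n)} {q : Cycles s} {p : Fin n}
    (h : (Quotient.mk _ p : Cycles s) = q) : ∃ k : ℕ, (s ^ k) q.out = p := by
  have h1 : s.SameCycle q.out p := Quotient.exact ((Quotient.out_eq q).trans h.symm)
  obtain ⟨k, -, hk⟩ := h1.exists_pow_eq'
  exact ⟨k, hk⟩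

theorem cycleLen_eq {n : ℕ} {s : Equiv.Perm (Fin n)} {q : Cycles s} {p : Fin n}
    (h : (Quotient.mk _ p : Cycles s) = q) : cycleLen q = Function.minimalPeriod s p := by
  obtain ⟨k, rfl⟩ := sameCycle_out h
  rw [minimalPeriod_pow_apply]; rfl

theorem cycleClass_eq {n : ℕ} (g : Fin n → Γ) {s : Equiv.Perm (Fin n)} {q : Cycles s} {p : Fin n}
    (h : (Quotient.mk _ p : Cycles s) = q) : cycleClass g q = pointClass g s p := by
  obtain ⟨k, rfl⟩ := sameCycle_out h
  rw [pointClass_pow_apply]; rfl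

/-- The number of points lying on cycles of length `i` and class `c`. -/
noncomputable def pointCount {α : Type*} [Fintype α] (g : α → Γ) (s : Equiv.Perm α) (i : ℕ)
    (c : ConjClasses Γ) : ℕ :=
  ∑ p, if Function.minimalPeriod s p = i ∧ pointClass g s p = c then 1 else 0

theorem card_cycle {n : ℕ} {s : Equiv.Perm (Fin n)} (q : Cycles s) :
    (Finset.univ.filter fun p : Fin n => (Quotient.mk _ p : Cycles s) = q).card = cycleLen q := by
  have := Fintype.card_congr (Equiv.ofBijective _ (cycle_bijective q))
  rw [Fintype.card_fin, Fintype.card_subtype] at this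
  rw [this]

/-- Each cycle of length i contains i points. Counting points instead of cycles avoids the quotient
of the index set that depends on s, so types can be compared along equivariant bijections. -/
theorem mul_count_wreathType {n : ℕ} (g : Fin n → Γ) (s : Equiv.Perm (Fin n)) (i : ℕ)
    (c : ConjClasses Γ) : i * (wreathType g s c).count i = pointCount g s i c := by
  have h1 : (wreathType g s c).count i =
      ∑ q : Cycles s, if cycleLen q = i ∧ cycleClass g q = c then 1 else 0 := by
    rw [wreathType, Multiset.count_map, ← Finset.filter_val, Finset.card_val, Finset.filter_filter,
      Finset.card_filter]
    refine Finset.sum_congr rfl fun q _ => ?_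
    simp only [and_comm, eq_comm]
  rw [h1, Finset.mul_sum, pointCount,
    ← Finset.sum_fiberwise (s := Finset.univ) (g := fun p => (Quotient.mk _ p : Cycles s))]
  refine Finset.sum_congr rfl fun q _ => ?_
  have h2 : ∀ p ∈ Finset.univ.filter (fun p : Fin n => (Quotient.mk _ p : Cycles s) = q),
      (if Function.minimalPeriod s p = i ∧ pointClass g s p = c then 1 else 0) =
      if cycleLen q = i ∧ cycleClass g q = c then 1 else 0 := by
    intro p hp
    have hp' := (Finset.mem_filter.1 hp).2
    rw [cycleLen_eq hp', cycleClass_eq g hp']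
  rw [Finset.sum_congr rfl h2, Finset.sum_const, card_cycle, smul_eq_mul]
  split_ifs with h
  · rw [h.1]
  · simp

theorem count_zero_wreathType {n : ℕ} (g : Fin n → Γ) (s : Equiv.Perm (Fin n))
    (c : ConjClasses Γ) : (wreathType g s c).count 0 = 0 := by
  rw [Multiset.count_eq_zero, wreathType]
  intro h
  obtain ⟨q, -, hq⟩ := Multiset.mem_map.1 h
  exact (cycleLen_pos q).ne' hq

/-- A function on `Γ_*` is the type of `(g, s)` once its multiplicities are right. -/
theorem wreathType_eq_of_count {n : ℕ} {g : Fin n → Γ} {s : Equiv.Perm (Fin n)}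
    {ρ : ConjClasses Γ → Multiset ℕ} (h0 : ∀ c, (ρ c).count 0 = 0)
    (h : ∀ c i, pointCount g s i c = i * (ρ c).count i) : wreathType g s = ρ := by
  funext c
  refine Multiset.ext.2 fun i => ?_
  rcases Nat.eq_zero_or_pos i with rfl | hi
  · rw [h0, count_zero_wreathType]
  · exact Nat.eq_of_mul_eq_mul_left hi ((mul_count_wreathType g s i c).trans (h c i))

section Local

variable {α β : Type*} {j : α → β} {s : Equiv.Perm α} {t : Equiv.Perm β}

theorem semiconj_pow (h : ∀ a, t (j a) = j (s a)) (k : ℕ) (a : α) :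
    (t ^ k) (j a) = j ((s ^ k) a) := by
  induction k with
  | zero => rfl
  | succ k ih => rw [pow_succ', pow_succ', Equiv.Perm.mul_apply, ih, h]; rfl

theorem semiconj_pow_inv (h : ∀ a, t (j a) = j (s a)) (k : ℕ) (a : α) :
    (t ^ k)⁻¹ (j a) = j ((s ^ k)⁻¹ a) := by
  rw [Equiv.Perm.inv_eq_iff_eq, semiconj_pow h]
  congr 1
  exact ((s ^ k).apply_symm_apply a).symm

theorem minimalPeriod_semiconj (hj : Function.Injective j) (h : ∀ a, t (j a) = j (s a)) (a : α) :
    Function.minimalPeriod t (j a) = Function.minimalPeriod s a := by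
  refine Function.minimalPeriod_eq_minimalPeriod_iff.2 fun k => ?_
  rw [Function.IsPeriodicPt, Function.IsPeriodicPt, Function.IsFixedPt, Function.IsFixedPt,
    Equiv.Perm.iterate_eq_pow, Equiv.Perm.iterate_eq_pow, semiconj_pow h, hj.eq_iff]

theorem pointClass_semiconj (hj : Function.Injective j) (h : ∀ a, t (j a) = j (s a)) (g : β → Γ)
    (a : α) : pointClass g t (j a) = pointClass (g ∘ j) s a := by
  unfold pointClass
  rw [minimalPeriod_semiconj hj h]
  simp only [semiconj_pow_inv h, Function.comp_apply]

end Local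

/-- The type is additive over invariant decompositions of `{1, …, n}`. -/
theorem wreathType_add {n i k : ℕ} {g : Fin n → Γ} {s : Equiv.Perm (Fin n)}
    {σ : Equiv.Perm (Fin i)} {τ : Equiv.Perm (Fin k)} (E : Fin i ⊕ Fin k ≃ Fin n)
    (h1 : ∀ a, s (E (Sum.inl a)) = E (Sum.inl (σ a)))
    (h2 : ∀ a, s (E (Sum.inr a)) = E (Sum.inr (τ a))) :
    wreathType g s = wreathType (fun a => g (E (Sum.inl a))) σ +
      wreathType (fun a => g (E (Sum.inr a))) τ := by
  refine wreathType_eq_of_count (fun c => ?_) fun c l => ?_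
  · rw [Pi.add_apply, Multiset.count_add, count_zero_wreathType, count_zero_wreathType]
  · rw [Pi.add_apply, Multiset.count_add, mul_add, mul_count_wreathType, mul_count_wreathType,
      pointCount, ← Equiv.sum_comp E, Fintype.sum_sum_type]
    have i1 : Function.Injective fun a => E (Sum.inl a) := E.injective.comp Sum.inl_injective
    have i2 : Function.Injective fun a => E (Sum.inr a) := E.injective.comp Sum.inr_injective
    congr 1
    · refine Finset.sum_congr rfl fun a _ => ?_
      rw [minimalPeriod_semiconj (j := fun a => E (Sum.inl a)) i1 h1,
        pointClass_semiconj (j := fun a => E (Sum.inl a)) i1 h1]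
      rfl
    · refine Finset.sum_congr rfl fun a _ => ?_
      rw [minimalPeriod_semiconj (j := fun a => E (Sum.inr a)) i2 h2,
        pointClass_semiconj (j := fun a => E (Sum.inr a)) i2 h2]
      rfl

/-- The type with a single cycle, of class `c` and length `i`. -/
noncomputable def oneCycle (c : ConjClasses Γ) (i : ℕ) : ConjClasses Γ → Multiset ℕ :=
  fun d => if d = c then {i} else 0

theorem finRotate_pow_apply {i : ℕ} (k : ℕ) (hk : k < i + 1) :
    ((finRotate (i + 1)) ^ k) 0 = ⟨k, hk⟩ := by
  induction k with
  | zero => rfl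
  | succ k ih =>
    rw [pow_succ', Equiv.Perm.mul_apply, ih (by omega)]
    exact finRotate_of_lt (by omega)

theorem minimalPeriod_finRotate {i : ℕ} (a : Fin (i + 1)) :
    Function.minimalPeriod (finRotate (i + 1)) a = i + 1 := by
  have h0 : Function.minimalPeriod (finRotate (i + 1)) 0 = i + 1 := by
    refine le_antisymm ?_ ?_
    · refine Function.IsPeriodicPt.minimalPeriod_le (Nat.succ_pos i) ?_
      rw [Function.IsPeriodicPt, Function.IsFixedPt, Equiv.Perm.iterate_eq_pow, pow_succ',
        Equiv.Perm.mul_apply, finRotate_pow_apply i (by omega)]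
      exact finRotate_last'
    · by_contra hlt
      have h1 := pow_minimalPeriod_apply (finRotate (i + 1)) 0
      rw [finRotate_pow_apply _ (by omega)] at h1
      have := congrArg Fin.val h1
      exact (minimalPeriod_perm_pos (finRotate (i + 1)) 0).ne' this
  obtain ⟨a, ha⟩ := a
  rw [← finRotate_pow_apply a ha, minimalPeriod_pow_apply, h0]

theorem pointClass_finRotate {i : ℕ} (g : Fin (i + 1) → Γ) (a : Fin (i + 1)) :
    pointClass g (finRotate (i + 1)) a = pointClass g (finRotate (i + 1)) 0 := by
  obtain ⟨a, ha⟩ := a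
  rw [← finRotate_pow_apply a ha, pointClass_pow_apply]

theorem wreathType_finRotate {i : ℕ} (g : Fin (i + 1) → Γ) :
    wreathType g (finRotate (i + 1)) =
      oneCycle (pointClass g (finRotate (i + 1)) 0) (i + 1) := by
  refine wreathType_eq_of_count (fun c => ?_) fun c l => ?_
  · by_cases hc : c = pointClass g (finRotate (i + 1)) 0 <;> simp [oneCycle, hc]
  · simp only [pointCount, minimalPeriod_finRotate, pointClass_finRotate g]
    by_cases hc : c = pointClass g (finRotate (i + 1)) 0
    · by_cases hl : l = i + 1
      · simp [oneCycle, hc, hl]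
      · simp [oneCycle, hc, hl, Ne.symm hl]
    · simp [oneCycle, hc, Ne.symm hc]

end Types

/-! ### Splitting off the cycle of a marked point. -/

section Recursion

variable {Γ : Type*} [Group Γ]

theorem exists_sum_equiv {n l k : ℕ} (h : l + k = n) (e : Fin l ↪ Fin n) :
    ∃ E : Fin l ⊕ Fin k ≃ Fin n, ∀ a, E (Sum.inl a) = e a := by
  have hc : Fintype.card (Fin k) = Fintype.card {x // ¬ x ∈ Set.range e} := by
    rw [Fintype.card_subtype_compl, Fintype.card_fin, Fintype.card_fin,
      ← Fintype.card_congr (Equiv.ofInjective e e.injective), Fintype.card_fin]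
    omega
  refine ⟨(Equiv.sumCongr (Equiv.ofInjective e e.injective) (Fintype.equivOfCardEq hc)).trans
    (Equiv.sumCompl (· ∈ Set.range e)), fun a => ?_⟩
  simp

theorem exists_perm_complement {n l k : ℕ} (E : Fin l ⊕ Fin k ≃ Fin n) {s : Equiv.Perm (Fin n)}
    {σ : Equiv.Perm (Fin l)} (h : ∀ a, s (E (Sum.inl a)) = E (Sum.inl (σ a))) :
    ∃ τ : Equiv.Perm (Fin k), s = E.permCongr (Equiv.sumCongr σ τ) := by
  have hm : Set.MapsTo (E.symm.permCongr s) (Set.range Sum.inl) (Set.range Sum.inl) := by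
    rintro _ ⟨a, rfl⟩
    exact ⟨σ a, by simp [h]⟩
  obtain ⟨⟨σ', τ⟩, hτ⟩ := Equiv.Perm.mem_sumCongrHom_range_of_perm_mapsTo_inl hm
  have hσ : σ' = σ := by
    refine Equiv.ext fun a => ?_
    have := DFunLike.congr_fun hτ (Sum.inl a)
    simpa [h] using this
  refine ⟨τ, ?_⟩
  rw [← hσ]
  refine Equiv.ext fun x => ?_
  have := DFunLike.congr_fun hτ (E.symm x)
  simp only [Equiv.Perm.sumCongrHom_apply, Equiv.permCongr_apply, Equiv.symm_symm,
    Equiv.apply_symm_apply] at this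
  simp only [Equiv.permCongr_apply]
  exact (E.symm_apply_eq.1 this.symm)

theorem exists_cycle_embedding {n i : ℕ} {s : Equiv.Perm (Fin n)} {p : Fin n}
    (h : Function.minimalPeriod s p = i + 1) :
    ∃ e : Fin (i + 1) ↪ Fin n, e 0 = p ∧ ∀ a, s (e a) = e (finRotate (i + 1) a) := by
  refine ⟨⟨fun a => (s ^ (a : ℕ)) p, fun a b hab => ?_⟩, rfl, fun a => ?_⟩
  · refine Fin.ext (Function.iterate_injOn_Iio_minimalPeriod (f := s) (x := p) ?_ ?_ ?_)
    · rw [h]; exact a.2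
    · rw [h]; exact b.2
    · simpa only [Equiv.Perm.iterate_eq_pow] using hab
  · show s ((s ^ (a : ℕ)) p) = (s ^ (finRotate (i + 1) a : ℕ)) p
    by_cases ha : a = Fin.last i
    · subst ha
      rw [finRotate_last, ← Equiv.Perm.mul_apply, ← pow_succ']
      have := pow_minimalPeriod_apply s p
      rw [h] at this
      exact this
    · rw [coe_finRotate_of_ne_last ha, pow_succ', Equiv.Perm.mul_apply]

/-- A point determines a decomposition of the permutation into its cycle and the rest. -/
theorem exists_cycle_split {n : ℕ} (s : Equiv.Perm (Fin n)) (p : Fin n) {i : ℕ}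
    (h : Function.minimalPeriod s p = i + 1) :
    ∃ (k : ℕ) (E : Fin (i + 1) ⊕ Fin k ≃ Fin n) (τ : Equiv.Perm (Fin k)),
      i + 1 + k = n ∧ E (Sum.inl 0) = p ∧
      (∀ a, s (E (Sum.inl a)) = E (Sum.inl (finRotate (i + 1) a))) ∧
      ∀ a, s (E (Sum.inr a)) = E (Sum.inr (τ a)) := by
  obtain ⟨e, he, hs⟩ := exists_cycle_embedding h
  have hle : i + 1 ≤ n := by simpa using Fintype.card_le_of_embedding e
  obtain ⟨E, hE⟩ := exists_sum_equiv (Nat.add_sub_of_le hle) e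
  have hs' : ∀ a, s (E (Sum.inl a)) = E (Sum.inl (finRotate (i + 1) a)) := fun a => by
    rw [hE, hE, hs]
  obtain ⟨τ, hτ⟩ := exists_perm_complement E hs'
  refine ⟨_, E, τ, Nat.add_sub_of_le hle, (hE 0).trans he, hs', fun a => ?_⟩
  rw [hτ]
  simp

/-- An equivariant embedding of the standard cycle is determined by the image of 0, which can be any
point of the right period. Points are thus replaced by embeddings, whose total number is a falling
factorial. -/
theorem card_period_eq {n : ℕ} (s : Equiv.Perm (Fin n)) (i : ℕ) :
    (Finset.univ.filter fun p : Fin n => Function.minimalPeriod s p = i + 1).card =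
      (Finset.univ.filter fun e : Fin (i + 1) ↪ Fin n =>
        ∀ a, s (e a) = e (finRotate (i + 1) a)).card := by
  symm
  refine Finset.card_nbij (fun e => e 0) (fun e he => ?_) (fun e he e' he' h => ?_)
    (fun p hp => ?_)
  · simp only [Finset.mem_coe, Finset.mem_filter, Finset.mem_univ, true_and] at he ⊢
    rw [minimalPeriod_semiconj e.injective he, minimalPeriod_finRotate]
  · simp only [Finset.coe_filter, Finset.mem_univ, true_and, Set.mem_ofPred_eq] at he he'
    refine DFunLike.ext _ _ fun a => ?_
    obtain ⟨a, ha⟩ := a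
    rw [← finRotate_pow_apply a ha, ← semiconj_pow he, ← semiconj_pow he']
    exact congrArg _ h
  · obtain ⟨e, h0, he⟩ := exists_cycle_embedding (by simpa using hp)
    exact ⟨e, by simpa using he, h0⟩

theorem sum_perm_filter {M : Type*} [AddCommMonoid M] {n l k : ℕ} (E : Fin l ⊕ Fin k ≃ Fin n)
    (σ : Equiv.Perm (Fin l)) (G : Equiv.Perm (Fin n) → M) :
    ∑ s ∈ Finset.univ.filter (fun s : Equiv.Perm (Fin n) =>
      ∀ a, s (E (Sum.inl a)) = E (Sum.inl (σ a))), G s =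
    ∑ τ : Equiv.Perm (Fin k), G (E.permCongr (Equiv.sumCongr σ τ)) := by
  symm
  refine Finset.sum_nbij (fun τ => E.permCongr (Equiv.sumCongr σ τ)) (fun τ _ => ?_)
    (fun τ _ τ' _ h => ?_) (fun s hs => ?_) (fun _ _ => rfl)
  · simp
  · refine Equiv.ext fun a => ?_
    have := DFunLike.congr_fun (E.permCongr.injective h) (Sum.inr a)
    simpa using this
  · obtain ⟨τ, hτ⟩ := exists_perm_complement E (by simpa using hs)
    exact ⟨τ, by simp, hτ.symm⟩

/-- Pairs (s, p) of a permutation and a point are counted twice: each s has n + 1 points, and the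
cycle of p is an embedded standard cycle of some length i + 1. There are (n+1)_{i+1} embeddings,
each leaving a sum over the permutations of the remaining j points. -/
theorem sum_perm_smul {M : Type*} [AddCommMonoid M] {n : ℕ}
    (G : Equiv.Perm (Fin (n + 1)) → M) (K : ℕ → ℕ → M)
    (hK : ∀ i j, i + j = n → ∀ E : Fin (i + 1) ⊕ Fin j ≃ Fin (n + 1),
      ∑ τ : Equiv.Perm (Fin j), G (E.permCongr (Equiv.sumCongr (finRotate (i + 1)) τ)) = K i j) :
    (n + 1) • ∑ s, G s =
      ∑ x ∈ Finset.HasAntidiagonal.antidiagonal n, (n + 1).descFactorial (x.1 + 1) • K x.1 x.2 := by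
  have h1 : ∀ x ∈ Finset.HasAntidiagonal.antidiagonal n, (n + 1).descFactorial (x.1 + 1) • K x.1 x.2 =
      ∑ s : Equiv.Perm (Fin (n + 1)), (Finset.univ.filter fun p : Fin (n + 1) => Function.minimalPeriod s p = x.1 + 1).card • G s := by
    intro x hx
    have hx' := Finset.HasAntidiagonal.mem_antidiagonal.1 hx
    rw [Finset.sum_congr rfl fun s _ => congrArg (· • G s) (card_period_eq s x.1)]
    simp only [Finset.card_filter, Finset.sum_smul]
    rw [Finset.sum_comm]
    have : ∀ e : Fin (x.1 + 1) ↪ Fin (n + 1),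
        ∑ s, (if ∀ a, s (e a) = e (finRotate (x.1 + 1) a) then 1 else 0) • G s = K x.1 x.2 := by
      intro e
      obtain ⟨E, hE⟩ := exists_sum_equiv (k := x.2) (by omega) e
      rw [← hK _ _ hx' E, ← sum_perm_filter E (finRotate (x.1 + 1)) G, Finset.sum_filter]
      refine Finset.sum_congr rfl fun s _ => ?_
      simp only [hE]
      split_ifs <;> simp
    rw [Finset.sum_congr rfl fun e _ => this e, Finset.sum_const, Finset.card_univ,
      Fintype.card_embedding_eq, Fintype.card_fin, Fintype.card_fin]
  rw [Finset.sum_congr rfl h1, Finset.sum_comm, Finset.smul_sum]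
  refine Finset.sum_congr rfl fun s _ => ?_
  rw [← Finset.sum_smul]
  congr 1
  -- The n + 1 points are distributed over the antidiagonal according to their period minus one.
  have h2 := Finset.card_eq_sum_card_fiberwise (s := (Finset.univ : Finset (Fin (n + 1))))
    (t := Finset.HasAntidiagonal.antidiagonal n)
    (f := fun p => (Function.minimalPeriod s p - 1, n - (Function.minimalPeriod s p - 1)))
    (fun p _ => by
      rw [Finset.mem_coe, Finset.HasAntidiagonal.mem_antidiagonal]
      have := minimalPeriod_perm_pos s p
      have h3 : Function.minimalPeriod s p ≤ n + 1 := by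
        obtain ⟨i, hi⟩ : ∃ i, Function.minimalPeriod s p = i + 1 := ⟨_, (Nat.sub_add_cancel this).symm⟩
        obtain ⟨e, -, -⟩ := exists_cycle_embedding hi
        rw [hi]
        simpa using Fintype.card_le_of_embedding e
      show Function.minimalPeriod s p - 1 + (n - (Function.minimalPeriod s p - 1)) = n
      omega)
  rw [Finset.card_univ, Fintype.card_fin] at h2
  refine h2.trans (Finset.sum_congr rfl fun x hx => ?_)
  congr 1
  ext p
  have := minimalPeriod_perm_pos s p
  have hx' := Finset.HasAntidiagonal.mem_antidiagonal.1 hx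
  simp only [Finset.mem_filter, Finset.mem_univ, true_and, Prod.ext_iff]
  omega

theorem wreathType_split {n i j : ℕ} {g : Fin n → Γ} {s : Equiv.Perm (Fin n)}
    {τ : Equiv.Perm (Fin j)} (E : Fin (i + 1) ⊕ Fin j ≃ Fin n)
    (h1 : ∀ a, s (E (Sum.inl a)) = E (Sum.inl (finRotate (i + 1) a)))
    (h2 : ∀ a, s (E (Sum.inr a)) = E (Sum.inr (τ a))) :
    wreathType g s =
      oneCycle (pointClass (fun a => g (E (Sum.inl a))) (finRotate (i + 1)) 0) (i + 1) +
        wreathType (fun a => g (E (Sum.inr a))) τ := by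
  rw [← wreathType_finRotate]
  exact wreathType_add E h1 h2

theorem wreathType_permCongr {n i j : ℕ} (E : Fin (i + 1) ⊕ Fin j ≃ Fin n)
    (τ : Equiv.Perm (Fin j)) (g : Fin n → Γ) :
    wreathType g (E.permCongr (Equiv.sumCongr (finRotate (i + 1)) τ)) =
      oneCycle (pointClass (fun a => g (E (Sum.inl a))) (finRotate (i + 1)) 0) (i + 1) +
        wreathType (fun a => g (E (Sum.inr a))) τ :=
  wreathType_split E (fun a => by simp) (fun a => by simp)

variable [Fintype Γ]

/-- With the last i entries fixed, the first entry makes the product run once through Γ. -/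
theorem sum_prod_ofFn {M : Type*} [AddCommMonoid M] (i : ℕ) (H : Γ → M) :
    ∑ g : Fin (i + 1) → Γ, H (List.ofFn g).prod = Fintype.card Γ ^ i • ∑ x, H x := by
  rw [← (Fin.consEquiv fun _ : Fin (i + 1) => Γ).sum_comp, Fintype.sum_prod_type, Finset.sum_comm]
  have : ∀ h : Fin i → Γ, ∑ x : Γ, H (List.ofFn (Fin.consEquiv (fun _ => Γ) (x, h))).prod =
      ∑ x, H x := by
    intro h
    rw [← Equiv.sum_comp (Equiv.mulRight (List.ofFn h).prod) H]
    refine Finset.sum_congr rfl fun x _ => ?_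
    simp [Fin.consEquiv]
  rw [Finset.sum_congr rfl fun h _ => this h, Finset.sum_const]
  simp

/-- The cycle product multiplies all entries, in the order `π` in which the rotation visits the
indices backwards; relabelling them reduces to an ordinary ordered product. -/
theorem sum_pointClass_finRotate {M : Type*} [AddCommMonoid M] (i : ℕ) (H : ConjClasses Γ → M) :
    ∑ g : Fin (i + 1) → Γ, H (pointClass g (finRotate (i + 1)) 0) =
      Fintype.card Γ ^ i • ∑ x : Γ, H (ConjClasses.mk x) := by
  let π : Fin (i + 1) → Fin (i + 1) := fun k => ((finRotate (i + 1)) ^ (k : ℕ))⁻¹ 0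
  have hπ : Function.Injective π := by
    intro a b hab
    have h1 : ((finRotate (i + 1)) ^ (a : ℕ)) (π a) = 0 :=
      ((finRotate (i + 1)) ^ (a : ℕ)).apply_symm_apply 0
    have h2 : ((finRotate (i + 1)) ^ (b : ℕ)) (π b) = 0 :=
      ((finRotate (i + 1)) ^ (b : ℕ)).apply_symm_apply 0
    rw [← hab, ← h1] at h2
    refine Fin.ext (Function.iterate_injOn_Iio_minimalPeriod (f := finRotate (i + 1)) (x := π a)
      ?_ ?_ ?_)
    · rw [minimalPeriod_finRotate]; exact a.2
    · rw [minimalPeriod_finRotate]; exact b.2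
    · simpa only [Equiv.Perm.iterate_eq_pow] using h2.symm
  let e : Fin (i + 1) ≃ Fin (i + 1) := Equiv.ofBijective π (Finite.injective_iff_bijective.1 hπ)
  rw [← sum_prod_ofFn i fun x => H (ConjClasses.mk x),
    ← Equiv.sum_comp (e.symm.arrowCongr (Equiv.refl Γ)) fun h : Fin (i + 1) → Γ =>
      H (ConjClasses.mk (List.ofFn h).prod)]
  refine Finset.sum_congr rfl fun g _ => ?_
  rw [pointClass, minimalPeriod_finRotate, List.ofFn_eq_map, ← List.map_coe_finRange_eq_range,
    List.map_map]
  rfl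

theorem zeta_ne_zero (c : ConjClasses Γ) : zeta c ≠ 0 := by
  unfold zeta
  have h : Nonempty c.carrier := by
    obtain ⟨x, rfl⟩ := ConjClasses.exists_rep c
    exact ⟨⟨x, ConjClasses.mem_carrier_mk⟩⟩
  refine div_ne_zero (Nat.cast_ne_zero.2 Fintype.card_ne_zero) (Nat.cast_ne_zero.2 ?_)
  exact Nat.card_pos.ne'

theorem card_filter_mk (c : ConjClasses Γ) :
    ((Finset.univ.filter fun x : Γ => ConjClasses.mk x = c).card : ℂ) =
      Fintype.card Γ * (zeta c)⁻¹ := by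
  have h : (Fintype.card Γ : ℂ) ≠ 0 := Nat.cast_ne_zero.2 Fintype.card_ne_zero
  rw [zeta, inv_div, mul_div_cancel₀ _ h, Nat.card_eq_fintype_card, Fintype.card_subtype]
  simp only [ConjClasses.mem_carrier_iff_mk_eq]

theorem sum_mk {M : Type*} [AddCommGroup M] [Module ℂ M] (H : ConjClasses Γ → M) :
    ∑ x : Γ, H (ConjClasses.mk x) = (Fintype.card Γ : ℂ) • ∑ c, (zeta c)⁻¹ • H c := by
  rw [← Finset.sum_fiberwise (s := Finset.univ) (g := fun x : Γ => ConjClasses.mk x),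
    Finset.smul_sum]
  refine Finset.sum_congr rfl fun c _ => ?_
  rw [Finset.sum_congr rfl fun x hx => congrArg H (Finset.mem_filter.1 hx).2, Finset.sum_const,
    smul_smul, ← card_filter_mk, Nat.cast_smul_eq_nsmul]

variable {M : Type*} [AddCommGroup M] [Module ℂ M]

/-- The average over `Γ^n ⋊ S_n` of a function of the type. -/
noncomputable def avgType (n : ℕ) (F : (ConjClasses Γ → Multiset ℕ) → M) : M :=
  ((Fintype.card Γ ^ n * n.factorial : ℕ) : ℂ)⁻¹ •
    ∑ s : Equiv.Perm (Fin n), ∑ g : Fin n → Γ, F (wreathType g s)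

/-- This is Newton's identity for averages over the wreath product. The cycle through a marked point
is split off; its cycle product is equidistributed in Γ, so the class c receives the weight ζ_c⁻¹.
-/
theorem avgType_succ (n : ℕ) (F : (ConjClasses Γ → Multiset ℕ) → M) :
    ((n + 1 : ℕ) : ℂ) • avgType (n + 1) F = ∑ x ∈ Finset.HasAntidiagonal.antidiagonal n,
      ∑ c, (zeta c)⁻¹ • avgType x.2 fun ρ => F (oneCycle c (x.1 + 1) + ρ) := by
  have hΓ : (Fintype.card Γ : ℂ) ≠ 0 := Nat.cast_ne_zero.2 Fintype.card_ne_zero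
  have key := sum_perm_smul (fun s : Equiv.Perm (Fin (n + 1)) => ∑ g : Fin (n + 1) → Γ,
      F (wreathType g s))
    (fun i j => Fintype.card Γ ^ i • (Fintype.card Γ : ℂ) • ∑ c, (zeta c)⁻¹ •
      ∑ τ : Equiv.Perm (Fin j), ∑ g : Fin j → Γ, F (oneCycle c (i + 1) + wreathType g τ)) (by
    intro i j hij E
    rw [← sum_mk fun c => ∑ τ : Equiv.Perm (Fin j), ∑ g : Fin j → Γ,
      F (oneCycle c (i + 1) + wreathType g τ), ← sum_pointClass_finRotate i fun c =>
      ∑ τ : Equiv.Perm (Fin j), ∑ g : Fin j → Γ, F (oneCycle c (i + 1) + wreathType g τ)]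
    refine Eq.trans ?_ Finset.sum_comm
    refine Finset.sum_congr rfl fun τ _ => ?_
    simp only [wreathType_permCongr]
    let e : (Fin (n + 1) → Γ) ≃ (Fin (i + 1) → Γ) × (Fin j → Γ) :=
      (E.symm.arrowCongr (Equiv.refl Γ)).trans (Equiv.sumArrowEquivProdArrow _ _ _)
    refine (Equiv.sum_comp e fun x : (Fin (i + 1) → Γ) × (Fin j → Γ) =>
      F (oneCycle (pointClass x.1 (finRotate (i + 1)) 0) (i + 1) + wreathType x.2 τ)).trans ?_
    rw [Fintype.sum_prod_type])
  rw [avgType, smul_comm, Nat.cast_smul_eq_nsmul ℂ, key, Finset.smul_sum]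
  refine Finset.sum_congr rfl fun x hx => ?_
  have hx' := Finset.HasAntidiagonal.mem_antidiagonal.1 hx
  simp only [avgType]
  simp_rw [smul_comm (zeta _)⁻¹]
  rw [← Finset.smul_sum, ← Nat.cast_smul_eq_nsmul ℂ, ← Nat.cast_smul_eq_nsmul ℂ, smul_smul,
    smul_smul, smul_smul]
  congr 1
  -- With x = (i, j) the normalizations cancel: (n+1)! = j! (n+1)_{i+1} and |Γ|^{n+1} = |Γ|^j |Γ|^i
  -- |Γ|.
  have h1 := Nat.factorial_mul_descFactorial (n := n + 1) (k := x.1 + 1) (by omega)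
  have h2 : n + 1 - (x.1 + 1) = x.2 := by omega
  rw [h2] at h1
  have h3 : n + 1 = x.2 + x.1 + 1 := by omega
  have h4 : (x.2.factorial : ℂ) ≠ 0 := Nat.cast_ne_zero.2 (Nat.factorial_ne_zero _)
  have h5 : ((n + 1).descFactorial (x.1 + 1) : ℂ) ≠ 0 := by
    refine Nat.cast_ne_zero.2 fun h => ?_
    rw [h, mul_zero] at h1
    exact Nat.factorial_ne_zero _ h1.symm
  rw [← h1]
  push_cast
  rw [h3, pow_add, pow_add, ← h3]
  field_simp

end Recursion

/-! ### Inverses and conjugacy in the wreath product. -/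

section Conjugacy

variable {Γ : Type*} [Group Γ]

theorem ofWreath_mul {n : ℕ} (g h : Fin n → Γ) (s t : Equiv.Perm (Fin n)) :
    ofWreath g s * ofWreath h t = ofWreath (fun i => g i * h (s.symm i)) (s * t) := by
  ext1
  · refine Prod.ext rfl ?_
    show 1 * PiGroup.permuteHom s 1 = 1
    rw [map_one, one_mul]
  · rfl

/-- The product `f m ⋯ f 1`. -/
def downProd (f : ℕ → Γ) (m : ℕ) : Γ := ((List.range m).map fun k => f (m - k)).prod

theorem downProd_zero (f : ℕ → Γ) : downProd f 0 = 1 := rfl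

theorem downProd_succ (f : ℕ → Γ) (m : ℕ) : downProd f (m + 1) = f (m + 1) * downProd f m := by
  unfold downProd
  rw [List.range_succ_eq_map, List.map_cons, List.prod_cons, List.map_map]
  congr 3
  funext k
  simp

theorem prod_inv_range (f : ℕ → Γ) (m : ℕ) :
    ((List.range m).map fun k => (f (k + 1))⁻¹).prod = (downProd f m)⁻¹ := by
  induction m with
  | zero => simp [downProd_zero]
  | succ m ih =>
    rw [List.range_succ, List.map_append, List.prod_append, ih, downProd_succ, mul_inv_rev]
    simp

theorem pow_minimalPeriod_sub {α : Type*} (s : Equiv.Perm α) (p : α) {k : ℕ}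
    (hk : k ≤ Function.minimalPeriod s p) :
    (s ^ (Function.minimalPeriod s p - k)) p = (s ^ k)⁻¹ p := by
  rw [eq_comm, Equiv.Perm.inv_eq_iff_eq, ← Equiv.Perm.mul_apply, ← pow_add,
    Nat.add_sub_of_le hk, pow_minimalPeriod_apply]

/-- Going k steps back on a cycle of length m is going m - k steps forward; the forward form suits
recursions along the cycle. -/
theorem pointClass_eq_downProd {α : Type*} (g : α → Γ) (s : Equiv.Perm α) (p : α) :
    pointClass g s p =
      ConjClasses.mk (downProd (fun k => g ((s ^ k) p)) (Function.minimalPeriod s p)) := by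
  unfold pointClass downProd
  congr 2
  refine List.map_congr_left fun k hk => ?_
  show _ = g _
  rw [pow_minimalPeriod_sub s p (List.mem_range.1 hk).le]

/-- The inverse of a conjugacy class. -/
def invClass (c : ConjClasses Γ) : ConjClasses Γ :=
  Quotient.map (sa := IsConj.setoid Γ) (sb := IsConj.setoid Γ) (fun x => x⁻¹) (fun x y h => by
    obtain ⟨c, rfl⟩ := isConj_iff.1 h
    exact isConj_iff.2 ⟨c, by group⟩) c

theorem invClass_mk (x : Γ) : invClass (ConjClasses.mk x) = ConjClasses.mk x⁻¹ := rfl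

theorem invClass_invClass (c : ConjClasses Γ) : invClass (invClass c) = c := by
  obtain ⟨x, rfl⟩ := ConjClasses.exists_rep c
  rw [invClass_mk, invClass_mk, inv_inv]

theorem minimalPeriod_inv {α : Type*} (s : Equiv.Perm α) (p : α) :
    Function.minimalPeriod (s⁻¹ : Equiv.Perm α) p = Function.minimalPeriod s p := by
  refine Function.minimalPeriod_eq_minimalPeriod_iff.2 fun k => ?_
  rw [Function.IsPeriodicPt, Function.IsPeriodicPt, Function.IsFixedPt, Function.IsFixedPt,
    Equiv.Perm.iterate_eq_pow, Equiv.Perm.iterate_eq_pow, inv_pow, Equiv.Perm.inv_eq_iff_eq,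
    eq_comm]

/-- The left side belongs to the inverse element (g, s)⁻¹ = (i ↦ g(s i)⁻¹, s⁻¹); its cycle product
at p consists of the inverted letters in the opposite order. -/
theorem pointClass_inv {α : Type*} (g : α → Γ) (s : Equiv.Perm α) (p : α) :
    pointClass (fun i => (g (s i))⁻¹) s⁻¹ p = invClass (pointClass g s p) := by
  rw [pointClass_eq_downProd g, invClass_mk, ← prod_inv_range, pointClass, minimalPeriod_inv]
  congr 2
  refine List.map_congr_left fun k hk => ?_
  rw [inv_pow, inv_inv, pow_succ', Equiv.Perm.mul_apply]

theorem wreathType_inv {n : ℕ} (g : Fin n → Γ) (s : Equiv.Perm (Fin n)) :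
    wreathType (fun i => (g (s i))⁻¹) s⁻¹ = fun c => wreathType g s (invClass c) := by
  refine wreathType_eq_of_count (fun c => count_zero_wreathType _ _ _) fun c l => ?_
  rw [mul_count_wreathType, pointCount, pointCount]
  refine Finset.sum_congr rfl fun p _ => ?_
  rw [minimalPeriod_inv, pointClass_inv]
  congr 1
  refine propext (and_congr_right fun _ => ?_)
  exact ⟨fun h => by rw [← h, invClass_invClass], fun h => by rw [h, invClass_invClass]⟩

/-- The equation is solved along the cycle: once w is chosen at 0, each next value is forced. The
condition for closing up at the last index is exactly that the value at 0 conjugates one cycle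
product to the other. -/
theorem exists_conj_finRotate {i : ℕ} {g h : Fin (i + 1) → Γ}
    (hc : pointClass g (finRotate (i + 1)) 0 = pointClass h (finRotate (i + 1)) 0) :
    ∃ w : Fin (i + 1) → Γ, ∀ a, h (finRotate (i + 1) a) =
      w (finRotate (i + 1) a) * g (finRotate (i + 1) a) * (w a)⁻¹ := by
  rw [pointClass_eq_downProd, pointClass_eq_downProd, minimalPeriod_finRotate,
    ConjClasses.mk_eq_mk_iff_isConj, isConj_iff] at hc
  obtain ⟨u, hu⟩ := hc
  set G := fun k => g ((finRotate (i + 1) ^ k) 0) with hG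
  set H := fun k => h ((finRotate (i + 1) ^ k) 0) with hH
  refine ⟨fun a => downProd H a * u * (downProd G a)⁻¹, fun a => ?_⟩
  have hr : finRotate (i + 1) a = (finRotate (i + 1) ^ (a.1 + 1)) 0 := by
    obtain ⟨a, ha⟩ := a
    rw [pow_succ', Equiv.Perm.mul_apply, finRotate_pow_apply a ha]
  have hg : g (finRotate (i + 1) a) = G (a.1 + 1) := by rw [hr]
  have hh : h (finRotate (i + 1) a) = H (a.1 + 1) := by rw [hr]
  rw [hg, hh]
  by_cases ha : a = Fin.last i
  · subst ha
    rw [finRotate_last]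
    rw [downProd_succ, downProd_succ] at hu
    simp only [Fin.val_last, Fin.val_zero, downProd_zero]
    have : H (i + 1) = u * (G (i + 1) * downProd G i) * u⁻¹ * (downProd H i)⁻¹ := by
      rw [hu]; group
    rw [this]; group
  · dsimp only
    rw [coe_finRotate_of_ne_last ha, downProd_succ, downProd_succ]
    group

/-- Elements of the wreath product of the same type are conjugate. -/
theorem exists_conj_of_wreathType_eq {n : ℕ} : ∀ {g h : Fin n → Γ} {s t : Equiv.Perm (Fin n)},
    wreathType g s = wreathType h t → ∃ (r : Equiv.Perm (Fin n)) (w : Fin n → Γ),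
      (∀ a, r (s a) = t (r a)) ∧ ∀ a, h (r (s a)) = w (s a) * g (s a) * (w a)⁻¹ := by
  induction n using Nat.strong_induction_on with
  | _ n ih =>
  intro g h s t hst
  rcases Nat.eq_zero_or_pos n with rfl | hn
  · exact ⟨1, 1, fun a => a.elim0, fun a => a.elim0⟩
  · let p : Fin n := ⟨0, hn⟩
    obtain ⟨i, hi⟩ : ∃ i, Function.minimalPeriod s p = i + 1 :=
      ⟨_, (Nat.sub_add_cancel (minimalPeriod_perm_pos s p)).symm⟩
    obtain ⟨k, E, τ, hk, hE, h1, h2⟩ := exists_cycle_split s p hi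
    have hc := mul_count_wreathType h t (i + 1) (pointClass g s p)
    rw [← hst, mul_count_wreathType] at hc
    -- Equal types give t as many points as s on cycles of this length and class, hence at least
    -- one; its cycle is matched with that of p, and the complements are treated by induction.
    have hpos : 0 < pointCount h t (i + 1) (pointClass g s p) := by
      rw [← hc, pointCount]
      refine Finset.sum_pos' (fun _ _ => Nat.zero_le _) ⟨p, Finset.mem_univ _, ?_⟩
      rw [if_pos ⟨hi, rfl⟩]
      exact Nat.one_pos
    obtain ⟨p', hp'⟩ : ∃ p', Function.minimalPeriod t p' = i + 1 ∧
        pointClass h t p' = pointClass g s p := by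
      by_contra hne
      push Not at hne
      refine hpos.ne' (Finset.sum_eq_zero fun p' _ => if_neg fun hh => hne p' hh.1 hh.2)
    obtain ⟨k', E', τ', hk', hE', h1', h2'⟩ := exists_cycle_split t p' hp'.1
    obtain rfl : k' = k := by omega
    have e1 := wreathType_split (g := g) E h1 h2
    have e2 := wreathType_split (g := h) E' h1' h2'
    have c1 : pointClass (fun a => g (E (Sum.inl a))) (finRotate (i + 1)) 0 = pointClass g s p := by
      rw [← hE]
      exact (pointClass_semiconj (j := fun a => E (Sum.inl a))
        (E.injective.comp Sum.inl_injective) h1 g 0).symm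
    have c2 : pointClass (fun a => h (E' (Sum.inl a))) (finRotate (i + 1)) 0 =
        pointClass g s p := by
      rw [← hp'.2, ← hE']
      exact (pointClass_semiconj (j := fun a => E' (Sum.inl a))
        (E'.injective.comp Sum.inl_injective) h1' h 0).symm
    rw [e1, e2, c1, c2] at hst
    obtain ⟨r, w, hr, hw⟩ := ih k' (by omega) (add_left_cancel hst)
    obtain ⟨v, hv⟩ := exists_conj_finRotate (c1.trans c2.symm)
    refine ⟨(E.symm.trans (Equiv.sumCongr (Equiv.refl _) r)).trans E',
      fun x => Sum.elim v w (E.symm x), fun x => ?_, fun x => ?_⟩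
    · obtain ⟨a | a, rfl⟩ := E.surjective x
      · simp [h1, h1']
      · simp [h2, h2', hr]
    · obtain ⟨a | a, rfl⟩ := E.surjective x
      · simpa [h1] using hv a
      · simpa [h2] using hw a

theorem isConj_ofWreath {n : ℕ} {g h : Fin n → Γ} {s t : Equiv.Perm (Fin n)}
    (hst : wreathType g s = wreathType h t) : IsConj (ofWreath g s) (ofWreath h t) := by
  obtain ⟨r, w, hr, hw⟩ := exists_conj_of_wreathType_eq hst
  refine isConj_iff.2 ⟨ofWreath (fun i => w (r.symm i)) r, ?_⟩
  rw [mul_inv_eq_iff_eq_mul, ofWreath_mul, ofWreath_mul]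
  have hrs : r * s = t * r := Equiv.ext hr
  rw [hrs]
  congr 1
  funext b
  obtain ⟨a, rfl⟩ : ∃ a, b = r (s a) := ⟨s.symm (r.symm b), by simp⟩
  have : t.symm (r (s a)) = r a := by rw [hr]; simp
  rw [hw, this]
  simp

end Conjugacy

/-! ### The number of elements of a given type. -/

section Count

variable {Γ : Type*} [Group Γ] [Fintype Γ]

/-- The size of a partition-valued function. -/
noncomputable def typeSize (ρ : ConjClasses Γ → Multiset ℕ) : ℕ := ∑ c, (ρ c).sum

theorem prod_count_factorial_cons (i : ℕ) (m : Multiset ℕ) :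
    ∏ j ∈ (i ::ₘ m).toFinset, ((i ::ₘ m).count j).factorial =
      (m.count i + 1) * ∏ j ∈ m.toFinset, (m.count j).factorial := by
  have h1 : ∏ j ∈ m.toFinset, (m.count j).factorial =
      ∏ j ∈ insert i m.toFinset, (m.count j).factorial := by
    refine Finset.prod_subset (Finset.subset_insert _ _) fun j _ hj => ?_
    rw [Multiset.mem_toFinset] at hj
    rw [Multiset.count_eq_zero.2 hj, Nat.factorial_zero]
  rw [h1, Multiset.toFinset_cons, ← Finset.mul_prod_erase _ _ (Finset.mem_insert_self i _),
    ← Finset.mul_prod_erase _ _ (Finset.mem_insert_self i m.toFinset), ← mul_assoc,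
    Multiset.count_cons_self, Nat.factorial_succ]
  congr 1
  refine Finset.prod_congr rfl fun j hj => ?_
  rw [Multiset.count_cons_of_ne (Finset.ne_of_mem_erase hj)]

theorem zRho_oneCycle_add (c : ConjClasses Γ) (i : ℕ) (ρ : ConjClasses Γ → Multiset ℕ) :
    zRho (oneCycle c i + ρ) = i * zeta c * ((ρ c).count i + 1) * zRho ρ := by
  have h : (i * zeta c * ((ρ c).count i + 1) : ℂ) =
      ∏ d, if d = c then (i * zeta c * ((ρ c).count i + 1) : ℂ) else 1 := by simp
  rw [h, zRho, zRho, ← Finset.prod_mul_distrib]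
  refine Finset.prod_congr rfl fun d _ => ?_
  by_cases hd : d = c
  · subst hd
    have : (oneCycle d i + ρ) d = i ::ₘ ρ d := by simp [oneCycle]
    rw [this, prod_count_factorial_cons, if_pos rfl, Multiset.prod_cons, Multiset.card_cons,
      pow_succ]
    push_cast
    ring
  · have : (oneCycle c i + ρ) d = ρ d := by simp [oneCycle, hd]
    rw [this, if_neg hd, one_mul]

theorem zRho_ne_zero {ρ : ConjClasses Γ → Multiset ℕ} (h : ∀ c, 0 ∉ ρ c) : zRho ρ ≠ 0 := by
  refine Finset.prod_ne_zero_iff.2 fun c _ => ?_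
  refine mul_ne_zero (mul_ne_zero ?_ ?_) (pow_ne_zero _ (zeta_ne_zero c))
  · exact_mod_cast Multiset.prod_ne_zero (h c)
  · refine Nat.cast_ne_zero.2 (Finset.prod_ne_zero_iff.2 fun i _ => Nat.factorial_ne_zero _)

theorem avgType_zero {M : Type*} [AddCommGroup M] [Module ℂ M]
    (F : (ConjClasses Γ → Multiset ℕ) → M) : avgType 0 F = F 0 := by
  have h : ∀ (s : Equiv.Perm (Fin 0)) (g : Fin 0 → Γ), wreathType g s = 0 := fun s g =>
    wreathType_eq_of_count (fun c => by simp) fun c i => by simp [pointCount]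
  simp [avgType, h]

theorem typeSize_oneCycle_add (c : ConjClasses Γ) (i : ℕ) (ρ : ConjClasses Γ → Multiset ℕ) :
    typeSize (oneCycle c i + ρ) = i + typeSize ρ := by
  have h : ∀ d, (oneCycle c i d).sum = if d = c then i else 0 := fun d => by
    unfold oneCycle; split_ifs <;> simp
  simp [typeSize, Finset.sum_add_distrib, h]

theorem exists_oneCycle_add {ρ : ConjClasses Γ → Multiset ℕ} {c : ConjClasses Γ} {i : ℕ}
    (h : i ∈ ρ c) : ∃ σ, ρ = oneCycle c i + σ := by
  refine ⟨fun d => if d = c then (ρ d).erase i else ρ d, funext fun d => ?_⟩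
  by_cases hd : d = c
  · subst hd
    simp [oneCycle, Multiset.cons_erase h]
  · simp [oneCycle, hd]

/-- The proportion of the elements of type `ρ` is `Z_ρ⁻¹`. -/
theorem avgType_indicator {n : ℕ} : ∀ {ρ : ConjClasses Γ → Multiset ℕ}, (∀ c, 0 ∉ ρ c) →
    typeSize ρ = n → avgType n (fun σ => if σ = ρ then (1 : ℂ) else 0) = (zRho ρ)⁻¹ := by
  induction n using Nat.strong_induction_on with
  | _ n ih =>
  intro ρ h0 hn
  rcases n with _ | n
  · have : ρ = 0 := by
      funext c
      have h1 : (ρ c).sum = 0 := (Finset.sum_eq_zero_iff.1 hn) c (Finset.mem_univ c)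
      refine Multiset.eq_zero_of_forall_notMem fun i hi => ?_
      have := Multiset.le_sum_of_mem hi
      have hi0 : i = 0 := by omega
      exact h0 c (hi0 ▸ hi)
    rw [avgType_zero, this, if_pos rfl]
    simp [zRho]
  · have hz := zRho_ne_zero h0
    -- Removing one cycle of length i and class c divides Z_ρ by i ζ_c m_i(c), so that this pair
    -- contributes i m_i(c) Z_ρ⁻¹.
    have hterm : ∀ x ∈ Finset.HasAntidiagonal.antidiagonal n, ∀ c : ConjClasses Γ,
        (zeta c)⁻¹ • avgType x.2 (fun σ => if oneCycle c (x.1 + 1) + σ = ρ then (1 : ℂ) else 0) =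
        (((x.1 + 1) * (ρ c).count (x.1 + 1) : ℕ) : ℂ) * (zRho ρ)⁻¹ := by
      intro x hx c
      have hx' := Finset.HasAntidiagonal.mem_antidiagonal.1 hx
      by_cases hc : x.1 + 1 ∈ ρ c
      · obtain ⟨σ, rfl⟩ := exists_oneCycle_add hc
        simp only [add_right_inj]
        rw [typeSize_oneCycle_add] at hn
        have hσ : ∀ d, 0 ∉ σ d := fun d hd => h0 d (Multiset.mem_add.2 (Or.inr hd))
        rw [ih x.2 (by omega) hσ (by omega), zRho_oneCycle_add, smul_eq_mul]
        have h1 := zeta_ne_zero c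
        have h2 := zRho_ne_zero hσ
        have h3 : (x.1 + 1 : ℂ) ≠ 0 := by exact_mod_cast Nat.succ_ne_zero x.1
        have h4 : ((σ c).count (x.1 + 1) + 1 : ℂ) ≠ 0 := by
          exact_mod_cast Nat.succ_ne_zero ((σ c).count (x.1 + 1))
        have h5 : ((oneCycle c (x.1 + 1) + σ) c).count (x.1 + 1) = (σ c).count (x.1 + 1) + 1 := by
          simp [oneCycle, add_comm]
        rw [h5]
        push_cast
        field_simp
      · have : ∀ σ, (if oneCycle c (x.1 + 1) + σ = ρ then (1 : ℂ) else 0) = 0 := fun σ =>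
          if_neg fun h => hc (by rw [← h]; simp [oneCycle])
        simp only [this]
        rw [Multiset.count_eq_zero.2 hc]
        simp [avgType]
    have key := avgType_succ (M := ℂ) n (fun σ => if σ = ρ then (1 : ℂ) else 0)
    rw [Finset.sum_congr rfl fun x hx => Finset.sum_congr rfl fun c _ => hterm x hx c] at key
    -- The numbers i m_i(c) add up to the size n + 1 of ρ, which cancels the factor on the left of
    -- the recursion.
    have hsum : ∑ x ∈ Finset.HasAntidiagonal.antidiagonal n, ∑ c,
        (x.1 + 1) * (ρ c).count (x.1 + 1) = n + 1 := by
      rw [Finset.sum_comm, ← hn, typeSize]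
      refine Finset.sum_congr rfl fun c _ => ?_
      rw [Finset.Nat.sum_antidiagonal_eq_sum_range_succ_mk,
        Finset.sum_multiset_count_of_subset (ρ c) (Finset.range (n + 2)), Finset.sum_range_succ' _ (n + 1)]
      · simp [mul_comm]
      · intro i hi
        have h1 := Multiset.le_sum_of_mem (Multiset.mem_toFinset.1 hi)
        have h2 : (ρ c).sum ≤ n + 1 := hn ▸ Finset.single_le_sum (f := fun c => (ρ c).sum)
          (fun _ _ => Nat.zero_le _) (Finset.mem_univ c)
        rw [Finset.mem_range]; omega
    simp only [← Finset.sum_mul, ← Nat.cast_sum] at key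
    rw [hsum, smul_eq_mul] at key
    exact mul_left_cancel₀ (Nat.cast_ne_zero.2 (Nat.succ_ne_zero n)) key

end Count

/-! ### The basic spin character on permutations with odd cycles. -/

section BasicValue

/-- The trace runs over the s-invariant exponent vectors u, which are functions on the set of
cycles. Such a monomial is fixed by s without sign, because s has odd order while the sign has order
at most 2. -/
theorem basicChar_one_eq {n : ℕ} {s : Equiv.Perm (Fin n)}
    (hs : ∀ p, Odd (Function.minimalPeriod s p)) :
    basicChar 1 s = 2 ^ Fintype.card (Cycles s) := by
  have hz : ∀ u : Fin n → ZMod 2, (PiGroup.permuteHom s ⟨0, u⟩).supp = u →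
      (PiGroup.permuteHom s ⟨0, u⟩).zexp = 0 := by
    intro u hu
    set ε := (PiGroup.permuteHom s ⟨0, u⟩).zexp with hε
    have h1 : ∀ k : ZMod 2, PiGroup.permuteHom s ⟨k, u⟩ = ⟨k + ε, u⟩ := by
      intro k
      ext1
      · simp only [hε, PiGroup.permuteHom, MonoidHom.coe_mk, OneHom.coe_mk, zero_add]
      · exact hu
    have h2 : ∀ m : ℕ, PiGroup.permuteHom (s ^ m) ⟨0, u⟩ = ⟨m * ε, u⟩ := by
      intro m
      induction m with
      | zero => simp [PiGroup.permuteHom_one]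
      | succ m ih =>
        rw [pow_succ', PiGroup.permuteHom_mul, MonoidHom.comp_apply, ih, h1]
        push_cast
        rw [add_mul, one_mul]
    -- The product of all the periods is an odd exponent N with s^N = 1; hence N ε = 0 modulo 2 and
    -- ε = 0.
    have h3 : s ^ (∏ p, Function.minimalPeriod s p) = 1 := by
      refine Equiv.ext fun p => ?_
      obtain ⟨k, hk⟩ := Finset.dvd_prod_of_mem (fun p => Function.minimalPeriod s p)
        (Finset.mem_univ p)
      rw [hk, ← Equiv.Perm.iterate_eq_pow]
      exact (Function.isPeriodicPt_minimalPeriod s p).mul_const k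
    have h4 := h2 (∏ p, Function.minimalPeriod s p)
    rw [h3, PiGroup.permuteHom_one] at h4
    have h5 : (0 : ZMod 2) = (∏ p, Function.minimalPeriod s p : ℕ) * ε := congrArg PiGroup.zexp h4
    have h6 : Odd (∏ p, Function.minimalPeriod s p) :=
      Finset.prod_induction _ Odd (fun _ _ ha hb => ha.mul hb) odd_one fun p _ => hs p
    rw [(ZMod.natCast_eq_one_iff_odd).2 h6, one_mul] at h5
    exact h5.symm
  rw [basicChar_eq_sum]
  have h1 : ∀ u : Fin n → ZMod 2, (if (1 * PiGroup.permuteHom s ⟨0, u⟩).supp = u then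
      sgn (1 * PiGroup.permuteHom s ⟨0, u⟩).zexp else 0) =
      if ∀ a, u (s a) = u a then (1 : ℂ) else 0 := by
    intro u
    rw [one_mul]
    have h2 : (PiGroup.permuteHom s ⟨0, u⟩).supp = u ↔ ∀ a, u (s a) = u a := by
      constructor
      · intro h a
        have : u (s.symm (s a)) = u (s a) := congrFun h (s a)
        rw [← this, s.symm_apply_apply]
      · intro h
        funext a
        show u (s.symm a) = u a
        rw [← h, s.apply_symm_apply]
    by_cases h : (PiGroup.permuteHom s ⟨0, u⟩).supp = u
    · rw [if_pos h, if_pos (h2.1 h), hz u h, sgn_zero]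
    · rw [if_neg h, if_neg fun h' => h (h2.2 h')]
  rw [Finset.sum_congr rfl fun u _ => h1 u, Finset.sum_boole]
  let e : (Cycles s → ZMod 2) ≃ {u : Fin n → ZMod 2 // ∀ a, u (s a) = u a} :=
    { toFun := fun f => ⟨fun a => f (Quotient.mk _ a), fun a => by
        refine congrArg f (Quotient.sound ?_)
        exact Equiv.Perm.sameCycle_apply_left.2 (Equiv.Perm.SameCycle.refl s a)⟩
      invFun := fun u => Quotient.lift u.1 fun a b hab => by
        obtain ⟨k, -, rfl⟩ := Equiv.Perm.SameCycle.exists_pow_eq' hab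
        induction k with
        | zero => rfl
        | succ k ih =>
          rw [pow_succ', Equiv.Perm.mul_apply, u.2]
          exact ih (Equiv.Perm.sameCycle_pow_right.2 (Equiv.Perm.SameCycle.refl s a))
      left_inv := fun f => by
        funext q
        obtain ⟨a, rfl⟩ := Quotient.exists_rep q
        rfl
      right_inv := fun u => rfl }
  rw [← Fintype.card_subtype, ← Fintype.card_congr e, Fintype.card_fun, ZMod.card]
  push_cast
  rfl

end BasicValue

/-! ### Restriction to the two factors of the spin product. -/

section Restriction

variable {Γ : Type*} [Group Γ]

theorem zPow_zero (n : ℕ) : (zPow n 0 : BG Γ n) = 1 := rfl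

theorem zPow_one (n : ℕ) : (zPow n 1 : BG Γ n) = zBG n := rfl

theorem parity_ofWreath {n : ℕ} (g : Fin n → Γ) (s : Equiv.Perm (Fin n)) :
    parity (ofWreath g s) = 0 := by
  simp [parity, ofWreath]

theorem parity_inv_eq {n : ℕ} (x : BG Γ n) : parity x⁻¹ = parity x := by
  have h : parity x + parity x⁻¹ = 0 := by
    rw [← parity_mul, mul_inv_cancel]; simp [parity]
  have h2 := CharTwo.add_self_eq_zero (parity x)
  linear_combination h - h2

theorem eq_of_isConj {n : ℕ} {f : BG Γ n → ℂ} (hf : f ∈ spinSuper Γ n) {x y : BG Γ n}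
    (h : IsConj x y) : f x = f y := by
  obtain ⟨c, rfl⟩ := isConj_iff.1 h
  exact (hf.1 x c).symm

theorem apply_zPow_mul {n : ℕ} {f : BG Γ n → ℂ} (hf : f ∈ spinSuper Γ n) (k : ZMod 2)
    (x : BG Γ n) : f (zPow n k * x) = sgn k * f x := spin_zPow hf.2.1 k x

theorem incl_comm {n k m : ℕ} (h : n + k = m) {x : BG Γ n} {y : BG Γ k}
    (hxy : parity x * parity y = 0) : inclL h x * inclR h y = inclR h y * inclL h x := by
  rw [inclL_mul_inclR, hxy, zPow_zero, one_mul]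

/-- Evenness of y is what makes it commute with the whole first factor, odd elements included, so
that conjugation there extends to the product. -/
theorem restrictL_mem {n k m : ℕ} (h : n + k = m) {f : BG Γ m → ℂ} (hf : f ∈ spinSuper Γ m)
    {y : BG Γ k} (hy : parity y = 0) :
    (fun x => f (inclL h x * inclR h y)) ∈ spinSuper Γ n := by
  refine ⟨fun x t => ?_, fun x => ?_, fun x hx => ?_⟩
  · have hc : inclL h t⁻¹ * inclR h y = inclR h y * inclL h t⁻¹ := incl_comm h (by rw [hy, mul_zero])
    have : inclL h (t * x * t⁻¹) * inclR h y =
        inclL h t * (inclL h x * inclR h y) * (inclL h t)⁻¹ := by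
      rw [map_mul, map_mul, mul_assoc, hc, map_inv]
      simp only [mul_assoc]
    show f _ = f _
    rw [this, hf.1]
  · show f _ = -f _
    rw [map_mul, inclL, incl_zBG, mul_assoc, hf.2.1]
  · exact hf.2.2 _ (by rw [parity_mul, inclL, inclR, parity_incl, parity_incl, hx, hy, add_zero])

theorem restrictR_mem {n k m : ℕ} (h : n + k = m) {f : BG Γ m → ℂ} (hf : f ∈ spinSuper Γ m)
    {x : BG Γ n} (hx : parity x = 0) :
    (fun y => f (inclL h x * inclR h y)) ∈ spinSuper Γ k := by
  refine ⟨fun y t => ?_, fun y => ?_, fun y hy => ?_⟩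
  · have hc : inclL h x * inclR h t = inclR h t * inclL h x := incl_comm h (by rw [hx, zero_mul])
    have : inclL h x * inclR h (t * y * t⁻¹) =
        inclR h t * (inclL h x * inclR h y) * (inclR h t)⁻¹ := by
      rw [map_mul, map_mul, map_inv, ← mul_assoc, ← mul_assoc, hc]
      simp only [mul_assoc]
    show f _ = f _
    rw [this, hf.1]
  · have : inclL h x * inclR h (zBG k * y) = zBG m * (inclL h x * inclR h y) := by
      rw [map_mul, inclR, incl_zBG, ← mul_assoc, ← zBG_mul, mul_assoc]
    show f _ = -f _
    rw [this, hf.2.1]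
  · exact hf.2.2 _ (by rw [parity_mul, inclL, inclR, parity_incl, parity_incl, hx, hy, zero_add])

theorem exists_first_or_last {n k m : ℕ} (h : n + k = m) (j : Fin m) :
    (∃ a, firstEmb h a = j) ∨ ∃ b, lastEmb h b = j := by
  by_cases hj : (j : ℕ) < n
  · exact Or.inl ⟨⟨j, hj⟩, rfl⟩
  · refine Or.inr ⟨⟨j - n, by omega⟩, Fin.ext ?_⟩
    show n + (j - n) = (j : ℕ)
    omega

/-- The decomposition of `{1, …, m}` into its first `n` and last `k` elements. -/
noncomputable def splitEquiv {n k m : ℕ} (h : n + k = m) : Fin n ⊕ Fin k ≃ Fin m :=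
  Equiv.ofBijective (Sum.elim (firstEmb h) (lastEmb h)) ⟨by
    refine Function.Injective.sumElim (firstEmb h).injective (lastEmb h).injective fun a b => ?_
    exact firstEmb_ne_lastEmb h a b, fun j => by
    rcases exists_first_or_last h j with ⟨a, ha⟩ | ⟨b, hb⟩
    · exact ⟨Sum.inl a, ha⟩
    · exact ⟨Sum.inr b, hb⟩⟩

theorem splitEquiv_inl {n k m : ℕ} (h : n + k = m) (a : Fin n) :
    splitEquiv h (Sum.inl a) = firstEmb h a := rfl

theorem splitEquiv_inr {n k m : ℕ} (h : n + k = m) (a : Fin k) :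
    splitEquiv h (Sum.inr a) = lastEmb h a := rfl

section Extend

variable {n k m : ℕ} (h : n + k = m) {M : Type*}

theorem extend_first_first (f : Fin n → M) (d : Fin m → M) (a : Fin n) :
    Function.extend (firstEmb h) f d (firstEmb h a) = f a := (firstEmb h).injective.extend_apply _ _ _

theorem extend_last_last (f : Fin k → M) (d : Fin m → M) (a : Fin k) :
    Function.extend (lastEmb h) f d (lastEmb h a) = f a := (lastEmb h).injective.extend_apply _ _ _

theorem extend_first_last (f : Fin n → M) (d : Fin m → M) (b : Fin k) :
    Function.extend (firstEmb h) f d (lastEmb h b) = d (lastEmb h b) :=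
  Function.extend_apply' _ _ _ fun ⟨a, ha⟩ => firstEmb_ne_lastEmb h a b ha

theorem extend_last_first (f : Fin k → M) (d : Fin m → M) (a : Fin n) :
    Function.extend (lastEmb h) f d (firstEmb h a) = d (firstEmb h a) :=
  Function.extend_apply' _ _ _ fun ⟨b, hb⟩ => firstEmb_ne_lastEmb h a b hb.symm

end Extend

theorem viaEmbedding_mul_first {n k m : ℕ} (h : n + k = m) (σ : Equiv.Perm (Fin n))
    (τ : Equiv.Perm (Fin k)) (a : Fin n) :
    (Equiv.Perm.viaEmbedding σ (firstEmb h).toEmbedding *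
      Equiv.Perm.viaEmbedding τ (lastEmb h).toEmbedding) (firstEmb h a) = firstEmb h (σ a) := by
  rw [Equiv.Perm.mul_apply, inclR_right_first]
  exact Equiv.Perm.viaEmbedding_apply σ (firstEmb h).toEmbedding a

theorem viaEmbedding_mul_last {n k m : ℕ} (h : n + k = m) (σ : Equiv.Perm (Fin n))
    (τ : Equiv.Perm (Fin k)) (a : Fin k) :
    (Equiv.Perm.viaEmbedding σ (firstEmb h).toEmbedding *
      Equiv.Perm.viaEmbedding τ (lastEmb h).toEmbedding) (lastEmb h a) = lastEmb h (τ a) := by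
  rw [Equiv.Perm.mul_apply]
  have := Equiv.Perm.viaEmbedding_apply τ (lastEmb h).toEmbedding a
  simp only [RelEmbedding.coe_toEmbedding] at this
  rw [this, inclL_right_last]

/-- The element of `Γ^{n+k} ⋊ S_{n+k}` with the given components. -/
theorem incl_ofWreath {n k m : ℕ} (h : n + k = m) (g : Fin n → Γ) (σ : Equiv.Perm (Fin n))
    (g' : Fin k → Γ) (τ : Equiv.Perm (Fin k)) :
    inclL h (ofWreath g σ) * inclR h (ofWreath g' τ) =
      ofWreath (vecIncl (firstEmb h) g * vecIncl (lastEmb h) g')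
        (Equiv.Perm.viaEmbedding σ (firstEmb h).toEmbedding *
          Equiv.Perm.viaEmbedding τ (lastEmb h).toEmbedding) := by
  ext1
  · rw [inclL_mul_inclR_left]
    refine Prod.ext rfl ?_
    show PiGroup.incl (firstEmb h) 1 * PiGroup.incl (lastEmb h) 1 = 1
    rw [map_one, map_one, one_mul]
  · rfl

theorem wreathType_incl {n k m : ℕ} (h : n + k = m) (g : Fin n → Γ) (σ : Equiv.Perm (Fin n))
    (g' : Fin k → Γ) (τ : Equiv.Perm (Fin k)) :
    wreathType (vecIncl (firstEmb h) g * vecIncl (lastEmb h) g')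
        (Equiv.Perm.viaEmbedding σ (firstEmb h).toEmbedding *
          Equiv.Perm.viaEmbedding τ (lastEmb h).toEmbedding) =
      wreathType g σ + wreathType g' τ := by
  rw [wreathType_add (splitEquiv h) (fun a => viaEmbedding_mul_first h σ τ a)
    (fun a => viaEmbedding_mul_last h σ τ a)]
  congr 2
  · funext a
    show Function.extend (firstEmb h) g (1 : Fin m → Γ) (firstEmb h a) *
      Function.extend (lastEmb h) g' (1 : Fin m → Γ) (firstEmb h a) = g a
    rw [extend_first_first, extend_last_first]
    exact mul_one _
  · funext a
    show Function.extend (firstEmb h) g (1 : Fin m → Γ) (lastEmb h a) *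
      Function.extend (lastEmb h) g' (1 : Fin m → Γ) (lastEmb h a) = g' a
    rw [extend_last_last, extend_first_last]
    exact one_mul _

theorem exists_eq_incl {n k m : ℕ} (h : n + k = m) {y : BG Γ m} {σ : Equiv.Perm (Fin n)}
    {τ : Equiv.Perm (Fin k)} (h1 : ∀ a, y.right (firstEmb h a) = firstEmb h (σ a))
    (h2 : ∀ a, y.right (lastEmb h a) = lastEmb h (τ a)) :
    ∃ (x : BG Γ n) (x' : BG Γ k), x.right = σ ∧ x'.right = τ ∧ y = inclL h x * inclR h x' := by
  refine ⟨⟨(fun a => y.left.1 (firstEmb h a), ⟨y.left.2.zexp, fun a => y.left.2.supp (firstEmb h a)⟩), σ⟩,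
    ⟨(fun a => y.left.1 (lastEmb h a), ⟨0, fun a => y.left.2.supp (lastEmb h a)⟩), τ⟩, rfl, rfl, ?_⟩
  ext1
  · rw [inclL_mul_inclR_left]
    refine Prod.ext (funext fun j => ?_) ?_
    · show y.left.1 j = Function.extend (firstEmb h) (fun a => y.left.1 (firstEmb h a)) 1 j *
        Function.extend (lastEmb h) (fun a => y.left.1 (lastEmb h a)) 1 j
      rcases exists_first_or_last h j with ⟨a, rfl⟩ | ⟨b, rfl⟩
      · rw [extend_first_first, extend_last_first]; exact (mul_one _).symm
      · rw [extend_first_last, extend_last_last]; exact (one_mul _).symm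
    · ext1
      · show y.left.2.zexp = y.left.2.zexp + 0 + PiGroup.cocycle
          (Function.extend (firstEmb h) (fun a => y.left.2.supp (firstEmb h a)) 0)
          (Function.extend (lastEmb h) (fun a => y.left.2.supp (lastEmb h a)) 0)
        rw [cocycle_first_last, add_zero, add_zero]
      · funext j
        show y.left.2.supp j =
          Function.extend (firstEmb h) (fun a => y.left.2.supp (firstEmb h a)) 0 j +
          Function.extend (lastEmb h) (fun a => y.left.2.supp (lastEmb h a)) 0 j
        rcases exists_first_or_last h j with ⟨a, rfl⟩ | ⟨b, rfl⟩
        · rw [extend_first_first, extend_last_first]; exact (add_zero _).symm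
        · rw [extend_first_last, extend_last_last]; exact (zero_add _).symm
  · refine Equiv.ext fun j => ?_
    rcases exists_first_or_last h j with ⟨a, rfl⟩ | ⟨b, rfl⟩
    · rw [h1]; exact (viaEmbedding_mul_first h σ τ a).symm
    · rw [h2]; exact (viaEmbedding_mul_last h σ τ b).symm

/-- A pure permutation carrying the given invariant decomposition to the first n and last k indices
conjugates x into the spin product. -/
theorem exists_isConj_incl {n k m : ℕ} (h : n + k = m) (E : Fin n ⊕ Fin k ≃ Fin m) {x : BG Γ m}
    {σ : Equiv.Perm (Fin n)} {τ : Equiv.Perm (Fin k)}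
    (h1 : ∀ a, x.right (E (Sum.inl a)) = E (Sum.inl (σ a)))
    (h2 : ∀ a, x.right (E (Sum.inr a)) = E (Sum.inr (τ a))) :
    ∃ (y : BG Γ n) (y' : BG Γ k), y.right = σ ∧ y'.right = τ ∧
      IsConj x (inclL h y * inclR h y') := by
  let T : Equiv.Perm (Fin m) := (E.symm.trans (splitEquiv h))
  let t : BG Γ m := ofWreath 1 T
  have hr : (t * x * t⁻¹).right = T * x.right * T⁻¹ := rfl
  have hT1 : ∀ a, T⁻¹ (firstEmb h a) = E (Sum.inl a) := fun a => by
    rw [Equiv.Perm.inv_eq_iff_eq]; simp [T, splitEquiv_inl]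
  have hT2 : ∀ a, T⁻¹ (lastEmb h a) = E (Sum.inr a) := fun a => by
    rw [Equiv.Perm.inv_eq_iff_eq]; simp [T, splitEquiv_inr]
  obtain ⟨y, y', hy, hy', hyy⟩ := exists_eq_incl h (y := t * x * t⁻¹) (σ := σ) (τ := τ)
    (fun a => by
      rw [hr, Equiv.Perm.mul_apply, Equiv.Perm.mul_apply, hT1, h1]; simp [T, splitEquiv_inl])
    (fun a => by
      rw [hr, Equiv.Perm.mul_apply, Equiv.Perm.mul_apply, hT2, h2]; simp [T, splitEquiv_inr])
  exact ⟨y, y', hy, hy', hyy ▸ isConj_iff.2 ⟨t, rfl⟩⟩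

end Restriction

/-! ### Spin class functions vanish on even cycles and live on odd types. -/

section Vanishing

variable {Γ : Type*} [Group Γ]

/-- The inclusion of `Π_n` in `Γ̃_n`. -/
def ofPi {n : ℕ} : PiGroup n →* BG Γ n :=
  SemidirectProduct.inl.comp (MonoidHom.inr (Fin n → Γ) (PiGroup n))

theorem ofPi_conj {n : ℕ} (b : PiGroup n) (x : BG Γ n) :
    ofPi b * x * (ofPi b)⁻¹ =
      ⟨(x.left.1, b * x.left.2 * (PiGroup.permuteHom x.right b)⁻¹), x.right⟩ := by
  rw [mul_inv_eq_iff_eq_mul]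
  ext1
  · refine Prod.ext (funext fun i => ?_) ?_
    · show 1 * x.left.1 i = x.left.1 i * 1
      rw [one_mul, mul_one]
    · show b * PiGroup.permuteHom 1 x.left.2 = b * x.left.2 * (PiGroup.permuteHom x.right b)⁻¹ *
        PiGroup.permuteHom x.right b
      rw [PiGroup.permuteHom_one, inv_mul_cancel_right]; rfl
  · show 1 * x.right = x.right * 1
    rw [one_mul, mul_one]

/-- The inversions of the rotation are the i pairs formed with the last index, so it sends a_1 ⋯
a_{i+1} to z^i a_1 ⋯ a_{i+1}. -/
theorem permuteHom_finRotate_ones (i : ℕ) :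
    PiGroup.permuteHom (finRotate (i + 1)) ⟨0, 1⟩ = ⟨(i : ZMod 2), 1⟩ := by
  ext1
  · show 0 + ∑ a : Fin (i + 1), ∑ b, (if a < b ∧ finRotate (i + 1) b < finRotate (i + 1) a then
      (1 : ZMod 2) * 1 else 0) = i
    have h : ∀ a b : Fin (i + 1), (a < b ∧ finRotate (i + 1) b < finRotate (i + 1) a) ↔
        (b = Fin.last i ∧ a < Fin.last i) := by
      intro a b
      constructor
      · rintro ⟨hab, hr⟩
        have ha : a ≠ Fin.last i := (hab.trans_le (Fin.le_last b)).ne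
        refine ⟨?_, (hab.trans_le (Fin.le_last b))⟩
        by_contra hb
        rw [Fin.lt_def, coe_finRotate_of_ne_last ha, coe_finRotate_of_ne_last hb] at hr
        rw [Fin.lt_def] at hab
        omega
      · rintro ⟨rfl, ha⟩
        refine ⟨ha, ?_⟩
        rw [Fin.lt_def, coe_finRotate_of_ne_last ha.ne, finRotate_last]
        exact Nat.succ_pos _
    simp only [h, ite_and, mul_one, zero_add, Finset.sum_ite_eq', Finset.mem_univ, if_true]
    rw [Finset.sum_boole]
    have : (Finset.univ.filter fun a : Fin (i + 1) => a < Fin.last i) =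
        Finset.Iio (Fin.last i) := by
      ext a; simp only [Finset.mem_filter, Finset.mem_univ, true_and, Finset.mem_Iio]
    rw [this, Fin.card_Iio, Fin.val_last]
  · rfl

/-- For a cycle of even length, conjugation by a_1 ⋯ a_{i+1} multiplies the element by z, so f
equals its own negative there. -/
theorem apply_ofWreath_finRotate {i : ℕ} (hi : ¬ Odd (i + 1)) {f : BG Γ (i + 1) → ℂ}
    (hf : f ∈ spinSuper Γ (i + 1)) (g : Fin (i + 1) → Γ) :
    f (ofWreath g (finRotate (i + 1))) = 0 := by
  have hi' : (i : ZMod 2) = 1 := by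
    rw [ZMod.natCast_eq_one_iff_odd, ← Nat.not_even_iff_odd]
    exact fun h => hi (Even.add_one h)
  have h1 := hf.1 (ofWreath g (finRotate (i + 1))) (ofPi ⟨0, 1⟩)
  have h2 : ofPi ⟨0, 1⟩ * ofWreath g (finRotate (i + 1)) * (ofPi ⟨0, 1⟩)⁻¹ =
      zBG (i + 1) * ofWreath g (finRotate (i + 1)) := by
    rw [ofPi_conj, ← zPow_one, zPow_mul]
    ext1
    · refine Prod.ext rfl ?_
      show ⟨0, 1⟩ * 1 * (PiGroup.permuteHom (finRotate (i + 1)) ⟨0, 1⟩)⁻¹ = (⟨1 + 0, 0⟩ : PiGroup (i + 1))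
      rw [permuteHom_finRotate_ones, hi', mul_inv_eq_iff_eq_mul]
      ext1
      · simp [PiGroup.cocycle_zero_left]
        decide
      · simp
    · rfl
  rw [h2, hf.2.1] at h1
  linear_combination (-1 / 2 : ℂ) * h1

theorem twisted_conj_supp {n : ℕ} (a b : PiGroup n) (s : Equiv.Perm (Fin n)) (j : Fin n) :
    (b * a * (PiGroup.permuteHom s b)⁻¹).supp j = b.supp j + a.supp j + b.supp (s.symm j) := rfl

/-- Inside a single cycle an even element of `Π_n` can be conjugated away. -/
theorem exists_ofPi_conj {i : ℕ} {x : BG Γ (i + 1)} (hx : x.right = finRotate (i + 1))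
    (hp : parity x = 0) : ∃ k, IsConj x (zPow (i + 1) k * ofWreath x.left.1 (finRotate (i + 1))) := by
  -- The conjugating exponents are partial sums of those of x, so that consecutive ones differ by
  -- the exponent to be removed; the evenness of x closes the cycle, the last partial sum being 0.
  let u : Fin (i + 1) → ZMod 2 := fun j => ∑ l ∈ Finset.Iic j, x.left.2.supp l
  have hu : ∀ j, u (finRotate (i + 1) j) + x.left.2.supp (finRotate (i + 1) j) + u j = 0 := by
    intro j
    by_cases hj : j = Fin.last i
    · subst hj
      rw [finRotate_last]
      have h1 : u 0 = x.left.2.supp 0 := by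
        have : (Finset.Iic (0 : Fin (i + 1))) = {0} := by ext a; simp
        simp [u, this]
      have h2 : u (Fin.last i) = 0 := by
        rw [← hp]
        have : (Finset.Iic (Fin.last i)) = Finset.univ := by ext a; simp [Fin.le_last]
        simp [u, this, parity]
      rw [h1, h2, add_zero, CharTwo.add_self_eq_zero]
    · have hv := coe_finRotate_of_ne_last hj
      have : Finset.Iic (finRotate (i + 1) j) = insert (finRotate (i + 1) j) (Finset.Iic j) := by
        ext a
        rw [Finset.mem_insert, Finset.mem_Iic, Finset.mem_Iic, Fin.le_def, Fin.le_def, Fin.ext_iff, hv]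
        omega
      have h3 : u (finRotate (i + 1) j) = x.left.2.supp (finRotate (i + 1) j) + u j := by
        show ∑ l ∈ Finset.Iic (finRotate (i + 1) j), _ = _
        rw [this, Finset.sum_insert]
        rw [Finset.mem_Iic, Fin.le_def, hv]
        omega
      rw [h3]
      linear_combination CharTwo.add_self_eq_zero (x.left.2.supp (finRotate (i + 1) j)) +
        CharTwo.add_self_eq_zero (u j)
  refine ⟨(⟨0, u⟩ * x.left.2 * (PiGroup.permuteHom x.right ⟨0, u⟩)⁻¹).zexp,
    isConj_iff.2 ⟨ofPi ⟨0, u⟩, (ofPi_conj _ _).trans ?_⟩⟩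
  rw [zPow_mul]
  ext1
  · refine Prod.ext rfl ?_
    ext1
    · exact (add_zero _).symm
    · funext j
      obtain ⟨j, rfl⟩ := (finRotate (i + 1)).surjective j
      refine (twisted_conj_supp _ _ _ _).trans ?_
      rw [hx, Equiv.symm_apply_apply]
      exact hu j
  · exact hx

theorem odd_minimalPeriod_incl {n k m : ℕ} (h : n + k = m) {σ : Equiv.Perm (Fin n)}
    {τ : Equiv.Perm (Fin k)} (hσ : ∀ p, Odd (Function.minimalPeriod σ p))
    (hτ : ∀ p, Odd (Function.minimalPeriod τ p)) (p : Fin m) :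
    Odd (Function.minimalPeriod (Equiv.Perm.viaEmbedding σ (firstEmb h).toEmbedding *
      Equiv.Perm.viaEmbedding τ (lastEmb h).toEmbedding : Equiv.Perm (Fin m)) p) := by
  rcases exists_first_or_last h p with ⟨a, rfl⟩ | ⟨b, rfl⟩
  · rw [minimalPeriod_semiconj (firstEmb h).injective (viaEmbedding_mul_first h σ τ)]
    exact hσ a
  · rw [minimalPeriod_semiconj (lastEmb h).injective (viaEmbedding_mul_last h σ τ)]
    exact hτ b

/-- Spin super class functions vanish on permutations with an even cycle. -/
theorem apply_ofWreath_of_even {n : ℕ} {f : BG Γ n → ℂ} (hf : f ∈ spinSuper Γ n) (g : Fin n → Γ)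
    {s : Equiv.Perm (Fin n)} {p : Fin n} (hp : ¬ Odd (Function.minimalPeriod s p)) :
    f (ofWreath g s) = 0 := by
  obtain ⟨i, hi⟩ : ∃ i, Function.minimalPeriod s p = i + 1 :=
    ⟨_, (Nat.sub_add_cancel (minimalPeriod_perm_pos s p)).symm⟩
  obtain ⟨k, E, τ, hk, -, h1, h2⟩ := exists_cycle_split s p hi
  -- The even cycle is moved into the first factor, where the restriction of f is again a spin super
  -- class function and the single-cycle case applies.
  have hconj : IsConj (ofWreath g s)
      (inclL hk (ofWreath (fun a => g (E (Sum.inl a))) (finRotate (i + 1))) *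
        inclR hk (ofWreath (fun a => g (E (Sum.inr a))) τ)) := by
    rw [incl_ofWreath]
    exact isConj_ofWreath (by rw [wreathType_incl, wreathType_add E h1 h2])
  rw [eq_of_isConj hf hconj]
  exact apply_ofWreath_finRotate (hi ▸ hp)
    (restrictL_mem hk hf (parity_ofWreath (fun a => g (E (Sum.inr a))) τ)) _

/-- A spin super class function is determined by its values on permutations with odd cycles. -/
theorem spinSuper_eq_zero {n : ℕ} : ∀ {f : BG Γ n → ℂ}, f ∈ spinSuper Γ n →
    (∀ (g : Fin n → Γ) (s : Equiv.Perm (Fin n)), (∀ p, Odd (Function.minimalPeriod s p)) →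
      f (ofWreath g s) = 0) → ∀ x, f x = 0 := by
  induction n using Nat.strong_induction_on with
  | _ n ih =>
  intro f hf h0 x
  rcases Nat.eq_zero_or_pos n with rfl | hn
  · have hx : x = zPow 0 x.left.2.zexp * ofWreath 1 1 := by
      rw [zPow_mul]
      ext1
      · refine Prod.ext (funext fun a => a.elim0) ?_
        ext1
        · exact (add_zero _).symm
        · exact funext fun a => a.elim0
      · exact Equiv.ext fun a => a.elim0
    rw [hx, apply_zPow_mul hf, h0 _ _ fun p => p.elim0, mul_zero]
  · by_cases hpar : parity x = 1
    · exact hf.2.2 x hpar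
    have hpar : parity x = 0 := (zmod_two_cases _).resolve_right hpar
    let p : Fin n := ⟨0, hn⟩
    obtain ⟨i, hi⟩ : ∃ i, Function.minimalPeriod x.right p = i + 1 :=
      ⟨_, (Nat.sub_add_cancel (minimalPeriod_perm_pos x.right p)).symm⟩
    obtain ⟨k, E, τ, hk, -, h1, h2⟩ := exists_cycle_split x.right p hi
    obtain ⟨y, y', hy, hy', hc⟩ := exists_isConj_incl hk E h1 h2
    rw [eq_of_isConj hf hc]
    have hyy : parity y + parity y' = 0 := by
      obtain ⟨c, hc⟩ := isConj_iff.1 hc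
      rw [← hpar, ← parity_conj x c, hc, parity_mul, inclL, inclR, parity_incl, parity_incl]
    rcases zmod_two_cases (parity y) with h | h
    · have hy'0 : parity y' = 0 := by rwa [h, zero_add] at hyy
      -- Both components are even. The first becomes a pure rotation up to a power of z; with it
      -- fixed, f is a spin super class function of the second component, to which the induction
      -- applies if the rotation is odd.
      obtain ⟨c, hc⟩ := exists_ofPi_conj hy h
      have hL := restrictL_mem hk hf hy'0
      have e1 := eq_of_isConj hL hc
      have e2 := apply_zPow_mul hL c (ofWreath y.left.1 (finRotate (i + 1)))
      rw [e1, e2]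
      refine mul_eq_zero_of_right _ ?_
      by_cases ho : Odd (i + 1)
      · refine ih k (by omega) (restrictR_mem hk hf (parity_ofWreath y.left.1 (finRotate (i + 1))))
          (fun g s hs => ?_) y'
        rw [incl_ofWreath]
        refine h0 _ _ (odd_minimalPeriod_incl hk (fun a => ?_) hs)
        rw [minimalPeriod_finRotate]
        exact ho
      · exact apply_ofWreath_finRotate ho hL y.left.1
    · have hy'1 : parity y' = 1 := by
        rw [h] at hyy
        linear_combination hyy - CharTwo.add_self_eq_zero (1 : ZMod 2)
      -- Both components are odd. They anticommute, so conjugating the product by the first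
      -- component multiplies it by z.
      have e1 := hf.1 (inclL hk y * inclR hk y') (inclL hk y)
      have e2 : inclL hk y * (inclL hk y * inclR hk y') * (inclL hk y)⁻¹ =
          zBG n * (inclL hk y * inclR hk y') := by
        have hab := inclL_mul_inclR hk y y'
        rw [h, hy'1, mul_one, zPow_one] at hab
        rw [mul_inv_eq_iff_eq_mul]
        calc inclL hk y * (inclL hk y * inclR hk y')
            = inclL hk y * (zBG n * (inclR hk y' * inclL hk y)) := by rw [hab]
          _ = zBG n * (inclL hk y * inclR hk y') * inclL hk y := by
            rw [← mul_assoc, ← zBG_mul]; simp only [mul_assoc]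
      rw [e2, hf.2.1] at e1
      linear_combination (-1 / 2 : ℂ) * e1

end Vanishing

/-! ### Multiplicative functions of the type. -/

section TypeProd

variable {Γ : Type*} [Group Γ]

theorem prod_telescope (a b : ℕ → Γ) (m : ℕ) :
    ((List.range m).map fun k => a k * b k * (a (k + 1))⁻¹).prod =
      a 0 * ((List.range m).map b).prod * (a m)⁻¹ := by
  induction m with
  | zero => simp
  | succ m ih =>
    rw [List.range_succ, List.map_append, List.prod_append, ih, List.map_append, List.prod_append]
    simp [mul_assoc]

/-- Along a cycle the factors w telescope, and the cycle product is conjugated by the value of w at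
the base point. -/
theorem wreathType_conj {n : ℕ} {g h : Fin n → Γ} {s t r : Equiv.Perm (Fin n)} {w : Fin n → Γ}
    (hr : ∀ a, t (r a) = r (s a)) (hw : ∀ a, h (r a) = w a * g a * (w (s.symm a))⁻¹) :
    wreathType h t = wreathType g s := by
  refine wreathType_eq_of_count (fun c => count_zero_wreathType _ _ _) fun c l => ?_
  rw [mul_count_wreathType, pointCount, pointCount, ← Equiv.sum_comp r]
  refine Finset.sum_congr rfl fun p _ => ?_
  rw [minimalPeriod_semiconj r.injective hr, pointClass_semiconj r.injective hr]
  have : pointClass (h ∘ r) s p = pointClass g s p := by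
    unfold pointClass
    have hk : ∀ k : ℕ, (h ∘ r) ((s ^ k)⁻¹ p) =
        w ((s ^ k)⁻¹ p) * g ((s ^ k)⁻¹ p) * (w ((s ^ (k + 1))⁻¹ p))⁻¹ := fun k => by
      rw [Function.comp_apply, hw]
      congr 3
      rw [pow_succ, mul_inv_rev]
      rfl
    simp only [hk]
    rw [prod_telescope (fun k => w ((s ^ k)⁻¹ p)) (fun k => g ((s ^ k)⁻¹ p)),
      ConjClasses.mk_eq_mk_iff_isConj, isConj_comm, isConj_iff]
    refine ⟨w p, ?_⟩
    have hm : (s ^ Function.minimalPeriod s p)⁻¹ p = p := by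
      rw [Equiv.Perm.inv_eq_iff_eq, pow_minimalPeriod_apply]
    rw [hm]
    simp
  rw [this]

variable [Fintype Γ] {A : Type*} [CommMonoid A]

/-- The product over the cycles of `ρ` of the values of `θ`. -/
noncomputable def typeProd (θ : ℕ → ConjClasses Γ → A) (ρ : ConjClasses Γ → Multiset ℕ) : A :=
  ∏ c, ((ρ c).map fun i => θ i c).prod

theorem typeProd_add (θ : ℕ → ConjClasses Γ → A) (ρ σ : ConjClasses Γ → Multiset ℕ) :
    typeProd θ (ρ + σ) = typeProd θ ρ * typeProd θ σ := by
  simp [typeProd, Finset.prod_mul_distrib]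

theorem typeProd_zero (θ : ℕ → ConjClasses Γ → A) : typeProd θ 0 = 1 := by
  simp [typeProd]

theorem typeProd_oneCycle (θ : ℕ → ConjClasses Γ → A) (c : ConjClasses Γ) (i : ℕ) :
    typeProd θ (oneCycle c i) = θ i c := by
  have : ∀ d, ((oneCycle c i d).map fun j => θ j d).prod = if d = c then θ i c else 1 := fun d => by
    unfold oneCycle
    split_ifs with h
    · simp [h]
    · simp
  simp [typeProd, this]

theorem typeProd_wreathType (θ : ℕ → ConjClasses Γ → A) {n : ℕ} (g : Fin n → Γ)
    (s : Equiv.Perm (Fin n)) :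
    typeProd θ (wreathType g s) = ∏ q : Cycles s, θ (cycleLen q) (cycleClass g q) := by
  rw [typeProd, ← Finset.prod_fiberwise (s := Finset.univ) (g := fun q : Cycles s => cycleClass g q)]
  refine Finset.prod_congr rfl fun c _ => ?_
  rw [wreathType, Multiset.map_map]
  refine Finset.prod_congr (by congr) fun q hq => ?_
  rw [Function.comp_apply, (Finset.mem_filter.1 hq).2]

theorem eta_eq_typeProd (γ : ClassFn Γ) {n : ℕ} (g : Fin n → Γ) (s : Equiv.Perm (Fin n)) :
    eta γ g s = typeProd (fun _ c => γ c) (wreathType g s) :=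
  (typeProd_wreathType (fun _ c => γ c) g s).symm

theorem typeProd_mul (θ φ : ℕ → ConjClasses Γ → A) (ρ : ConjClasses Γ → Multiset ℕ) :
    typeProd (fun i c => θ i c * φ i c) ρ = typeProd θ ρ * typeProd φ ρ := by
  simp [typeProd, Finset.prod_mul_distrib]

theorem typeProd_inv (θ : ℕ → ConjClasses Γ → A) (ρ : ConjClasses Γ → Multiset ℕ) :
    typeProd θ (fun c => ρ (invClass c)) = typeProd (fun i c => θ i (invClass c)) ρ := by
  let e : ConjClasses Γ ≃ ConjClasses Γ :=
    ⟨invClass, invClass, invClass_invClass, invClass_invClass⟩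
  unfold typeProd
  rw [← Equiv.prod_comp e]
  refine Finset.prod_congr rfl fun c _ => ?_
  show ((ρ (invClass (invClass c))).map fun i => θ i (invClass c)).prod = _
  rw [invClass_invClass]

theorem typeSize_wreathType {n : ℕ} (g : Fin n → Γ) (s : Equiv.Perm (Fin n)) :
    typeSize (wreathType g s) = n := by
  have h1 : typeSize (wreathType g s) = ∑ q : Cycles s, cycleLen q := by
    rw [typeSize, ← Finset.sum_fiberwise (s := Finset.univ) (g := fun q : Cycles s => cycleClass g q)]
    refine Finset.sum_congr rfl fun c _ => ?_
    rw [wreathType]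
    exact Finset.sum_congr (by congr) fun q _ => rfl
  rw [h1]
  have h2 := Finset.card_eq_sum_card_fiberwise (s := (Finset.univ : Finset (Fin n)))
    (t := Finset.univ) (f := fun p => (Quotient.mk _ p : Cycles s)) (fun _ _ => Finset.mem_univ _)
  rw [Finset.card_univ, Fintype.card_fin] at h2
  refine Eq.trans ?_ h2.symm
  exact Finset.sum_congr rfl fun q _ => (card_cycle q).symm

end TypeProd

/-! ### Averages as weighted sums over types, and the characteristic map. -/

section Average

variable {Γ : Type*} [Group Γ] [Fintype Γ] {M N : Type*} [AddCommGroup M] [Module ℂ M]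
  [AddCommGroup N] [Module ℂ N]

theorem avgType_congr {n : ℕ} {F G : (ConjClasses Γ → Multiset ℕ) → M}
    (h : ∀ (g : Fin n → Γ) (s : Equiv.Perm (Fin n)), F (wreathType g s) = G (wreathType g s)) :
    avgType n F = avgType n G := by
  unfold avgType
  simp only [h]

theorem map_avgType (L : M →ₗ[ℂ] N) (n : ℕ) (F : (ConjClasses Γ → Multiset ℕ) → M) :
    L (avgType n F) = avgType n fun ρ => L (F ρ) := by
  simp [avgType, map_sum]

theorem avgType_sum {ι : Type*} (s : Finset ι) (n : ℕ)
    (F : ι → (ConjClasses Γ → Multiset ℕ) → M) :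
    ∑ i ∈ s, avgType n (F i) = avgType n fun ρ => ∑ i ∈ s, F i ρ := by
  simp only [avgType, ← Finset.smul_sum]
  congr 1
  rw [Finset.sum_comm]
  refine Finset.sum_congr rfl fun σ _ => ?_
  rw [Finset.sum_comm]

theorem avgType_smul (a : ℂ) (n : ℕ) (F : (ConjClasses Γ → Multiset ℕ) → M) :
    avgType n (fun ρ => a • F ρ) = a • avgType n F :=
  (map_avgType (LinearMap.lsmul ℂ M a) n F).symm

theorem avgType_smul_const (n : ℕ) (F : (ConjClasses Γ → Multiset ℕ) → ℂ) (v : M) :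
    avgType n (fun ρ => F ρ • v) = avgType n F • v :=
  (map_avgType (LinearMap.toSpanSingleton ℂ M v) n F).symm

theorem mem_OP {n : ℕ} {ρ : ConjClasses Γ → Multiset ℕ} :
    ρ ∈ OP Γ n ↔ (∀ c, ∀ i ∈ ρ c, Odd i) ∧ typeSize ρ = n := by
  rw [OP, Set.mem_ofPred_eq]
  unfold typeSize
  exact Iff.rfl

/-- Averages are sums over types, weighted by `Z_ρ⁻¹`. -/
theorem avgType_eq_sum {n : ℕ} {F : (ConjClasses Γ → Multiset ℕ) → M}
    (hF : ∀ ρ c, ∀ i ∈ ρ c, ¬ Odd i → F ρ = 0) :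
    avgType n F = ∑ ρ ∈ (OP_finite Γ n).toFinset, (zRho ρ)⁻¹ • F ρ := by
  have h1 : avgType n F = avgType n fun σ =>
      ∑ ρ ∈ (OP_finite Γ n).toFinset, (if σ = ρ then (1 : ℂ) else 0) • F ρ := by
    refine avgType_congr fun g s => ?_
    simp only [ite_smul, one_smul, zero_smul, Finset.sum_ite_eq]
    split_ifs with h
    · rfl
    · have : ∃ c, ∃ i ∈ wreathType g s c, ¬ Odd i := by
        by_contra hne
        push Not at hne
        exact h ((OP_finite Γ n).mem_toFinset.2 (mem_OP.2 ⟨hne, typeSize_wreathType g s⟩))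
      obtain ⟨c, i, hi, ho⟩ := this
      exact hF _ c i hi ho
  rw [h1, ← avgType_sum]
  refine Finset.sum_congr rfl fun ρ hρ => ?_
  have hρ' := mem_OP.1 ((OP_finite Γ n).mem_toFinset.1 hρ)
  rw [avgType_smul_const, avgType_indicator (fun c h0 => ?_) hρ'.2]
  exact absurd (hρ'.1 c 0 h0) (by decide)

theorem aRho_eq_typeProd (ρ : ConjClasses Γ → Multiset ℕ) : aRho ρ = typeProd aNegClass ρ := rfl

theorem aNegClass_even {i : ℕ} (hi : ¬ Odd i) (c : ConjClasses Γ) : aNegClass i c = 0 := by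
  rw [aNegClass, aNeg, dif_neg hi]

theorem typeProd_eq_zero {A : Type*} [CommSemiring A] {θ : ℕ → ConjClasses Γ → A}
    {ρ : ConjClasses Γ → Multiset ℕ} {c : ConjClasses Γ} {i : ℕ} (hi : i ∈ ρ c) (h : θ i c = 0) :
    typeProd θ ρ = 0 := by
  refine Finset.prod_eq_zero (Finset.mem_univ c) (Multiset.prod_eq_zero ?_)
  exact Multiset.mem_map.2 ⟨i, hi, h⟩

-- The chosen representative has the type of (g, s) because (g, s) itself shows that this type
-- occurs, and elements of equal type are conjugate.
omit [Fintype Γ] in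
theorem valueAt_wreathType {n : ℕ} (f : spinSuper Γ n) (g : Fin n → Γ) (s : Equiv.Perm (Fin n)) :
    valueAt (wreathType g s) f = f.1 (ofWreath g s) := by
  have h : wreathType (wreathRepr n (wreathType g s)).1 (wreathRepr n (wreathType g s)).2 =
      wreathType g s :=
    Classical.epsilon_spec (p := fun x : (Fin n → Γ) × Equiv.Perm (Fin n) =>
      wreathType x.1 x.2 = wreathType g s) ⟨(g, s), rfl⟩
  exact eq_of_isConj f.2 (isConj_ofWreath h)

/-- Elements of type ρ have proportion Z_ρ⁻¹, and types with an even part contribute nothing, since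
a_{-i} is zero for even i. In this form ch is accessible to the recursion. -/
theorem ch_lof {n : ℕ} (f : spinSuper Γ n) :
    ch (DirectSum.lof ℂ ℕ (fun i => spinSuper Γ i) n f) =
      avgType n fun ρ => valueAt ρ f • aRho ρ := by
  rw [avgType_eq_sum fun ρ c i hi ho => ?_]
  · rw [ch, DirectSum.toModule_lof, LinearMap.sum_apply]
    refine Finset.sum_congr rfl fun ρ _ => ?_
    rw [LinearMap.smulRight_apply, smul_comm]
  · rw [aRho_eq_typeProd, typeProd_eq_zero hi (aNegClass_even ho c), smul_zero]

end Average

/-! ### The decomposition of Γ̃_n into Π_n and Γ^n ⋊ S_n. -/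

section WreathSubgroup

variable {Γ : Type*} [Group Γ]

/-- The type of the image of `x` in `Γ^n ⋊ S_n`. -/
noncomputable def elemType {n : ℕ} (x : BG Γ n) : ConjClasses Γ → Multiset ℕ :=
  wreathType x.left.1 x.right

theorem elemType_conj {n : ℕ} (x t : BG Γ n) : elemType (t * x * t⁻¹) = elemType x := by
  refine wreathType_conj (r := t.right) (w := fun a => t.left.1 (t.right a)) (fun a => ?_)
    (fun a => ?_)
  · show t.right (x.right (t.right⁻¹ (t.right a))) = t.right (x.right a)
    simp
  · show t.left.1 (t.right a) * x.left.1 (t.right.symm (t.right a)) *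
      (t⁻¹).left.1 ((t.right * x.right).symm (t.right a)) = _
    have h : (t⁻¹).left.1 ((t.right * x.right).symm (t.right a)) =
        (t.left.1 (t.right ((t.right * x.right).symm (t.right a))))⁻¹ := rfl
    have h2 : (t.right * x.right).symm (t.right a) = x.right.symm a := by
      rw [Equiv.symm_apply_eq]; simp
    rw [h, h2, Equiv.symm_apply_apply]

/-- The subgroup `Γ^n ⋊ S_n` of `Γ̃_n`. -/
def wreathSubgroup (Γ : Type*) [Group Γ] (n : ℕ) : Subgroup (BG Γ n) where
  carrier := {x | x.left.2 = 1}
  one_mem' := rfl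
  mul_mem' {x y} hx hy := by
    show x.left.2 * PiGroup.permuteHom x.right y.left.2 = 1
    rw [show x.left.2 = 1 from hx, show y.left.2 = 1 from hy, map_one, one_mul]
  inv_mem' {x} hx := by
    show PiGroup.permuteHom x.right⁻¹ (x.left.2)⁻¹ = 1
    rw [show x.left.2 = 1 from hx, inv_one, map_one]

theorem mem_wreathSubgroup {n : ℕ} {x : BG Γ n} : x ∈ wreathSubgroup Γ n ↔ x.left.2 = 1 := Iff.rfl

/-- The elements of `Γ^n ⋊ S_n` as pairs. -/
def wreathEquiv (Γ : Type*) [Group Γ] (n : ℕ) :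
    Equiv.Perm (Fin n) × (Fin n → Γ) ≃ wreathSubgroup Γ n where
  toFun p := ⟨ofWreath p.2 p.1, rfl⟩
  invFun x := (x.1.right, x.1.left.1)
  left_inv _ := rfl
  right_inv x := Subtype.ext (SemidirectProduct.ext (Prod.ext rfl x.2.symm) rfl)

theorem eq_ofPi_mul {n : ℕ} (x : BG Γ n) : x = ofPi x.left.2 * ofWreath x.left.1 x.right := by
  refine SemidirectProduct.ext (Prod.ext ?_ ?_) ?_
  · show x.left.1 = 1 * x.left.1
    rw [one_mul]
  · show x.left.2 = x.left.2 * PiGroup.permuteHom 1 1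
    rw [map_one, mul_one]
  · show x.right = 1 * x.right
    rw [one_mul]

/-- The elements of `Γ̃_n` as products of an element of `Π_n` and an element of `Γ^n ⋊ S_n`. -/
def piWreathEquiv (Γ : Type*) [Group Γ] (n : ℕ) : PiGroup n × wreathSubgroup Γ n ≃ BG Γ n where
  toFun p := ofPi p.1 * p.2.1
  invFun x := (x.left.2, ⟨ofWreath x.left.1 x.right, rfl⟩)
  left_inv p := by
    have h2 : p.2.1.left.2 = 1 := p.2.2
    refine Prod.ext ?_ (Subtype.ext (SemidirectProduct.ext (Prod.ext ?_ ?_) ?_))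
    · show p.1 * PiGroup.permuteHom 1 p.2.1.left.2 = p.1
      rw [h2, map_one, mul_one]
    · show 1 * p.2.1.left.1 = p.2.1.left.1
      rw [one_mul]
    · exact h2.symm
    · show 1 * p.2.1.right = p.2.1.right
      rw [one_mul]
  right_inv x := (eq_ofPi_mul x).symm

theorem card_piGroup (n : ℕ) : Fintype.card (PiGroup n) = 2 ^ (n + 1) := by
  rw [← Finset.card_univ, Finset.card_eq_sum_ones, sum_piGroup]
  simp [pow_succ]

variable [Fintype Γ]

noncomputable instance (n : ℕ) : Fintype (wreathSubgroup Γ n) := Fintype.ofFinite _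

theorem sum_wreathSubgroup {M : Type*} [AddCommMonoid M] {n : ℕ} (F : BG Γ n → M) :
    ∑ w : wreathSubgroup Γ n, F w =
      ∑ s : Equiv.Perm (Fin n), ∑ g : Fin n → Γ, F (ofWreath g s) := by
  rw [← Equiv.sum_comp (wreathEquiv Γ n) fun w => F w, Fintype.sum_prod_type]
  rfl

theorem card_wreathSubgroup (n : ℕ) :
    Fintype.card (wreathSubgroup Γ n) = Fintype.card Γ ^ n * n.factorial := by
  rw [← Fintype.card_congr (wreathEquiv Γ n), Fintype.card_prod, Fintype.card_perm, Fintype.card_fun,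
    Fintype.card_fin, mul_comm]

theorem card_wreathSubgroup_ne_zero (n : ℕ) : (Fintype.card (wreathSubgroup Γ n) : ℂ) ≠ 0 :=
  Nat.cast_ne_zero.2 Fintype.card_ne_zero

theorem sum_BG {M : Type*} [AddCommMonoid M] {n : ℕ} (F : BG Γ n → M) :
    ∑ x, F x = ∑ b : PiGroup n, ∑ w : wreathSubgroup Γ n, F (ofPi b * w.1) := by
  rw [← Equiv.sum_comp (piWreathEquiv Γ n) F, Fintype.sum_prod_type]
  rfl

theorem card_BG (n : ℕ) : Nat.card (BG Γ n) = 2 ^ (n + 1) * Fintype.card (wreathSubgroup Γ n) := by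
  rw [← Nat.card_congr (piWreathEquiv Γ n), Nat.card_prod, Nat.card_eq_fintype_card,
    Nat.card_eq_fintype_card, card_piGroup]

theorem avgType_eq_sum_wreathSubgroup {M : Type*} [AddCommGroup M] [Module ℂ M] (n : ℕ)
    (F : (ConjClasses Γ → Multiset ℕ) → M) :
    avgType n F = (Fintype.card (wreathSubgroup Γ n) : ℂ)⁻¹ •
      ∑ w : wreathSubgroup Γ n, F (elemType w.1) := by
  rw [sum_wreathSubgroup fun w => F (elemType w), card_wreathSubgroup, avgType]
  push_cast
  rfl

omit [Fintype Γ] in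
theorem elemType_inv {n : ℕ} (x : BG Γ n) :
    elemType x⁻¹ = fun c => elemType x (invClass c) := wreathType_inv x.left.1 x.right

theorem avgType_inv {M : Type*} [AddCommGroup M] [Module ℂ M] (n : ℕ)
    (F : (ConjClasses Γ → Multiset ℕ) → M) :
    avgType n (fun ρ => F fun c => ρ (invClass c)) = avgType n F := by
  rw [avgType_eq_sum_wreathSubgroup, avgType_eq_sum_wreathSubgroup,
    ← Equiv.sum_comp (Equiv.inv (wreathSubgroup Γ n)) fun w : wreathSubgroup Γ n => F (elemType w.1)]
  congr 1
  refine Finset.sum_congr rfl fun w _ => ?_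
  rw [Equiv.inv_apply, Subgroup.coe_inv, elemType_inv]

omit [Fintype Γ] in
theorem elemType_incl {n k m : ℕ} (h : n + k = m) (x : BG Γ n) (y : BG Γ k) :
    elemType (inclL h x * inclR h y) = elemType x + elemType y := by
  refine Eq.trans ?_ (wreathType_incl h x.left.1 x.right y.left.1 y.right)
  rw [elemType, inclL_mul_inclR_left]
  rfl

omit [Fintype Γ] in
theorem incl_mem_wreathSubgroup {n k m : ℕ} (h : n + k = m) {x : BG Γ n} {y : BG Γ k}
    (hx : x ∈ wreathSubgroup Γ n) (hy : y ∈ wreathSubgroup Γ k) :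
    inclL h x * inclR h y ∈ wreathSubgroup Γ m := by
  rw [mem_wreathSubgroup, inclL_mul_inclR_left]
  show PiGroup.incl (firstEmb h) x.left.2 * PiGroup.incl (lastEmb h) y.left.2 = 1
  rw [mem_wreathSubgroup.1 hx, mem_wreathSubgroup.1 hy, map_one, map_one, one_mul]

omit [Fintype Γ] in
theorem eq_ofWreath {n : ℕ} {x : BG Γ n} (hx : x ∈ wreathSubgroup Γ n) :
    x = ofWreath x.left.1 x.right := SemidirectProduct.ext (Prod.ext rfl hx) rfl

omit [Fintype Γ] in
theorem parity_eq_zero {n : ℕ} {x : BG Γ n} (hx : x ∈ wreathSubgroup Γ n) : parity x = 0 := by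
  rw [eq_ofWreath hx, parity_ofWreath]

omit [Fintype Γ] in
theorem valueAt_elemType {n : ℕ} (f : spinSuper Γ n) {x : BG Γ n} (hx : x ∈ wreathSubgroup Γ n) :
    valueAt (elemType x) f = f.1 x := by
  rw [elemType, valueAt_wreathType, ← eq_ofWreath hx]

omit [Fintype Γ] in
theorem ofPi_mul {n : ℕ} (b : PiGroup n) {w : BG Γ n} (hw : w ∈ wreathSubgroup Γ n) :
    ofPi b * w = ⟨(w.left.1, b), w.right⟩ := by
  refine SemidirectProduct.ext (Prod.ext ?_ ?_) ?_
  · show 1 * w.left.1 = w.left.1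
    rw [one_mul]
  · show b * PiGroup.permuteHom 1 w.left.2 = b
    rw [mem_wreathSubgroup.1 hw, map_one, mul_one]
  · show 1 * w.right = w.right
    rw [one_mul]

omit [Fintype Γ] in
theorem comp_inv_mem {n : ℕ} {f : BG Γ n → ℂ} (hf : f ∈ spinSuper Γ n) :
    (fun x => f x⁻¹) ∈ spinSuper Γ n := by
  refine ⟨fun x y => ?_, fun x => ?_, fun x hx => hf.2.2 _ (by rw [parity_inv_eq, hx])⟩
  · have : (y * x * y⁻¹)⁻¹ = y * x⁻¹ * y⁻¹ := by group
    show f _ = f _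
    rw [this, hf.1]
  · have hz : (zBG n : BG Γ n)⁻¹ = zBG n := inv_eq_of_mul_eq_one_left zBG_mul_zBG
    show f _ = - f _
    rw [mul_inv_rev, hz, ← zBG_mul, hf.2.1]

end WreathSubgroup

/-! ### The operator H_n(γ) in terms of types. -/

section Restriction

variable {Γ : Type*} [Group Γ] [Fintype Γ]

/-- For a fixed wreath component the sum over Π_n collapses by `sum_basicChar_mul`; its value
2^{n+1} cancels against |Γ̃_n| = 2^{n+1} |Γ^n ⋊ S_n|. -/
theorem weightedForm_chi (ξ γ : ClassFn Γ) {n : ℕ} {G : BG Γ n → ℂ} (hG : G ∈ spinSuper Γ n) :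
    weightedForm ξ (chi γ n) G = (Fintype.card (wreathSubgroup Γ n) : ℂ)⁻¹ *
      ∑ w : wreathSubgroup Γ n,
        typeProd (fun _ c => ξ c * γ c) (elemType w.1) * G (w.1)⁻¹ := by
  have hG' := comp_inv_mem hG
  rw [weightedForm, sum_BG, Finset.sum_comm, card_BG]
  have h : ∀ w : wreathSubgroup Γ n, ∑ b : PiGroup n, eta ξ (ofPi b * w.1).left.1
      (ofPi b * w.1).right * chi γ n (ofPi b * w.1) * G (ofPi b * w.1)⁻¹ =
      2 ^ (n + 1) * (typeProd (fun _ c => ξ c * γ c) (elemType w.1) * G (w.1)⁻¹) := fun w => by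
    have hb := sum_basicChar_mul w.1.right (fun b => G (ofPi b * w.1)⁻¹) (fun k u => ?_)
      (fun a b => ?_)
    · rw [map_one, one_mul] at hb
      rw [typeProd_mul, elemType, ← eta_eq_typeProd, ← eta_eq_typeProd, mul_left_comm, ← hb,
        Finset.mul_sum]
      refine Finset.sum_congr rfl fun b _ => ?_
      rw [ofPi_mul b w.2, chi]
      ring
    · have : ofPi ⟨k, u⟩ * w.1 = zPow n k * (ofPi ⟨0, u⟩ * w.1) := by
        rw [ofPi_mul _ w.2, ofPi_mul _ w.2, zPow_mul, add_zero]
      rw [this]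
      exact apply_zPow_mul hG' k _
    · have : ofPi (b * a * (PiGroup.permuteHom w.1.right b)⁻¹) * w.1 =
          ofPi b * (ofPi a * w.1) * (ofPi b)⁻¹ := by
        rw [ofPi_conj, ofPi_mul _ w.2, ofPi_mul _ w.2]
      rw [this]
      exact hG'.1 _ _
  rw [Finset.sum_congr rfl fun w _ => h w, ← Finset.mul_sum, ← mul_assoc]
  congr 1
  push_cast
  rw [mul_inv, mul_right_comm, inv_mul_cancel₀ (pow_ne_zero _ two_ne_zero), one_mul]

/-- The weight of a cycle in `⟨χ_n(γ), Res f⟩_ξ`. -/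
noncomputable def cycleWeight (ξ γ : ClassFn Γ) (i : ℕ) (c : ConjClasses Γ) : ℂ :=
  if Odd i then ξ (invClass c) * γ (invClass c) else 0

theorem typeProd_congr {A : Type*} [CommMonoid A] {θ φ : ℕ → ConjClasses Γ → A}
    {ρ : ConjClasses Γ → Multiset ℕ} (h : ∀ c, ∀ i ∈ ρ c, θ i c = φ i c) :
    typeProd θ ρ = typeProd φ ρ :=
  Finset.prod_congr rfl fun c _ => congrArg _ (Multiset.map_congr rfl (h c))

omit [Fintype Γ] in
theorem apply_eq_zero_of_not_odd {n : ℕ} (f : spinSuper Γ n) {x : BG Γ n}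
    (hx : x ∈ wreathSubgroup Γ n) {c : ConjClasses Γ} {i : ℕ} (hi : i ∈ elemType x c)
    (ho : ¬ Odd i) : f.1 x = 0 := by
  rw [elemType, wreathType] at hi
  obtain ⟨q, -, rfl⟩ := Multiset.mem_map.1 hi
  rw [eq_ofWreath hx]
  exact apply_ofWreath_of_even f.2 _ ho

/-- The pairing evaluates f at inverses. Replacing w by w⁻¹ transfers the inversion to the weight,
which is why `cycleWeight` evaluates ξ and γ at the inverse class. -/
theorem valueAt_resChi (ξ γ : ClassFn Γ) {n k m : ℕ} (h : n + k = m) (f : spinSuper Γ m)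
    {y : BG Γ k} (hy : y ∈ wreathSubgroup Γ k) :
    valueAt (elemType y) (resChi ξ γ h f) =
      avgType n fun ρ => typeProd (cycleWeight ξ γ) ρ * valueAt (ρ + elemType y) f := by
  rw [valueAt_elemType _ hy]
  refine (weightedForm_chi ξ γ (restrictL_mem h f.2 (parity_eq_zero hy))).trans ?_
  have h1 := avgType_inv n fun ρ : ConjClasses Γ → Multiset ℕ =>
    typeProd (fun _ c => ξ c * γ c) (fun c => ρ (invClass c)) * valueAt (ρ + elemType y) f
  -- As f vanishes on elements with an even cycle, the weights of even parts can be replaced by 0.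
  have h2 : avgType n (fun ρ => typeProd (cycleWeight ξ γ) ρ * valueAt (ρ + elemType y) f) =
      avgType n fun ρ => typeProd (fun _ c => ξ c * γ c) (fun c => ρ (invClass c)) *
        valueAt (ρ + elemType y) f := by
    rw [avgType_eq_sum_wreathSubgroup, avgType_eq_sum_wreathSubgroup]
    congr 1
    refine Finset.sum_congr rfl fun w _ => ?_
    rw [typeProd_inv]
    by_cases ho : ∀ c, ∀ i ∈ elemType w.1 c, Odd i
    · congr 1
      exact typeProd_congr fun c i hi => if_pos (ho c i hi)
    · push Not at ho
      obtain ⟨c, i, hi, ho⟩ := ho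
      rw [← elemType_incl h, valueAt_elemType _ (incl_mem_wreathSubgroup h w.2 hy),
        apply_eq_zero_of_not_odd f (incl_mem_wreathSubgroup h w.2 hy) (c := c) (i := i) ?_ ?_,
        mul_zero, mul_zero]
      · rw [elemType_incl]
        exact Multiset.mem_add.2 (Or.inl hi)
      · exact ho
  rw [h2, ← h1, avgType_eq_sum_wreathSubgroup, smul_eq_mul]
  congr 1
  refine Finset.sum_congr rfl fun w _ => ?_
  simp only [invClass_invClass]
  rw [← elemType_inv, ← elemType_incl h, valueAt_elemType _ (incl_mem_wreathSubgroup h (inv_mem w.2) hy)]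

end Restriction

/-! ### The operator H_{-n}(γ) under the characteristic map. -/

section Induction

variable {Γ : Type*} [Group Γ]

theorem ofPi_eq_incl {n k m : ℕ} (h : n + k = m) (b : PiGroup m) :
    (ofPi b : BG Γ m) = inclL h (ofPi ⟨b.zexp, fun a => b.supp (firstEmb h a)⟩) *
      inclR h (ofPi ⟨0, fun a => b.supp (lastEmb h a)⟩) := by
  ext1
  · rw [inclL_mul_inclR_left]
    refine Prod.ext ?_ ?_
    · exact ((map_one (vecIncl (Γ := Γ) (firstEmb h))).symm ▸ (map_one (vecIncl (Γ := Γ)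
        (lastEmb h))).symm ▸ (one_mul (1 : Fin m → Γ)).symm :
        (1 : Fin m → Γ) = vecIncl (firstEmb h) 1 * vecIncl (lastEmb h) 1)
    · ext1
      · show b.zexp = b.zexp + 0 + PiGroup.cocycle
          (Function.extend (firstEmb h) (fun a => b.supp (firstEmb h a)) 0)
          (Function.extend (lastEmb h) (fun a => b.supp (lastEmb h a)) 0)
        rw [cocycle_first_last, add_zero, add_zero]
      · funext j
        show b.supp j =
          Function.extend (firstEmb h) (fun a => b.supp (firstEmb h a)) 0 j +
          Function.extend (lastEmb h) (fun a => b.supp (lastEmb h a)) 0 j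
        rcases exists_first_or_last h j with ⟨a, rfl⟩ | ⟨b, rfl⟩
        · rw [extend_first_first, extend_last_first]; exact (add_zero _).symm
        · rw [extend_first_last, extend_last_last]; exact (zero_add _).symm
  · show (1 : Equiv.Perm (Fin m)) = Equiv.Perm.viaEmbeddingHom (firstEmb h).toEmbedding 1 *
      Equiv.Perm.viaEmbeddingHom (lastEmb h).toEmbedding 1
    rw [map_one, map_one, one_mul]

/-- Since the spin product contains all of Π_m, sums over Γ̃_m in the induction formula can be
reduced to sums over Γ^m ⋊ S_m. -/
theorem ofPi_mem_spinProd {n k m : ℕ} (h : n + k = m) (b : PiGroup m) :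
    (ofPi b : BG Γ m) ∈ spinProd Γ h := by
  rw [ofPi_eq_incl h]
  exact inclL_mul_inclR_mem h _ _

/-- An element of `Γ̃_n ×̂ Γ̃_k` in `Γ^m ⋊ S_m` is a product of elements of `Γ^n ⋊ S_n` and
`Γ^k ⋊ S_k`. -/
theorem exists_incl_of_mem {n k m : ℕ} (h : n + k = m) {w : BG Γ m} (hw : w ∈ spinProd Γ h)
    (hw' : w ∈ wreathSubgroup Γ m) :
    ∃ (x : wreathSubgroup Γ n) (y : wreathSubgroup Γ k), w = inclL h x.1 * inclR h y.1 := by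
  obtain ⟨x, y, rfl⟩ := exists_of_mem_spinProd h hw
  have hm : ∀ {l : ℕ} (u : BG Γ l), ofWreath u.left.1 u.right ∈ wreathSubgroup Γ l := fun _ => rfl
  refine ⟨⟨_, hm x⟩, ⟨_, hm y⟩, SemidirectProduct.ext (Prod.ext ?_ ?_) rfl⟩
  · rw [inclL_mul_inclR_left, inclL_mul_inclR_left]
    rfl
  · exact hw'.trans (mem_wreathSubgroup.1 (incl_mem_wreathSubgroup h (hm x) (hm y))).symm

/-- The only nontrivial coincidence in the spin product comes from (z, z), which does not lie in the
wreath subgroups. -/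
theorem incl_injective {n k m : ℕ} (h : n + k = m) :
    Function.Injective fun p : wreathSubgroup Γ n × wreathSubgroup Γ k =>
      inclL h p.1.1 * inclR h p.2.1 := by
  intro p q hpq
  obtain ⟨c, h1, h2⟩ := inclL_mul_inclR_eq h hpq
  have hc : c = 0 := by
    have h3 := congrArg (fun x => x.left.2.zexp) h1
    rw [zPow_mul] at h3
    simp only [mem_wreathSubgroup.1 p.1.2, mem_wreathSubgroup.1 q.1.2] at h3
    simpa using h3.symm
  subst hc
  rw [zPow_zero, one_mul] at h1 h2
  exact Prod.ext (Subtype.ext h1.symm) (Subtype.ext h2.symm)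

theorem chi_ofPi_conj (γ : ClassFn Γ) {n : ℕ} (b : PiGroup n) (x : BG Γ n) :
    chi γ n (ofPi b * x * (ofPi b)⁻¹) = chi γ n x := by
  rw [ofPi_conj, chi, chi, basicChar_conj]

/-- The extension by zero of `χ_n(γ) ⊗ f`. -/
noncomputable def tensorExt (γ : ClassFn Γ) {n k m : ℕ} (h : n + k = m) (f : BG Γ k → ℂ)
    (x : BG Γ m) : ℂ :=
  if hx : x ∈ spinProd Γ h then outerTensor h (chi γ n) f ⟨x, hx⟩ else 0

theorem tensorExt_incl (γ : ClassFn Γ) {n k m : ℕ} (h : n + k = m) {f : BG Γ k → ℂ}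
    (hf : f ∈ spinSuper Γ k) (x : BG Γ n) (y : BG Γ k) :
    tensorExt γ h f (inclL h x * inclR h y) = chi γ n x * f y := by
  rw [tensorExt, dif_pos (inclL_mul_inclR_mem h x y)]
  exact outerTensor_apply h (chi_spin γ) hf.2.1 _ x y rfl

/-- Write b = u v with u and v in the two factors. Wreath components are even, so they commute with
the opposite factor, and conjugation acts on each side separately; there `basicChar_conj` and the
class property of f apply. -/
theorem tensorExt_ofPi_conj (γ : ClassFn Γ) {n k m : ℕ} (h : n + k = m) {f : BG Γ k → ℂ}
    (hf : f ∈ spinSuper Γ k) (b : PiGroup m) {w : BG Γ m} (hw : w ∈ wreathSubgroup Γ m) :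
    tensorExt γ h f (ofPi b * w * (ofPi b)⁻¹) = tensorExt γ h f w := by
  have hb := ofPi_mem_spinProd (Γ := Γ) h b
  by_cases hwm : w ∈ spinProd Γ h
  · obtain ⟨x, y, rfl⟩ := exists_incl_of_mem h hwm hw
    rw [ofPi_eq_incl h b]
    set u : BG Γ n := ofPi ⟨b.zexp, fun a => b.supp (firstEmb h a)⟩ with hu
    set v : BG Γ k := ofPi ⟨0, fun a => b.supp (lastEmb h a)⟩
    have hx := parity_eq_zero x.2
    have hy := parity_eq_zero y.2
    have h1 : inclL h u * inclR h v * (inclL h x.1 * inclR h y.1) * (inclL h u * inclR h v)⁻¹ =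
        inclL h (u * x.1 * u⁻¹) * inclR h (v * y.1 * v⁻¹) := by
      have c1 : inclL h x.1 * inclR h v = inclR h v * inclL h x.1 :=
        incl_comm h (by rw [hx, zero_mul])
      have c2 : inclL h u⁻¹ * inclR h (v * y.1 * v⁻¹) = inclR h (v * y.1 * v⁻¹) * inclL h u⁻¹ :=
        incl_comm h (by rw [parity_conj, hy, mul_zero])
      calc _ = inclL h u * (inclR h v * inclL h x.1) * inclR h y.1 * (inclR h v)⁻¹ *
            (inclL h u)⁻¹ := by group
        _ = inclL h u * inclL h x.1 * (inclR h (v * y.1 * v⁻¹) * inclL h u⁻¹) := by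
          rw [← c1]; simp only [map_mul, map_inv, mul_assoc]
        _ = _ := by rw [← c2]; simp only [map_mul, mul_assoc]
    rw [h1, tensorExt_incl γ h hf, tensorExt_incl γ h hf, hf.1, hu, chi_ofPi_conj]
  · have : ofPi b * w * (ofPi b)⁻¹ ∉ spinProd Γ h := fun hh => hwm <| by
      have := mul_mem (mul_mem (inv_mem hb) hh) hb
      simpa [mul_assoc] using this
    rw [tensorExt, tensorExt, dif_neg hwm, dif_neg this]

variable [Fintype Γ]

theorem sum_tensorExt (γ : ClassFn Γ) {n k m : ℕ} (h : n + k = m) {f : BG Γ k → ℂ}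
    (hf : f ∈ spinSuper Γ k) {M : Type*} [AddCommGroup M] [Module ℂ M] (K : BG Γ m → M) :
    ∑ w : wreathSubgroup Γ m, tensorExt γ h f w.1 • K w.1 =
      ∑ x : wreathSubgroup Γ n, ∑ y : wreathSubgroup Γ k,
        (chi γ n x.1 * f y.1) • K (inclL h x.1 * inclR h y.1) := by
  rw [← Fintype.sum_prod_type (f := fun p : wreathSubgroup Γ n × wreathSubgroup Γ k =>
    (chi γ n p.1.1 * f p.2.1) • K (inclL h p.1.1 * inclR h p.2.1))]
  symm
  refine Finset.sum_of_injOn (fun p => ⟨inclL h p.1.1 * inclR h p.2.1,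
    incl_mem_wreathSubgroup h p.1.2 p.2.2⟩) ?_ (fun _ _ => Finset.mem_univ _) ?_ ?_
  · intro p _ q _ hpq
    exact incl_injective h (congrArg Subtype.val hpq)
  · intro w _ hw
    rw [tensorExt, dif_neg, zero_smul]
    intro hwm
    obtain ⟨x, y, hxy⟩ := exists_incl_of_mem h hwm w.2
    exact hw ⟨(x, y), Finset.mem_coe.2 (Finset.mem_univ _), Subtype.ext hxy.symm⟩
  · intro p _
    rw [tensorExt_incl γ h hf]

/-- Each element is uniquely a product of one in Π_m, one in Γ^n ⋊ S_n and one in Γ^k ⋊ S_k. -/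
theorem card_spinProd {n k m : ℕ} (h : n + k = m) : Nat.card (spinProd Γ h) =
    2 ^ (m + 1) * (Fintype.card (wreathSubgroup Γ n) * Fintype.card (wreathSubgroup Γ k)) := by
  have hm : ∀ p : PiGroup m × wreathSubgroup Γ n × wreathSubgroup Γ k,
      ofPi p.1 * (inclL h p.2.1.1 * inclR h p.2.2.1) ∈ spinProd Γ h := fun p =>
    mul_mem (ofPi_mem_spinProd h _) (inclL_mul_inclR_mem h _ _)
  have e : PiGroup m × wreathSubgroup Γ n × wreathSubgroup Γ k ≃ spinProd Γ h := by
    refine Equiv.ofBijective (fun p => ⟨_, hm p⟩) ⟨fun p q hpq => ?_, fun w => ?_⟩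
    · have h1 := (piWreathEquiv Γ m).injective (a₁ := (p.1, ⟨_, incl_mem_wreathSubgroup h p.2.1.2 p.2.2.2⟩))
        (a₂ := (q.1, ⟨_, incl_mem_wreathSubgroup h q.2.1.2 q.2.2.2⟩)) (congrArg Subtype.val hpq)
      rw [Prod.mk.injEq] at h1
      exact Prod.ext h1.1 (incl_injective h (congrArg Subtype.val h1.2))
    · obtain ⟨x, y, hxy⟩ := exists_incl_of_mem h (w := ofWreath w.1.left.1 w.1.right)
        (by
          have := mul_mem (inv_mem (ofPi_mem_spinProd (Γ := Γ) h w.1.left.2)) w.2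
          rwa [eq_ofPi_mul w.1, ← mul_assoc, ← eq_ofPi_mul w.1, inv_mul_cancel, one_mul] at this) rfl
      refine ⟨(w.1.left.2, x, y), Subtype.ext ?_⟩
      show ofPi w.1.left.2 * (inclL h x.1 * inclR h y.1) = w.1
      rw [← hxy, ← eq_ofPi_mul]
  rw [← Nat.card_congr e, Nat.card_prod, Nat.card_prod, Nat.card_eq_fintype_card,
    Nat.card_eq_fintype_card, Nat.card_eq_fintype_card, card_piGroup]

/-- Conjugation by Π_m does not change the summand, so the sum over Γ̃_m has 2^{m+1} equal parts;
the order of the spin product contains the same factor. -/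
theorem indChi_apply (γ : ClassFn Γ) {n k m : ℕ} (h : n + k = m) (f : spinSuper Γ k)
    {w : BG Γ m} (hw : w ∈ wreathSubgroup Γ m) :
    (indChi γ h f).1 w =
      ((Fintype.card (wreathSubgroup Γ n) : ℂ) * Fintype.card (wreathSubgroup Γ k))⁻¹ *
        ∑ t : wreathSubgroup Γ m, tensorExt γ h f.1 (t.1 * w * (t.1)⁻¹) := by
  have h1 : (indChi γ h f).1 w = (Nat.card (spinProd Γ h) : ℂ)⁻¹ *
      ∑ y : BG Γ m, tensorExt γ h f.1 (y⁻¹ * w * y) := rfl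
  rw [h1, ← Equiv.sum_comp (Equiv.inv (BG Γ m)), sum_BG, card_spinProd]
  have h2 : ∀ (b : PiGroup m) (t : wreathSubgroup Γ m),
      tensorExt γ h f.1 ((Equiv.inv (BG Γ m) (ofPi b * t.1))⁻¹ * w * Equiv.inv (BG Γ m) (ofPi b * t.1)) =
        tensorExt γ h f.1 (t.1 * w * (t.1)⁻¹) := fun b t => by
    rw [← tensorExt_ofPi_conj γ h f.2 b (mul_mem (mul_mem t.2 hw) (inv_mem t.2)), Equiv.inv_apply,
      inv_inv, mul_inv_rev]
    simp only [mul_assoc]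
  simp only [h2]
  rw [Finset.sum_const, Finset.card_univ, card_piGroup, nsmul_eq_mul, ← mul_assoc]
  congr 1
  push_cast
  rw [mul_inv, mul_right_comm, inv_mul_cancel₀ (pow_ne_zero _ two_ne_zero), one_mul]

/-- Frobenius reciprocity against the class function x ↦ K(type of x): conjugation is absorbed into
the outer sum, and types add on the spin product. -/
theorem avgType_indChi (γ : ClassFn Γ) {n k m : ℕ} (h : n + k = m) (f : spinSuper Γ k)
    {M : Type*} [AddCommGroup M] [Module ℂ M] (K : (ConjClasses Γ → Multiset ℕ) → M) :
    (avgType m fun ρ => valueAt ρ (indChi γ h f) • K ρ) =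
      ((Fintype.card (wreathSubgroup Γ n) : ℂ) * Fintype.card (wreathSubgroup Γ k))⁻¹ •
        ∑ x : wreathSubgroup Γ n, ∑ y : wreathSubgroup Γ k,
          (chi γ n x.1 * f.1 y.1) • K (elemType x.1 + elemType y.1) := by
  have h1 : ∀ t : wreathSubgroup Γ m,
      ∑ w : wreathSubgroup Γ m, tensorExt γ h f.1 (t.1 * w.1 * (t.1)⁻¹) • K (elemType w.1) =
        ∑ w : wreathSubgroup Γ m, tensorExt γ h f.1 w.1 • K (elemType w.1) := fun t => by
    rw [← Equiv.sum_comp (MulAut.conj t).toEquiv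
      fun w : wreathSubgroup Γ m => tensorExt γ h f.1 w.1 • K (elemType w.1)]
    refine Finset.sum_congr rfl fun w _ => ?_
    show _ = tensorExt γ h f.1 (t.1 * w.1 * (t.1)⁻¹) • K (elemType (t.1 * w.1 * (t.1)⁻¹))
    rw [elemType_conj]
  rw [avgType_eq_sum_wreathSubgroup]
  simp only [valueAt_elemType _ (Subtype.prop _), indChi_apply γ h f (Subtype.prop _), mul_smul,
    Finset.sum_smul]
  rw [← Finset.smul_sum, smul_comm, Finset.sum_comm, Finset.sum_congr rfl fun t _ => h1 t, Finset.sum_const,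
    sum_tensorExt γ h f.2 fun w => K (elemType w), Finset.card_univ,
    ← Nat.cast_smul_eq_nsmul ℂ, inv_smul_smul₀ (card_wreathSubgroup_ne_zero m)]
  simp only [elemType_incl, mul_smul]

theorem typeProd_const (z : ℂ) {n : ℕ} (x : BG Γ n) :
    typeProd (fun _ _ => z) (elemType x) = z ^ Fintype.card (Cycles x.right) := by
  rw [elemType, typeProd_wreathType, Finset.prod_const, Finset.card_univ]

/-- On types with odd parts, χ_n contributes a factor 2 for each cycle. On all others the Fock
monomial is zero, so the value of χ_n is irrelevant. -/
theorem chi_smul_aRho (γ : ClassFn Γ) {n : ℕ} {x : BG Γ n} (hx : x ∈ wreathSubgroup Γ n) :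
    chi γ n x • aRho (elemType x) =
      typeProd (fun i c => (2 * γ c) • aNegClass i c) (elemType x) := by
  by_cases ho : ∀ c, ∀ i ∈ elemType x c, Odd i
  · have hs : ∀ p, Odd (Function.minimalPeriod x.right p) := fun p => by
      have hq : cycleLen (Quotient.mk _ p : Cycles x.right) ∈
          elemType x (cycleClass x.left.1 (Quotient.mk _ p : Cycles x.right)) := by
        rw [elemType, wreathType]
        exact Multiset.mem_map_of_mem cycleLen (by simp)
      have := ho _ _ hq
      rwa [cycleLen_eq rfl] at this
    have h1 : chi γ n x = typeProd (fun _ c => 2 * γ c) (elemType x) := by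
      rw [typeProd_mul (fun _ _ => (2 : ℂ)), typeProd_const, ← basicChar_one_eq hs, elemType,
        ← eta_eq_typeProd, chi, mem_wreathSubgroup.1 hx, mul_comm]
    have h2 : algebraMap ℂ (Fock Γ) (typeProd (fun _ c => 2 * γ c) (elemType x)) =
        typeProd (fun _ c => algebraMap ℂ (Fock Γ) (2 * γ c)) (elemType x) := by
      unfold typeProd
      rw [map_prod]
      refine Finset.prod_congr rfl fun c _ => ?_
      rw [map_multiset_prod, Multiset.map_map]
      rfl
    rw [h1, Algebra.smul_def, h2, aRho_eq_typeProd, ← typeProd_mul]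
    simp only [Algebra.smul_def]
  · push Not at ho
    obtain ⟨c, i, hi, ho⟩ := ho
    rw [aRho_eq_typeProd, typeProd_eq_zero hi (aNegClass_even ho c), smul_zero,
      typeProd_eq_zero hi (by rw [aNegClass_even ho c, smul_zero])]

/-- The image of `χ_n(γ)` under the characteristic map. -/
noncomputable def chImage (γ : ClassFn Γ) (n : ℕ) : Fock Γ :=
  avgType n (typeProd fun i c => (2 * γ c) • aNegClass i c)

/-- After reciprocity the Fock monomial of a sum of types factors, and so does the double average.
-/
theorem ch_lof_indChi (γ : ClassFn Γ) {n k m : ℕ} (h : n + k = m) (f : spinSuper Γ k) :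
    ch (DirectSum.lof ℂ ℕ (fun i => spinSuper Γ i) m (indChi γ h f)) =
      chImage γ n * ch (DirectSum.lof ℂ ℕ (fun i => spinSuper Γ i) k f) := by
  rw [ch_lof, avgType_indChi, ch_lof, chImage, avgType_eq_sum_wreathSubgroup,
    avgType_eq_sum_wreathSubgroup, smul_mul_smul_comm, mul_inv, Finset.sum_mul_sum]
  congr 1
  refine Finset.sum_congr rfl fun x _ => Finset.sum_congr rfl fun y _ => ?_
  rw [← chi_smul_aRho γ x.2, valueAt_elemType f y.2, smul_mul_smul_comm, aRho_eq_typeProd,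
    typeProd_add]
  rfl

theorem ch_HNeg (γ : ClassFn Γ) (n : ℕ) (v : RTotal Γ) :
    ch (HNeg γ n v) = chImage γ n * ch v := by
  have : ch ∘ₗ HNeg γ n = LinearMap.mulLeft ℂ (chImage γ n) ∘ₗ (ch (Γ := Γ)) := by
    refine DirectSum.linearMap_ext ℂ fun k => LinearMap.ext fun f => ?_
    rw [LinearMap.comp_apply, LinearMap.comp_apply, LinearMap.comp_apply, LinearMap.comp_apply, HNeg,
      DirectSum.toModule_lof]
    exact ch_lof_indChi γ rfl f
  exact DFunLike.congr_fun this v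

end Induction

/-! ### Newton's identity and derivations on the Fock space. -/

section FockSide

variable {Γ : Type*} [Group Γ] [Fintype Γ]

theorem aNeg_eq_sum (n : ℕ) (γ : ClassFn Γ) :
    aNeg n γ = ∑ c, (zeta c)⁻¹ • γ c • aNegClass n c := by
  unfold aNegClass aNeg
  split_ifs with h
  · have h1 : γ = ∑ c, (zeta c)⁻¹ • γ c • (Pi.single c (zeta c) : ClassFn Γ) := by
      refine funext fun d => ?_
      rw [Finset.sum_apply, Finset.sum_eq_single d]
      · simp only [Pi.smul_apply, Pi.single_eq_same, smul_eq_mul]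
        have := zeta_ne_zero d
        field_simp
      · intro c _ hc
        simp [Pi.single_eq_of_ne hc.symm]
      · simp
    conv_lhs => rw [h1]
    have h2 : ∀ β : ClassFn Γ, SymmetricAlgebra.ι ℂ ({n : ℕ // Odd n} →₀ ClassFn Γ)
        (Finsupp.single ⟨n, h⟩ β) = (SymmetricAlgebra.ι ℂ ({n : ℕ // Odd n} →₀ ClassFn Γ) ∘ₗ
          Finsupp.lsingle ⟨n, h⟩) β := fun β => rfl
    simp only [h2, map_sum, map_smul]
  · simp

theorem chImage_zero (γ : ClassFn Γ) : chImage γ 0 = 1 := by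
  rw [chImage, avgType_zero, typeProd_zero]

/-- The averaged function is multiplicative, so the split-off cycle factors out; summing it over
classes reassembles 2 a_{-(i+1)}(γ) by `aNeg_eq_sum`. -/
theorem chImage_succ (γ : ClassFn Γ) (n : ℕ) :
    ((n + 1 : ℕ) : ℂ) • chImage γ (n + 1) =
      ∑ x ∈ Finset.HasAntidiagonal.antidiagonal n, ((2 : ℂ) • aNeg (x.1 + 1) γ) * chImage γ x.2 := by
  rw [chImage, avgType_succ]
  refine Finset.sum_congr rfl fun x _ => ?_
  rw [aNeg_eq_sum, Finset.smul_sum, Finset.sum_mul]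
  refine Finset.sum_congr rfl fun c _ => ?_
  simp only [typeProd_add, typeProd_oneCycle]
  have := map_avgType (LinearMap.mulLeft ℂ ((2 * γ c) • aNegClass (x.1 + 1) c)) x.2
    (typeProd fun i c => (2 * γ c) • aNegClass i c)
  simp only [LinearMap.mulLeft_apply] at this
  rw [← this, chImage, smul_comm (2 : ℂ), ← mul_smul (2 : ℂ)]
  simp only [smul_mul_assoc]

/-- `∑_ρ Z_ρ⁻¹ F(ρ) a'_{-ρ}`, over the types of size `m`. -/
noncomputable def fockOf (m : ℕ) (F : (ConjClasses Γ → Multiset ℕ) → ℂ) : Fock Γ :=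
  avgType m fun ρ => F ρ • aRho ρ

theorem fockOf_zero (F : (ConjClasses Γ → Multiset ℕ) → ℂ) :
    fockOf 0 F = algebraMap ℂ (Fock Γ) (F 0) := by
  rw [fockOf, avgType_zero, aRho_eq_typeProd, typeProd_zero, Algebra.algebraMap_eq_smul_one]

theorem fockOf_smul (a : ℂ) (m : ℕ) (F : (ConjClasses Γ → Multiset ℕ) → ℂ) :
    fockOf m (fun ρ => a * F ρ) = a • fockOf m F := by
  unfold fockOf
  rw [← avgType_smul]
  simp only [mul_smul]

theorem fockOf_sum {ι : Type*} (s : Finset ι) (m : ℕ)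
    (F : ι → (ConjClasses Γ → Multiset ℕ) → ℂ) :
    fockOf m (fun ρ => ∑ i ∈ s, F i ρ) = ∑ i ∈ s, fockOf m (F i) := by
  unfold fockOf
  rw [avgType_sum]
  simp only [Finset.sum_smul]

theorem fockOf_succ (m : ℕ) (F : (ConjClasses Γ → Multiset ℕ) → ℂ) :
    ((m + 1 : ℕ) : ℂ) • fockOf (m + 1) F =
      ∑ x ∈ Finset.HasAntidiagonal.antidiagonal m, ∑ c, (zeta c)⁻¹ •
        (aNegClass (x.1 + 1) c * fockOf x.2 fun ρ => F (oneCycle c (x.1 + 1) + ρ)) := by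
  rw [fockOf, avgType_succ]
  refine Finset.sum_congr rfl fun x _ => Finset.sum_congr rfl fun c _ => ?_
  have := map_avgType (LinearMap.mulLeft ℂ (aNegClass (x.1 + 1) c)) x.2
    fun ρ => F (oneCycle c (x.1 + 1) + ρ) • aRho ρ
  simp only [LinearMap.mulLeft_apply, mul_smul_comm] at this
  rw [fockOf, this]
  simp only [aRho_eq_typeProd, typeProd_add, typeProd_oneCycle]

/-- The second argument is evaluated at x⁻¹, so only x in the inverse class counts; the factor ζ_c
cancels the size of the class against |Γ|. -/
theorem classForm_single (ξ γ : ClassFn Γ) (c : ConjClasses Γ) :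
    classForm ξ γ (Pi.single c (zeta c)) = ξ (invClass c) * γ (invClass c) := by
  show (Fintype.card Γ : ℂ)⁻¹ * ∑ x : Γ, ξ (ConjClasses.mk x) * γ (ConjClasses.mk x) *
    (Pi.single c (zeta c) : ClassFn Γ) (ConjClasses.mk x⁻¹) = _
  rw [← Equiv.sum_comp (Equiv.inv Γ)]
  have h := sum_mk fun d : ConjClasses Γ => ξ (invClass d) * γ (invClass d) *
    (Pi.single c (zeta c) : ClassFn Γ) d
  simp only [Equiv.inv_apply, inv_inv, ← invClass_mk]
  rw [h, Finset.sum_eq_single c, smul_eq_mul, inv_mul_cancel_left₀, Pi.single_eq_same, smul_eq_mul]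
  · have := zeta_ne_zero c
    field_simp
  · exact Nat.cast_ne_zero.2 Fintype.card_ne_zero
  · intro d _ hd
    simp [Pi.single_eq_of_ne hd]
  · simp

/-- The derivation `2 a_i(γ)`. -/
noncomputable def twicePos (ξ γ : ClassFn Γ) (i : ℕ) : Module.End ℂ (Fock Γ) :=
  (2 : ℂ) • aPos ξ γ i

theorem twicePos_mul (ξ γ : ClassFn Γ) (i : ℕ) (v w : Fock Γ) :
    twicePos ξ γ i (v * w) = v * twicePos ξ γ i w + w * twicePos ξ γ i v := by
  simp only [twicePos, LinearMap.smul_apply, aPos_mul, smul_add, mul_smul_comm]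

theorem aPos_algebraMap (ξ γ : ClassFn Γ) (i : ℕ) (a : ℂ) :
    aPos ξ γ i (algebraMap ℂ (Fock Γ) a) = 0 := by
  show (aPosLift ξ γ i (algebraMap ℂ (Fock Γ) a)).snd = 0
  rw [AlgHom.commutes]
  rfl

theorem twicePos_algebraMap (ξ γ : ClassFn Γ) (i : ℕ) (a : ℂ) :
    twicePos ξ γ i (algebraMap ℂ (Fock Γ) a) = 0 := by
  rw [twicePos, LinearMap.smul_apply, aPos_algebraMap, smul_zero]

theorem aPos_even (ξ γ : ClassFn Γ) {i : ℕ} (hi : ¬ Odd i) : aPos ξ γ i = 0 := by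
  have h : aPosLift ξ γ i = TrivSqZeroExt.inlAlgHom ℂ (Fock Γ) (Fock Γ) := by
    refine SymmetricAlgebra.algHom_ext (LinearMap.ext fun w => ?_)
    simp [aPosLift, contraction, dif_neg hi]
  refine LinearMap.ext fun v => ?_
  show (aPosLift ξ γ i v).snd = 0
  rw [h]
  rfl

theorem twicePos_aNegClass (ξ γ : ClassFn Γ) (i j : ℕ) (c : ConjClasses Γ) :
    twicePos ξ γ i (aNegClass j c) =
      algebraMap ℂ (Fock Γ) (if i = j then (i : ℂ) * cycleWeight ξ γ i c else 0) := by
  rw [twicePos, LinearMap.smul_apply]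
  by_cases hi : Odd i
  · by_cases hj : Odd j
    · rw [aNegClass, aPos_aNeg ξ γ _ hi hj, classForm_single, cycleWeight, if_pos hi,
        Algebra.smul_def, ← map_mul]
      congr 1
      split_ifs
      · ring
      · ring
    · rw [aNegClass_even hj, map_zero, smul_zero, if_neg (by rintro rfl; exact hj hi), map_zero]
  · rw [aPos_even ξ γ hi, cycleWeight, if_neg hi]
    simp

theorem sum_antidiagonal_shift {M : Type*} [AddCommMonoid M] (m i : ℕ) (g : ℕ → ℕ → M) :
    ∑ x ∈ Finset.HasAntidiagonal.antidiagonal m, (if i ≤ x.2 then g x.1 (x.2 - i) else 0) =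
      if i ≤ m then ∑ x ∈ Finset.HasAntidiagonal.antidiagonal (m - i), g x.1 x.2 else 0 := by
  rw [Finset.Nat.sum_antidiagonal_eq_sum_range_succ fun a b => if i ≤ b then g a (b - i) else 0,
    Finset.Nat.sum_antidiagonal_eq_sum_range_succ g]
  split_ifs with h
  · rw [← Finset.sum_subset (Finset.range_subset_range.2 (by omega : m - i + 1 ≤ m + 1))]
    · refine Finset.sum_congr rfl fun k hk => ?_
      have := Finset.mem_range.1 hk
      rw [if_pos (by omega)]
      congr 1
      omega
    · intro k hk' hk
      rw [Finset.mem_range] at hk hk'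
      exact if_neg (by omega)
  · refine Finset.sum_eq_zero fun k _ => if_neg (by omega)

/-- By strong induction on m through `fockOf_succ` and the Leibniz rule. The derivation hits either
the split-off cycle, which must then have length i, or the rest, where the induction hypothesis
applies. These cases contribute the right side i and m - i times respectively, and the total m
cancels. -/
theorem twicePos_fockOf (ξ γ : ClassFn Γ) (i : ℕ) (hi : 0 < i) (m : ℕ) :
    ∀ F : (ConjClasses Γ → Multiset ℕ) → ℂ, twicePos ξ γ i (fockOf m F) =
      if i ≤ m then ∑ c, ((zeta c)⁻¹ * cycleWeight ξ γ i c) •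
        fockOf (m - i) (fun ρ => F (oneCycle c i + ρ)) else 0 := by
  induction m using Nat.strong_induction_on with
  | _ m ih =>
  intro F
  rcases m with _ | m
  · rw [fockOf_zero, twicePos_algebraMap, if_neg (by omega)]
  have hm : ((m + 1 : ℕ) : ℂ) ≠ 0 := Nat.cast_ne_zero.2 (Nat.succ_ne_zero m)
  refine smul_right_injective _ hm ?_
  show ((m + 1 : ℕ) : ℂ) • _ = ((m + 1 : ℕ) : ℂ) • _
  rw [← map_smul, fockOf_succ, map_sum]
  have h1 : ∀ x ∈ Finset.HasAntidiagonal.antidiagonal m, twicePos ξ γ i (∑ c, (zeta c)⁻¹ •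
        (aNegClass (x.1 + 1) c * fockOf x.2 fun ρ => F (oneCycle c (x.1 + 1) + ρ))) =
      (if i = x.1 + 1 then (i : ℂ) • ∑ c, ((zeta c)⁻¹ * cycleWeight ξ γ i c) •
        fockOf x.2 (fun ρ => F (oneCycle c i + ρ)) else 0) +
      if i ≤ x.2 then ∑ c, ∑ d, ((zeta d)⁻¹ * cycleWeight ξ γ i d) • (zeta c)⁻¹ •
        (aNegClass (x.1 + 1) c * fockOf (x.2 - i) fun ρ =>
          F (oneCycle d i + (oneCycle c (x.1 + 1) + ρ))) else 0 := fun x hx => by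
    have hx' : x.2 < m + 1 := by
      have := Finset.HasAntidiagonal.mem_antidiagonal.1 hx
      omega
    rw [map_sum]
    simp only [map_smul, twicePos_mul, twicePos_aNegClass, ih x.2 hx', smul_add]
    rw [Finset.sum_add_distrib, add_comm]
    congr 1
    · split_ifs with h
      · rw [Finset.smul_sum]
        refine Finset.sum_congr rfl fun c _ => ?_
        rw [mul_comm, ← Algebra.smul_def, ← h, smul_smul, smul_smul]
        congr 1
        ring
      · simp
    · split_ifs with h
      · refine Finset.sum_congr rfl fun c _ => ?_
        rw [Finset.mul_sum, Finset.smul_sum]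
        refine Finset.sum_congr rfl fun d _ => ?_
        rw [mul_smul_comm, smul_comm]
        simp only [add_left_comm]
      · simp
  rw [Finset.sum_congr rfl h1, Finset.sum_add_distrib,
    sum_antidiagonal_shift m i fun a b => ∑ c, ∑ d, ((zeta d)⁻¹ * cycleWeight ξ γ i d) •
      (zeta c)⁻¹ • (aNegClass (a + 1) c * fockOf b fun ρ =>
          F (oneCycle d i + (oneCycle c (a + 1) + ρ)))]
  obtain ⟨i, rfl⟩ : ∃ j, i = j + 1 := ⟨i - 1, by omega⟩
  -- Only the split-off cycle of the length being removed survives; in the shifted indexing it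
  -- contributes i + 1 copies.
  have h2 : ∑ x ∈ Finset.HasAntidiagonal.antidiagonal m,
      (if i + 1 = x.1 + 1 then ((i + 1 : ℕ) : ℂ) • ∑ c, ((zeta c)⁻¹ * cycleWeight ξ γ (i + 1) c) •
        fockOf x.2 (fun ρ => F (oneCycle c (i + 1) + ρ)) else 0) =
      if i + 1 ≤ m + 1 then ((i + 1 : ℕ) : ℂ) • ∑ c, ((zeta c)⁻¹ * cycleWeight ξ γ (i + 1) c) •
        fockOf (m + 1 - (i + 1)) (fun ρ => F (oneCycle c (i + 1) + ρ)) else 0 := by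
    split_ifs with h
    · rw [Finset.sum_eq_single (i, m - i)]
      · rw [if_pos rfl, Nat.add_sub_add_right]
      · rintro ⟨a, b⟩ hx hne
        rw [Finset.HasAntidiagonal.mem_antidiagonal] at hx
        refine if_neg fun h' => hne ?_
        simp only at hx h'
        exact Prod.ext (by simp; omega) (by simp; omega)
      · intro hh
        exact absurd (Finset.HasAntidiagonal.mem_antidiagonal.2 (by simp; omega)) hh
    · refine Finset.sum_eq_zero fun x hx => if_neg fun h' => ?_
      have := Finset.HasAntidiagonal.mem_antidiagonal.1 hx
      omega
  rw [h2]
  -- Here `fockOf_succ` is read backwards: with the removed cycle d held fixed, the sum over the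
  -- split-off cycle c yields m - i copies.
  have h3 : (if i + 1 ≤ m then ∑ x ∈ Finset.HasAntidiagonal.antidiagonal (m - (i + 1)),
      ∑ c, ∑ d, ((zeta d)⁻¹ * cycleWeight ξ γ (i + 1) d) •
      (zeta c)⁻¹ • (aNegClass (x.1 + 1) c * fockOf x.2 fun ρ =>
          F (oneCycle d (i + 1) + (oneCycle c (x.1 + 1) + ρ))) else 0) =
      if i + 1 ≤ m + 1 then ((m - i : ℕ) : ℂ) • ∑ d, ((zeta d)⁻¹ * cycleWeight ξ γ (i + 1) d) •
        fockOf (m + 1 - (i + 1)) (fun ρ => F (oneCycle d (i + 1) + ρ)) else 0 := by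
    split_ifs with h h' h'
    · have e : m + 1 - (i + 1) = m - (i + 1) + 1 := by omega
      have e' : m - i = m - (i + 1) + 1 := by omega
      rw [e, e', Finset.smul_sum]
      simp only [smul_comm (((m - (i + 1) + 1 : ℕ) : ℂ)), fockOf_succ]
      simp only [Finset.smul_sum]
      conv_rhs => rw [Finset.sum_comm]
      refine Finset.sum_congr rfl fun x _ => ?_
      rw [Finset.sum_comm]
    · omega
    · have : m - i = 0 := by omega
      rw [this]; simp
    · rfl
  rw [h3]
  split_ifs with h
  · rw [← add_smul]
    congr 1
    rw [← Nat.cast_add]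
    congr 1
    omega
  · simp

end FockSide

/-! ### The substitution of -z. -/

section NegArg

variable {V : Type*} [AddCommMonoid V] [Module ℂ V]

theorem coeff_negArg (A : PowerSeries (Module.End ℂ V)) (n : ℕ) :
    PowerSeries.coeff n (negArg A) = ((-1 : ℂ) ^ n) • PowerSeries.coeff n A :=
  PowerSeries.coeff_mk _ _

end NegArg

/-! ### Formal exponentials and their logarithmic derivative. -/

section Exponential

variable {V W : Type*} [AddCommGroup V] [Module ℂ V] [AddCommGroup W] [Module ℂ W]

/-- The Euler operator `z d/dz` on formal power series. -/
noncomputable def euler (A : PowerSeries (Module.End ℂ V)) : PowerSeries (Module.End ℂ V) :=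
  PowerSeries.mk fun n => (n : ℂ) • PowerSeries.coeff n A

theorem coeff_euler (A : PowerSeries (Module.End ℂ V)) (n : ℕ) :
    PowerSeries.coeff n (euler A) = (n : ℂ) • PowerSeries.coeff n A := PowerSeries.coeff_mk _ _

theorem euler_mul (A B : PowerSeries (Module.End ℂ V)) :
    euler (A * B) = euler A * B + A * euler B := by
  ext1 n
  rw [coeff_euler, map_add, PowerSeries.coeff_mul, PowerSeries.coeff_mul, PowerSeries.coeff_mul,
    Finset.smul_sum, ← Finset.sum_add_distrib]
  refine Finset.sum_congr rfl fun x hx => ?_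
  rw [coeff_euler, coeff_euler, smul_mul_assoc, mul_smul_comm, ← add_smul,
    ← Finset.HasAntidiagonal.mem_antidiagonal.1 hx]
  push_cast
  rfl

theorem commute_euler {A : PowerSeries (Module.End ℂ V)}
    (hc : ∀ i j, Commute (PowerSeries.coeff i A) (PowerSeries.coeff j A)) :
    A * euler A = euler A * A := by
  ext1 n
  rw [PowerSeries.coeff_mul, PowerSeries.coeff_mul, ← Finset.Nat.sum_antidiagonal_swap]
  refine Finset.sum_congr rfl fun x _ => ?_
  rw [coeff_euler, coeff_euler, smul_mul_assoc, mul_smul_comm]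
  exact congrArg _ (hc _ _).eq

theorem euler_pow_succ {A : PowerSeries (Module.End ℂ V)}
    (hc : ∀ i j, Commute (PowerSeries.coeff i A) (PowerSeries.coeff j A)) (m : ℕ) :
    euler (A ^ (m + 1)) = (m + 1) • (euler A * A ^ m) := by
  induction m with
  | zero => simp
  | succ m ih =>
    rw [pow_succ', euler_mul, ih, mul_smul_comm, ← mul_assoc, commute_euler hc, mul_assoc,
      ← pow_succ', succ_nsmul' _ (m + 1)]

theorem coeff_pow_eq_zero {A : PowerSeries (Module.End ℂ V)} (h0 : PowerSeries.coeff 0 A = 0)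
    (m : ℕ) : ∀ n < m, PowerSeries.coeff n (A ^ m) = 0 := by
  induction m with
  | zero => intro n hn; omega
  | succ m ih =>
    intro n hn
    rw [pow_succ', PowerSeries.coeff_mul]
    refine Finset.sum_eq_zero fun x hx => ?_
    have hx' := Finset.HasAntidiagonal.mem_antidiagonal.1 hx
    rcases Nat.eq_zero_or_pos x.1 with h | h
    · rw [h, h0, zero_mul]
    · rw [ih x.2 (by omega), mul_zero]

/-- Without constant term, A^m begins in degree m; the cutoff of the exponential sum can therefore
be enlarged, and one cutoff can serve several coefficients. -/
theorem coeff_seriesExp {A : PowerSeries (Module.End ℂ V)} (h0 : PowerSeries.coeff 0 A = 0)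
    {n N : ℕ} (hN : n < N) : PowerSeries.coeff n (seriesExp A) =
      ∑ m ∈ Finset.range N, ((m.factorial : ℂ)⁻¹) • PowerSeries.coeff n (A ^ m) := by
  rw [seriesExp, PowerSeries.coeff_mk]
  refine Finset.sum_subset (Finset.range_subset_range.2 hN) fun m _ hm => ?_
  rw [Finset.mem_range] at hm
  rw [coeff_pow_eq_zero h0 m n (by omega), smul_zero]

theorem coeff_zero_seriesExp (A : PowerSeries (Module.End ℂ V)) :
    PowerSeries.coeff 0 (seriesExp A) = 1 := by
  rw [seriesExp, PowerSeries.coeff_mk]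
  simp

/-- This is the coefficientwise form of z d/dz exp(A) = (z dA/dz) exp(A); commuting coefficients are
needed to differentiate the powers A^m. -/
theorem coeff_succ_seriesExp {A : PowerSeries (Module.End ℂ V)} (h0 : PowerSeries.coeff 0 A = 0)
    (hc : ∀ i j, Commute (PowerSeries.coeff i A) (PowerSeries.coeff j A)) (n : ℕ) :
    ((n + 1 : ℕ) : ℂ) • PowerSeries.coeff (n + 1) (seriesExp A) =
      ∑ x ∈ Finset.HasAntidiagonal.antidiagonal n,
        (((x.1 + 1 : ℕ) : ℂ) • PowerSeries.coeff (x.1 + 1) A) *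
          PowerSeries.coeff x.2 (seriesExp A) := by
  have h1 : ∀ m : ℕ, ((n + 1 : ℕ) : ℂ) • (((m + 1).factorial : ℂ)⁻¹ •
      PowerSeries.coeff (n + 1) (A ^ (m + 1))) = (m.factorial : ℂ)⁻¹ •
        ∑ x ∈ Finset.HasAntidiagonal.antidiagonal n,
        (((x.1 + 1 : ℕ) : ℂ) • PowerSeries.coeff (x.1 + 1) A) *
          PowerSeries.coeff x.2 (A ^ m) := fun m => by
    rw [smul_comm, ← coeff_euler, euler_pow_succ hc, map_nsmul, ← Nat.cast_smul_eq_nsmul ℂ,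
      smul_smul, PowerSeries.coeff_mul, Finset.Nat.sum_antidiagonal_succ, coeff_euler]
    simp only [coeff_euler]
    rw [Nat.cast_zero, zero_smul, zero_mul, zero_add, Nat.factorial_succ]
    congr 1
    have := Nat.factorial_ne_zero m
    push_cast
    field_simp
  have h2 : ∀ x ∈ Finset.HasAntidiagonal.antidiagonal n,
      (((x.1 + 1 : ℕ) : ℂ) • PowerSeries.coeff (x.1 + 1) A) * PowerSeries.coeff x.2 (seriesExp A) =
      ∑ m ∈ Finset.range (n + 1), (m.factorial : ℂ)⁻¹ •
        ((((x.1 + 1 : ℕ) : ℂ) • PowerSeries.coeff (x.1 + 1) A) *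
          PowerSeries.coeff x.2 (A ^ m)) := fun x hx => by
    have hx' := Finset.HasAntidiagonal.mem_antidiagonal.1 hx
    rw [coeff_seriesExp h0 (by omega : x.2 < n + 1), Finset.mul_sum]
    simp only [mul_smul_comm]
  rw [Finset.sum_congr rfl h2, Finset.sum_comm, coeff_seriesExp h0 (Nat.lt_succ_self (n + 1)),
    Finset.sum_range_succ', smul_add, Finset.smul_sum]
  simp only [h1, Finset.smul_sum]
  rw [pow_zero, PowerSeries.coeff_one, if_neg (Nat.succ_ne_zero n), smul_zero, smul_zero, add_zero]

/-- The exponential is determined by its logarithmic derivative. -/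
theorem eq_coeff_seriesExp {A : PowerSeries (Module.End ℂ V)} (h0 : PowerSeries.coeff 0 A = 0)
    (hc : ∀ i j, Commute (PowerSeries.coeff i A) (PowerSeries.coeff j A))
    {B : ℕ → Module.End ℂ V} (hB0 : B 0 = 1)
    (hB : ∀ n, ((n + 1 : ℕ) : ℂ) • B (n + 1) =
      ∑ x ∈ Finset.HasAntidiagonal.antidiagonal n,
        (((x.1 + 1 : ℕ) : ℂ) • PowerSeries.coeff (x.1 + 1) A) * B x.2) (n : ℕ) :
    B n = PowerSeries.coeff n (seriesExp A) := by
  induction n using Nat.strong_induction_on with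
  | _ n ih =>
  rcases n with _ | n
  · rw [hB0, coeff_zero_seriesExp]
  · refine smul_right_injective _ (Nat.cast_ne_zero.2 (Nat.succ_ne_zero n) : ((n + 1 : ℕ) : ℂ) ≠ 0) ?_
    show ((n + 1 : ℕ) : ℂ) • _ = ((n + 1 : ℕ) : ℂ) • _
    rw [hB, coeff_succ_seriesExp h0 hc]
    refine Finset.sum_congr rfl fun x hx => ?_
    rw [ih x.2 (by have := Finset.HasAntidiagonal.mem_antidiagonal.1 hx; omega)]

/-- The signed coefficients satisfy the recursion of the exponential of A(-z), because (-1)^{n+1}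
splits as (-1)^{i+1} (-1)^j when i + j = n. -/
theorem negArg_seriesExp {A : PowerSeries (Module.End ℂ V)} (h0 : PowerSeries.coeff 0 A = 0)
    (hc : ∀ i j, Commute (PowerSeries.coeff i A) (PowerSeries.coeff j A)) :
    negArg (seriesExp A) = seriesExp (negArg A) := by
  ext1 n
  rw [coeff_negArg]
  refine eq_coeff_seriesExp (B := fun n => ((-1 : ℂ) ^ n) • PowerSeries.coeff n (seriesExp A))
    ?_ (fun i j => ?_) ?_ (fun n => ?_) n
  · rw [coeff_negArg, h0, smul_zero]
  · rw [coeff_negArg, coeff_negArg]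
    exact ((hc i j).smul_left _).smul_right _
  · rw [coeff_zero_seriesExp, pow_zero, one_smul]
  · rw [smul_comm, coeff_succ_seriesExp h0 hc, Finset.smul_sum]
    refine Finset.sum_congr rfl fun x hx => ?_
    rw [coeff_negArg, smul_comm _ ((-1 : ℂ) ^ (x.1 + 1)), smul_mul_smul_comm, ← pow_add,
      ← Finset.HasAntidiagonal.mem_antidiagonal.1 hx]
    congr 2
    omega

end Exponential

/-! ### Conjugation of operator series by a linear isomorphism. -/

section Transport

variable {V W : Type*} [AddCommMonoid V] [Module ℂ V] [AddCommMonoid W] [Module ℂ W]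

theorem coeff_transport (φ : V ≃ₗ[ℂ] W) (A : PowerSeries (Module.End ℂ V)) (n : ℕ) :
    PowerSeries.coeff n (transport φ A) = φ.conj (PowerSeries.coeff n A) := PowerSeries.coeff_mk _ _

theorem transport_negArg (φ : V ≃ₗ[ℂ] W) (A : PowerSeries (Module.End ℂ V)) :
    transport φ (negArg A) = negArg (transport φ A) := by
  ext1 n
  rw [coeff_transport, coeff_negArg, coeff_negArg, coeff_transport, map_smul]

theorem coeff_tensorId (L : Type*) [AddCommMonoid L] [Module ℂ L] (A : PowerSeries (Module.End ℂ V))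
    (n : ℕ) : PowerSeries.coeff n (tensorId L A) = LinearMap.rTensor L (PowerSeries.coeff n A) :=
  PowerSeries.coeff_mk _ _

theorem congr_conj_rTensor (L : Type*) [AddCommMonoid L] [Module ℂ L] (φ : V ≃ₗ[ℂ] W)
    (f : Module.End ℂ V) : (TensorProduct.congr φ (LinearEquiv.refl ℂ L)).conj
      (LinearMap.rTensor L f) = LinearMap.rTensor L (φ.conj f) := by
  refine TensorProduct.ext' fun v l => ?_
  simp [LinearEquiv.conj_apply_apply]

theorem congr_conj_lTensor (L : Type*) [AddCommMonoid L] [Module ℂ L] (φ : V ≃ₗ[ℂ] W)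
    (f : Module.End ℂ L) : (TensorProduct.congr φ (LinearEquiv.refl ℂ L)).conj
      (LinearMap.lTensor V f) = LinearMap.lTensor W f := by
  refine TensorProduct.ext' fun v l => ?_
  simp [LinearEquiv.conj_apply_apply]

theorem transport_tensorId (L : Type*) [AddCommMonoid L] [Module ℂ L] (φ : V ≃ₗ[ℂ] W)
    (A : PowerSeries (Module.End ℂ V)) :
    transport (TensorProduct.congr φ (LinearEquiv.refl ℂ L)) (tensorId L A) =
      tensorId L (transport φ A) := by
  ext1 n
  rw [coeff_transport, coeff_tensorId, coeff_tensorId, coeff_transport, congr_conj_rTensor]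

theorem IsLocallyFinite.tensorId (L : Type*) [AddCommMonoid L] [Module ℂ L]
    {A : PowerSeries (Module.End ℂ V)} (hA : IsLocallyFinite A) :
    IsLocallyFinite (tensorId L A) := by
  intro t
  induction t using TensorProduct.induction_on with
  | zero => simp
  | tmul v l =>
    refine (hA v).subset fun n hn h0 => hn ?_
    rw [coeff_tensorId, LinearMap.rTensor_tmul, h0, TensorProduct.zero_tmul]
  | add s t hs ht =>
    refine (hs.union ht).subset fun n hn => ?_
    by_contra hne
    rw [Set.mem_union, not_or] at hne
    simp only [Set.mem_ofPred_eq, not_not] at hne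
    exact hn (by rw [map_add, hne.1, hne.2, add_zero])

theorem IsLocallyFinite.transport (φ : V ≃ₗ[ℂ] W) {A : PowerSeries (Module.End ℂ V)}
    (hA : IsLocallyFinite A) : IsLocallyFinite (transport φ A) := by
  intro w
  refine (hA (φ.symm w)).subset fun n hn h0 => hn ?_
  rw [coeff_transport, LinearEquiv.conj_apply_apply, h0, map_zero]

/-- Local finiteness passes through φ, so neither product takes its default value 0; an additive
isomorphism commutes with the remaining finite-support sum termwise. -/
theorem conj_mulCoeff (φ : V ≃ₗ[ℂ] W) (A : PowerSeries (Module.End ℂ V))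
    {B : PowerSeries (Module.End ℂ V)} (hB : IsLocallyFinite B) (k : ℤ) :
    φ.conj (mulCoeff A B k) = mulCoeff (transport φ A) (transport φ B) k := by
  refine LinearMap.ext fun w => ?_
  rw [LinearEquiv.conj_apply_apply, mulCoeff, dif_pos hB, mulCoeff, dif_pos (hB.transport φ)]
  refine (AddEquiv.map_finsum φ.toAddEquiv _).trans (finsum_congr fun j => ?_)
  show φ _ = _
  split_ifs with h
  · simp [coeff_transport, LinearEquiv.conj_apply_apply]
  · simp

end Transport

/-! ### The two exponentials on the Fock space. -/

section Annihilation

variable {Γ : Type*} [Group Γ] [Fintype Γ]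

omit [Fintype Γ] in
theorem creation_coeff_zero (γ : ClassFn Γ) : PowerSeries.coeff 0 (creationSeries γ) = 0 := by
  rw [creationSeries, PowerSeries.coeff_mk, if_neg (by decide)]

omit [Fintype Γ] in
theorem creation_commute (γ : ClassFn Γ) (i j : ℕ) :
    Commute (PowerSeries.coeff i (creationSeries γ)) (PowerSeries.coeff j (creationSeries γ)) := by
  have h : ∀ v w : Fock Γ, Commute (LinearMap.mulLeft ℂ v) (LinearMap.mulLeft ℂ w) := fun v w =>
    LinearMap.ext fun u => mul_left_comm v w u
  simp only [creationSeries, PowerSeries.coeff_mk]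
  split_ifs
  · exact ((h _ _).smul_left _).smul_right _
  · exact Commute.zero_right _
  · exact Commute.zero_left _
  · exact Commute.zero_left _

omit [Fintype Γ] in
theorem smul_coeff_creation (γ : ClassFn Γ) (i : ℕ) :
    ((i + 1 : ℕ) : ℂ) • PowerSeries.coeff (i + 1) (creationSeries γ) =
      LinearMap.mulLeft ℂ ((2 : ℂ) • aNeg (i + 1) γ) := by
  rw [creationSeries, PowerSeries.coeff_mk]
  have hi : ((i + 1 : ℕ) : ℂ) ≠ 0 := Nat.cast_ne_zero.2 (Nat.succ_ne_zero i)
  refine LinearMap.ext fun v => ?_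
  split_ifs with h
  · simp only [LinearMap.smul_apply, LinearMap.mulLeft_apply, smul_smul, smul_mul_assoc]
    rw [mul_div_cancel₀ _ hi]
  · rw [aNeg, dif_neg h]
    simp

/-- Newton's identity `chImage_succ` is the logarithmic-derivative recursion with (i+1) A_{i+1}
equal to multiplication by 2 a_{-(i+1)}(γ). -/
theorem mulLeft_chImage (γ : ClassFn Γ) (n : ℕ) :
    LinearMap.mulLeft ℂ (chImage γ n) = PowerSeries.coeff n (seriesExp (creationSeries γ)) := by
  refine eq_coeff_seriesExp (B := fun n => LinearMap.mulLeft ℂ (chImage γ n))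
    (creation_coeff_zero γ) (creation_commute γ) ?_ (fun n => ?_) n
  · rw [chImage_zero]
    exact LinearMap.mulLeft_one ℂ (Fock Γ)
  · refine LinearMap.ext fun v => ?_
    rw [LinearMap.smul_apply, LinearMap.mulLeft_apply, ← smul_mul_assoc, chImage_succ,
      Finset.sum_mul, LinearMap.sum_apply]
    refine Finset.sum_congr rfl fun x _ => ?_
    rw [smul_coeff_creation, mul_assoc]
    rfl

theorem aPos_ι (ξ γ : ClassFn Γ) (n : ℕ) (w : {n : ℕ // Odd n} →₀ ClassFn Γ) :
    aPos ξ γ n (SymmetricAlgebra.ι ℂ _ w) = algebraMap ℂ (Fock Γ) (contraction ξ γ n w) := by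
  show (aPosLift ξ γ n (SymmetricAlgebra.ι ℂ _ w)).snd = _
  rw [aPosLift, SymmetricAlgebra.lift_ι_apply, Algebra.algebraMap_eq_smul_one]
  simp

/-- Each derivation sends generators to scalars, so both composites vanish on generators; on
products the mixed Leibniz terms are symmetric. -/
theorem aPos_commute (ξ γ β : ClassFn Γ) (i j : ℕ) : Commute (aPos ξ γ i) (aPos ξ β j) := by
  refine LinearMap.ext fun v => ?_
  show aPos ξ γ i (aPos ξ β j v) = aPos ξ β j (aPos ξ γ i v)
  induction v using SymmetricAlgebra.induction with
  | algebraMap a => simp only [aPos_algebraMap, map_zero]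
  | ι w => simp only [aPos_ι, aPos_algebraMap]
  | mul v w hv hw =>
    simp only [aPos_mul, map_add, hv, hw]
    ring
  | add v w hv hw => simp only [map_add, hv, hw]

theorem annihilation_coeff_zero (ξ γ : ClassFn Γ) :
    PowerSeries.coeff 0 (annihilationSeries ξ γ) = 0 := by
  rw [annihilationSeries, PowerSeries.coeff_mk, if_neg (by decide)]

theorem annihilation_commute (ξ γ : ClassFn Γ) (i j : ℕ) :
    Commute (PowerSeries.coeff i (annihilationSeries ξ γ))
      (PowerSeries.coeff j (annihilationSeries ξ γ)) := by
  simp only [annihilationSeries, PowerSeries.coeff_mk]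
  split_ifs
  · exact ((aPos_commute ξ γ γ i j).smul_left _).smul_right _
  · exact Commute.zero_right _
  · exact Commute.zero_left _
  · exact Commute.zero_left _

theorem smul_coeff_annihilation (ξ γ : ClassFn Γ) (i : ℕ) :
    ((i + 1 : ℕ) : ℂ) • PowerSeries.coeff (i + 1) (annihilationSeries ξ γ) =
      twicePos ξ γ (i + 1) := by
  rw [annihilationSeries, PowerSeries.coeff_mk, twicePos]
  have hi : ((i + 1 : ℕ) : ℂ) ≠ 0 := Nat.cast_ne_zero.2 (Nat.succ_ne_zero i)
  split_ifs with h
  · rw [smul_smul, mul_div_cancel₀ _ hi]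
  · rw [aPos_even ξ γ h, smul_zero, smul_zero]

/-- Only odd powers occur. This is the origin of the minus sign in the second exponential of the
vertex operator. -/
theorem negArg_annihilation (ξ γ : ClassFn Γ) :
    negArg (annihilationSeries ξ γ) = -annihilationSeries ξ γ := by
  ext1 n
  rw [coeff_negArg, map_neg, annihilationSeries, PowerSeries.coeff_mk]
  split_ifs with h
  · rw [h.neg_one_pow]
    exact neg_one_smul ℂ (((2 : ℂ) / n) • aPos ξ γ n)
  · simp

/-- By induction on n: in the recursion for the exponential, the leading factor 2a_{i+1}(γ) removes
one cycle by `twicePos_fockOf` and the other factor is a weighted average over types of size n - i.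
Summing over cycles rebuilds `avgType_succ` for the average over types of size n + 1. -/
theorem coeff_seriesExp_annihilation (ξ γ : ClassFn Γ) (n : ℕ) : ∀ (m : ℕ)
    (F : (ConjClasses Γ → Multiset ℕ) → ℂ),
    PowerSeries.coeff n (seriesExp (annihilationSeries ξ γ)) (fockOf m F) =
      if n ≤ m then fockOf (m - n) fun σ =>
        avgType n fun ρ => typeProd (cycleWeight ξ γ) ρ * F (ρ + σ) else 0 := by
  induction n using Nat.strong_induction_on with
  | _ n ih =>
  intro m F
  rcases n with _ | n
  · rw [coeff_zero_seriesExp, if_pos (Nat.zero_le _), Module.End.one_apply, Nat.sub_zero]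
    simp only [avgType_zero, typeProd_zero, one_mul, zero_add]
  have hn : ((n + 1 : ℕ) : ℂ) ≠ 0 := Nat.cast_ne_zero.2 (Nat.succ_ne_zero n)
  refine smul_right_injective _ hn ?_
  show ((n + 1 : ℕ) : ℂ) • _ = ((n + 1 : ℕ) : ℂ) • _
  rw [← LinearMap.smul_apply, coeff_succ_seriesExp (annihilation_coeff_zero ξ γ)
    (annihilation_commute ξ γ), LinearMap.sum_apply]
  have h1 : ∀ x ∈ Finset.HasAntidiagonal.antidiagonal n,
      ((((x.1 + 1 : ℕ) : ℂ) • PowerSeries.coeff (x.1 + 1) (annihilationSeries ξ γ)) *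
        PowerSeries.coeff x.2 (seriesExp (annihilationSeries ξ γ))) (fockOf m F) =
      if n + 1 ≤ m then ∑ c, ((zeta c)⁻¹ * cycleWeight ξ γ (x.1 + 1) c) •
        fockOf (m - (n + 1)) (fun σ => avgType x.2 fun ρ => typeProd (cycleWeight ξ γ) ρ *
          F (ρ + (oneCycle c (x.1 + 1) + σ))) else 0 := fun x hx => by
    have hx' := Finset.HasAntidiagonal.mem_antidiagonal.1 hx
    rw [smul_coeff_annihilation, Module.End.mul_apply, ih x.2 (by omega)]
    split_ifs with h h' h'
    · rw [twicePos_fockOf ξ γ _ (Nat.succ_pos _), if_pos (by omega)]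
      have e : m - x.2 - (x.1 + 1) = m - (n + 1) := by omega
      rw [e]
    · rw [twicePos_fockOf ξ γ _ (Nat.succ_pos _), if_neg (by omega)]
    · omega
    · rw [map_zero]
  rw [Finset.sum_congr rfl h1]
  split_ifs with h
  · rw [← fockOf_smul]
    simp only [← smul_eq_mul (a := ((n + 1 : ℕ) : ℂ)), avgType_succ, fockOf_sum]
    refine Finset.sum_congr rfl fun x _ => Finset.sum_congr rfl fun c _ => ?_
    rw [← fockOf_smul]
    congr 1
    funext σ
    rw [mul_assoc, ← smul_eq_mul, ← smul_eq_mul, ← avgType_smul]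
    simp only [typeProd_add, typeProd_oneCycle, smul_eq_mul, mul_assoc, add_assoc, add_left_comm]
  · simp

theorem ch_lof_eq_fockOf {n : ℕ} (f : spinSuper Γ n) :
    ch (DirectSum.lof ℂ ℕ (fun i => spinSuper Γ i) n f) = fockOf n fun ρ => valueAt ρ f := ch_lof f

theorem ch_HPos (ξ γ : ClassFn Γ) (n : ℕ) (v : RTotal Γ) :
    ch (HPos ξ γ n v) = PowerSeries.coeff n (seriesExp (annihilationSeries ξ γ)) (ch v) := by
  have : ch ∘ₗ HPos ξ γ n =
      PowerSeries.coeff n (seriesExp (annihilationSeries ξ γ)) ∘ₗ (ch (Γ := Γ)) := by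
    refine DirectSum.linearMap_ext ℂ fun m => LinearMap.ext fun f => ?_
    rw [LinearMap.comp_apply, LinearMap.comp_apply, LinearMap.comp_apply, LinearMap.comp_apply, HPos,
      DirectSum.toModule_lof, ch_lof_eq_fockOf, coeff_seriesExp_annihilation]
    split_ifs with h
    · rw [LinearMap.comp_apply, ch_lof_eq_fockOf, fockOf, fockOf, avgType_eq_sum_wreathSubgroup,
        avgType_eq_sum_wreathSubgroup]
      congr 1
      refine Finset.sum_congr rfl fun w _ => ?_
      rw [valueAt_resChi _ _ _ _ w.2]
    · rw [LinearMap.zero_apply, map_zero]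
  exact DFunLike.congr_fun this v

/-- On the summand of degree m the operators H_n with n > m are zero. -/
theorem isLocallyFinite_HMinus (ξ γ : ClassFn Γ) : IsLocallyFinite (HMinus ξ γ) := by
  intro v
  induction v using DirectSum.induction_on with
  | zero => simp
  | of m f =>
    refine (Set.finite_Iic m).subset fun n hn => ?_
    by_contra h
    refine hn ?_
    rw [HMinus, PowerSeries.coeff_mk, HPos]
    refine (DirectSum.toModule_lof (M := fun i => spinSuper Γ i) ℂ m f).trans ?_
    rw [dif_neg (show ¬ n ≤ m from h), LinearMap.zero_apply]
  | add s t hs ht =>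
    refine (hs.union ht).subset fun n hn => ?_
    by_contra hne
    rw [Set.mem_union, not_or] at hne
    simp only [Set.mem_ofPred_eq, not_not] at hne
    exact hn (by rw [map_add, hne.1, hne.2, add_zero])

theorem isLocallyFinite_negArg {V : Type*} [AddCommMonoid V] [Module ℂ V]
    {A : PowerSeries (Module.End ℂ V)} (hA : IsLocallyFinite A) : IsLocallyFinite (negArg A) := by
  intro v
  refine (hA v).subset fun n hn h0 => hn ?_
  rw [coeff_negArg, LinearMap.smul_apply, h0, smul_zero]

end Annihilation

/-! ### Bijectivity of the characteristic map and transport of H_±. -/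

section Bijectivity

variable {Γ : Type*} [Group Γ] [Fintype Γ]

/-- The augmentation kills every generator, hence everything of positive degree. -/
theorem algebraMapInv_fockOf (m : ℕ) (F : (ConjClasses Γ → Multiset ℕ) → ℂ) :
    SymmetricAlgebra.algebraMapInv (fockOf m F) = if m = 0 then F 0 else 0 := by
  have h0 : ∀ (i : ℕ) (c : ConjClasses Γ), SymmetricAlgebra.algebraMapInv (aNegClass i c) = (0 : ℂ) :=
    fun i c => by
      rw [aNegClass, aNeg]
      split_ifs
      · exact SymmetricAlgebra.algebraMapInv_ι _
      · exact map_zero _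
  rcases m with _ | m
  · rw [fockOf_zero, if_pos rfl]
    exact SymmetricAlgebra.algebraMap_leftInverse _ _
  · rw [if_neg (Nat.succ_ne_zero m)]
    have hm : ((m + 1 : ℕ) : ℂ) ≠ 0 := Nat.cast_ne_zero.2 (Nat.succ_ne_zero m)
    refine smul_right_injective _ hm ?_
    show ((m + 1 : ℕ) : ℂ) • _ = ((m + 1 : ℕ) : ℂ) • _
    rw [← map_smul, fockOf_succ, smul_zero]
    simp [h0]

/-- With weight ξ = 1 and γ supported on the inverse class of c, the derivation 2a_i(γ) removes only
cycles of class c. These auxiliary operators are independent of the given ξ. -/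
theorem cycleWeight_single (c d : ConjClasses Γ) {i : ℕ} (hi : Odd i) :
    cycleWeight 1 (Pi.single (invClass c) 1) i d = if d = c then 1 else 0 := by
  rw [cycleWeight, if_pos hi, Pi.one_apply, one_mul, Pi.single_apply]
  have : invClass d = invClass c ↔ d = c :=
    ⟨fun h => by rw [← invClass_invClass d, h, invClass_invClass], fun h => by rw [h]⟩
  simp only [this]

/-- The coefficient at `ρ` can be read off by a linear functional. -/
theorem exists_functional (n : ℕ) : ∀ ρ : ConjClasses Γ → Multiset ℕ, (∀ c, ∀ i ∈ ρ c, Odd i) →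
    typeSize ρ = n → ∃ (L : Fock Γ →ₗ[ℂ] ℂ) (k : ℂ), k ≠ 0 ∧
      ∀ m F, L (fockOf m F) = if m = n then k * F ρ else 0 := by
  induction n using Nat.strong_induction_on with
  | _ n ih =>
  intro ρ hρ hn
  by_cases h0 : ∀ c, ρ c = 0
  · have hρ0 : ρ = 0 := funext h0
    subst hρ0
    have hn0 : n = 0 := by rw [← hn]; simp [typeSize]
    subst hn0
    refine ⟨SymmetricAlgebra.algebraMapInv.toLinearMap, 1, one_ne_zero, fun m F => ?_⟩
    rw [one_mul]
    exact algebraMapInv_fockOf m F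
  · push Not at h0
    obtain ⟨c, hc⟩ := h0
    obtain ⟨i, hi⟩ := Multiset.exists_mem_of_ne_zero hc
    have hio := hρ c i hi
    obtain ⟨σ, rfl⟩ := exists_oneCycle_add hi
    rw [typeSize_oneCycle_add] at hn
    obtain ⟨L, k, hk, hL⟩ := ih (typeSize σ) (by have := hio.pos; omega) σ
      (fun d j hj => hρ d j (Multiset.mem_add.2 (Or.inr hj))) rfl
    -- A cycle (c, i) of ρ is removed by a derivation selecting its class, and the functional for
    -- the remaining type σ is then applied; the removal multiplies the constant by ζ_c⁻¹.
    refine ⟨L ∘ₗ twicePos 1 (Pi.single (invClass c) 1) i, (zeta c)⁻¹ * k,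
      mul_ne_zero (inv_ne_zero (zeta_ne_zero c)) hk, fun m F => ?_⟩
    rw [LinearMap.comp_apply, twicePos_fockOf _ _ _ hio.pos]
    simp only [cycleWeight_single _ _ hio]
    split_ifs with h1 h2 h2
    · rw [map_sum, Finset.sum_eq_single c]
      · rw [map_smul, hL, if_pos rfl, if_pos (by omega), smul_eq_mul, mul_one, mul_assoc]
      · intro d _ hd
        rw [if_neg hd, mul_zero, zero_smul, map_zero]
      · simp
    · rw [map_sum, Finset.sum_eq_zero]
      intro d _
      rw [map_smul, hL, if_neg (show ¬ m - i = typeSize σ by omega), smul_zero]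
    · omega
    · rw [map_zero]

/-- The functional of `exists_functional` recovers, up to a nonzero constant, the value of the
degree n component at any odd type; by `spinSuper_eq_zero` these values determine the component. -/
theorem ch_injective : Function.Injective (ch (Γ := Γ)) := by
  intro v w hvw
  refine DFinsupp.ext fun n => sub_eq_zero.1 (Subtype.ext (funext fun x => ?_))
  refine spinSuper_eq_zero (v n - w n).2 (fun g s hs => ?_) x
  have hodd : ∀ c, ∀ i ∈ wreathType g s c, Odd i := fun c i hi => by
    rw [wreathType] at hi
    obtain ⟨q, -, rfl⟩ := Multiset.mem_map.1 hi
    exact hs _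
  obtain ⟨L, k, hk, hL⟩ := exists_functional n (wreathType g s) hodd (typeSize_wreathType g s)
  have h : L ∘ₗ ch = k • valueAt (wreathType g s) ∘ₗ
      DirectSum.component ℂ ℕ (fun i => spinSuper Γ i) n := by
    refine DirectSum.linearMap_ext ℂ fun m => LinearMap.ext fun f => ?_
    rw [LinearMap.comp_apply, LinearMap.comp_apply, ch_lof_eq_fockOf, hL]
    split_ifs with hm
    · subst hm
      simp [DirectSum.component.lof_self]
    · simp [DirectSum.component.of, hm]
  have h1 : ∀ u : RTotal Γ, L (ch u) = k * valueAt (wreathType g s) (u n) :=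
    fun u => DFunLike.congr_fun h u
  have h2 : valueAt (wreathType g s) (v n) = valueAt (wreathType g s) (w n) :=
    mul_left_cancel₀ hk (by rw [← h1, ← h1, hvw])
  rw [← valueAt_wreathType, map_sub, h2, sub_self]

/-- The spin super class function on `Γ̃_0 = ⟨z⟩` with value `1` at the identity. -/
noncomputable def vacuum (Γ : Type*) [Group Γ] : spinSuper Γ 0 :=
  ⟨fun x => sgn x.left.2.zexp, by
    have hmul : ∀ x y : BG Γ 0, (x * y).left.2.zexp = x.left.2.zexp + y.left.2.zexp := fun x y => by
      show x.left.2.zexp + (y.left.2.zexp + ∑ i : Fin 0, _) + ∑ i : Fin 0, _ = _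
      rw [Fin.sum_univ_zero, Fin.sum_univ_zero, add_zero, add_zero]
    have hone : (1 : BG Γ 0).left.2.zexp = 0 := rfl
    refine ⟨fun x y => ?_, fun x => ?_, fun x hx => ?_⟩
    · have h1 := hmul y y⁻¹
      rw [mul_inv_cancel, hone] at h1
      show sgn (y * x * y⁻¹).left.2.zexp = sgn x.left.2.zexp
      rw [hmul, hmul, add_right_comm, ← h1, zero_add]
    · show sgn (zBG 0 * x).left.2.zexp = - sgn x.left.2.zexp
      have hz : (zBG 0 : BG Γ 0).left.2.zexp = 1 := rfl
      rw [hmul, hz, sgn_add, sgn_one, neg_one_mul]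
    · simp [parity] at hx⟩

theorem ch_vacuum : ch (DirectSum.lof ℂ ℕ (fun i => spinSuper Γ i) 0 (vacuum Γ)) = 1 := by
  have h : valueAt (0 : ConjClasses Γ → Multiset ℕ) (vacuum Γ) = 1 := sgn_zero
  rw [ch_lof_eq_fockOf, fockOf_zero, h, map_one]

/-- Newton's identity is solved for its top term: the summand (n, 0) is 2 a_{-(n+1)}(γ), and all the
others involve earlier a_{-j}(γ). -/
theorem aNeg_mem {S : Subalgebra ℂ (Fock Γ)} (γ : ClassFn Γ) (hS : ∀ n, chImage γ n ∈ S) (n : ℕ) :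
    aNeg (n + 1) γ ∈ S := by
  induction n using Nat.strong_induction_on with
  | _ n ih =>
  have h := chImage_succ γ n
  rw [← Finset.add_sum_erase _ _ (Finset.HasAntidiagonal.mem_antidiagonal.2 (by simp) :
    (n, 0) ∈ Finset.HasAntidiagonal.antidiagonal n)] at h
  simp only [chImage_zero, mul_one] at h
  have h2 : (2 : ℂ) • aNeg (n + 1) γ ∈ S := by
    rw [eq_sub_of_add_eq h.symm]
    refine sub_mem (S.smul_mem (hS _) _) (sum_mem fun x hx => mul_mem (S.smul_mem (ih x.1 ?_) _) (hS _))
    have h3 := Finset.mem_erase.1 hx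
    have h4 := Finset.HasAntidiagonal.mem_antidiagonal.1 h3.2
    have h5 : x.2 ≠ 0 := fun h5 => h3.1 (Prod.ext (by simp; omega) h5)
    omega
  have h3 := S.smul_mem h2 (2 : ℂ)⁻¹
  rwa [inv_smul_smul₀ two_ne_zero] at h3

/-- The elements whose multiplication preserves the range form a subalgebra. It contains all
`chImage γ n` because these implement H_{-n}(γ), hence all generators of the Fock space; multiplying
the image 1 of the vacuum by an arbitrary element finishes the argument. -/
theorem ch_surjective : Function.Surjective (ch (Γ := Γ)) := by
  let S : Subalgebra ℂ (Fock Γ) :=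
    { carrier := {a | ∀ v ∈ LinearMap.range (ch (Γ := Γ)), a * v ∈ LinearMap.range (ch (Γ := Γ))}
      mul_mem' := fun {a b} ha hb v hv => by
        rw [mul_assoc]
        exact ha _ (hb v hv)
      add_mem' := fun {a b} ha hb v hv => by
        rw [add_mul]
        exact add_mem (ha v hv) (hb v hv)
      algebraMap_mem' := fun r v hv => by
        rw [← Algebra.smul_def]
        exact Submodule.smul_mem _ _ hv }
  have hS : ∀ (γ : ClassFn Γ) (n : ℕ), chImage γ n ∈ S := fun γ n v hv => by
    obtain ⟨u, rfl⟩ := hv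
    exact ⟨HNeg γ n u, ch_HNeg γ n u⟩
  have htop : ∀ a : Fock Γ, a ∈ S := fun a => by
    induction a using SymmetricAlgebra.induction with
    | algebraMap r => exact S.algebraMap_mem r
    | ι w =>
      induction w using Finsupp.induction_linear with
      | zero => rw [map_zero]; exact zero_mem S
      | add u v hu hv => rw [map_add]; exact add_mem hu hv
      | single i γ =>
        obtain ⟨i, hi⟩ := i
        obtain ⟨j, rfl⟩ : ∃ j, i = j + 1 := ⟨i - 1, by have := hi.pos; omega⟩
        have := aNeg_mem γ (hS γ) j
        rwa [aNeg, dif_pos hi] at this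
    | mul a b ha hb => exact mul_mem ha hb
    | add a b ha hb => exact add_mem ha hb
  intro a
  have := htop a 1 ⟨_, ch_vacuum⟩
  rwa [mul_one] at this

/-- The characteristic map as a linear isomorphism. -/
noncomputable def chEquiv (Γ : Type*) [Group Γ] [Fintype Γ] : RTotal Γ ≃ₗ[ℂ] Fock Γ :=
  LinearEquiv.ofBijective ch ⟨ch_injective, ch_surjective⟩

theorem chEquiv_apply (v : RTotal Γ) : chEquiv Γ v = ch v := rfl

theorem transport_HPlus (γ : ClassFn Γ) :
    transport (chEquiv Γ) (HPlus γ) = seriesExp (creationSeries γ) := by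
  ext1 n
  refine LinearMap.ext fun v => ?_
  rw [coeff_transport, LinearEquiv.conj_apply_apply, chEquiv_apply, HPlus, PowerSeries.coeff_mk,
    ch_HNeg, ← chEquiv_apply, LinearEquiv.apply_symm_apply, ← mulLeft_chImage]
  rfl

theorem transport_HMinus (ξ γ : ClassFn Γ) :
    transport (chEquiv Γ) (HMinus ξ γ) = seriesExp (annihilationSeries ξ γ) := by
  ext1 n
  refine LinearMap.ext fun v => ?_
  rw [coeff_transport, LinearEquiv.conj_apply_apply, chEquiv_apply, HMinus, PowerSeries.coeff_mk,
    ch_HPos, ← chEquiv_apply, LinearEquiv.apply_symm_apply]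

theorem transport_negArg_HMinus (ξ γ : ClassFn Γ) :
    transport (chEquiv Γ) (negArg (HMinus ξ γ)) = seriesExp (-annihilationSeries ξ γ) := by
  rw [transport_negArg, transport_HMinus, negArg_seriesExp (annihilation_coeff_zero ξ γ)
    (annihilation_commute ξ γ), negArg_annihilation]

end Bijectivity

end SpinWreath

/-! ### The theorem. -/

theorem mainTheorem10 {Γ : Type*} [Group Γ] [Fintype Γ] (ξ : SpinWreath.ClassFn Γ)
    (hξ : ξ ∈ SpinWreath.virtualChars Γ)
    (hdual : ∀ x : Γ, ξ (ConjClasses.mk x⁻¹) = ξ (ConjClasses.mk x)) :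
    ∃ chEquiv : SpinWreath.RTotal Γ ≃ₗ[ℂ] SpinWreath.Fock Γ, (∀ f, chEquiv f = SpinWreath.ch f) ∧
      (∀ γ : SpinWreath.ClassFn Γ,
        SpinWreath.transport chEquiv (SpinWreath.HPlus γ) = SpinWreath.seriesExp (SpinWreath.creationSeries γ) ∧
        SpinWreath.transport chEquiv (SpinWreath.HMinus ξ γ) = SpinWreath.seriesExp (SpinWreath.annihilationSeries ξ γ)) ∧
      ∀ (M : SpinWreath.TwistedModule ξ) (γ : SpinWreath.virtualChars Γ),
        SpinWreath.IsLocallyFinite (SpinWreath.tensorId M.L (SpinWreath.negArg (SpinWreath.HMinus ξ γ.1))) ∧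
        SpinWreath.IsLocallyFinite (SpinWreath.tensorId M.L (SpinWreath.seriesExp (-SpinWreath.annihilationSeries ξ γ.1))) ∧
        ∀ n : ℤ, (TensorProduct.congr chEquiv (LinearEquiv.refl ℂ M.L)).conj (M.X γ n) =
          M.flmX γ n := by
  open SpinWreath in
  refine ⟨SpinWreath.chEquiv Γ, chEquiv_apply, fun γ => ⟨transport_HPlus γ, transport_HMinus ξ γ⟩,
    fun M γ => ?_⟩
  have h1 : IsLocallyFinite (negArg (HMinus ξ γ.1)) :=
    isLocallyFinite_negArg (isLocallyFinite_HMinus ξ γ.1)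
  -- Local finiteness is clear on the group side by degree; ch carries it to the exponential on the
  -- Fock space.
  have h2 : IsLocallyFinite (seriesExp (-annihilationSeries ξ γ.1)) := by
    rw [← transport_negArg_HMinus]
    exact h1.transport _
  refine ⟨h1.tensorId M.L, h2.tensorId M.L, fun n => ?_⟩
  rw [TwistedModule.X, TwistedModule.flmX, Module.End.mul_eq_comp, LinearEquiv.conj_comp, conj_mulCoeff _ _ (h1.tensorId M.L),
    transport_tensorId, transport_tensorId, transport_HPlus, transport_negArg_HMinus,
    TwistedModule.eOp, TwistedModule.eOp, congr_conj_lTensor]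
  rfl
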